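/- Let $\mathcal{R}$ be a first-order expansion of the ordered additive group $(\mathbb{R},<,+)$. "Definable" means definable in $\mathcal{R}$, possibly with parameters. Say that $\mathcal{R}$ is of field-type if there are a nonempty bounded open interval $I \subseteq \mathbb{R}$ and definable operations $\oplus,\otimes : I^2 \to I$ such that $(I,<,\oplus,\otimes)$ is an ordered field isomorphic to $(\mathbb{R},<,+,\cdot)$. Say that $\mathcal{R}$ defines an isomorphic copy of second-order arithmetic if there are definable sets $S \subseteq \mathbb{R}^m$ and $N \subseteq \mathbb{R}^n$ (for some $m,n$), a definable relation $E \subseteq N \times S$ and definable operations $A, M : N^2 \to N$ such that the two-sorted structure $(S,N,E,A,M)$ is isomorphic to $(\mathcal{P}(\mathbb{N}),\mathbb{N},\in,+,\cdot)$. (a) Let $I$ be a nonempty bounded open interval and let $f : I \to \mathbb{R}$ be definable, $C^1$ and non-affine. (1) If $f'$ is strictly increasing or strictly decreasing on some nonempty open subinterval of $I$, then $\mathcal{R}$ is of field-type. (2) If $f'$ is not strictly increasing or strictly decreasing on any nonempty open subinterval of $I$, then $\mathcal{R}$ defines an isomorphic copy of $(\mathcal{P}(\mathbb{N}),\mathbb{N},\in,+,\cdot)$.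 In particular, if $f$ is $C^2$, then $\mathcal{R}$ is of field-type. (b) Suppose that $\mathcal{R}$ does not define an isomorphic copy of $(\mathcal{P}(\mathbb{N}),\mathbb{N},\in,+,\cdot)$. Then the following are equivalent: (1) $\mathcal{R}$ defines a non-affine $C^1$ function $f : I \to \mathbb{R}$ on some nonempty bounded open interval $I$; (2) $\mathcal{R}$ is of field-type. -/

import Mathlib

universe u v

namespace RealExpansion

/-- Function symbols of the language of ordered additive groups: one binary symbol `+`. -/
inductive OrdAddFunc : ℕ → Type
  | add : OrdAddFunc 2

/-- Relation symbols of the language of ordered additive groups: one binary symbol `<`. -/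
inductive OrdAddRel : ℕ → Type
  | lt : OrdAddRel 2

/-- The language `{<, +}`. -/
def ordAddLang : FirstOrder.Language.{0, 0} := ⟨OrdAddFunc, OrdAddRel⟩

/-- The ordered additive group `(ℝ, <, +)` as a first-order structure. -/
instance ordAddStructure : ordAddLang.Structure ℝ where
  funMap := fun {_} f =>
    match f with
    | OrdAddFunc.add => fun v => v 0 + v 1
  RelMap := fun {_} r =>
    match r with
    | OrdAddRel.lt => fun v => v 0 < v 1

section

variable (L : FirstOrder.Language.{u, v}) [L.Structure ℝ]

/-- A set of (possibly multi-dimensional) real tuples is definable in the `L`-structure on `ℝ`,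
with arbitrary real parameters. -/
def IsDef {α : Type} (s : Set (α → ℝ)) : Prop :=
  (Set.univ : Set ℝ).Definable L s

/-- The restriction of `f` to `(a, b)` is definable, i.e. its graph over `(a, b)` is. -/
def IsDefFunOn (f : ℝ → ℝ) (a b : ℝ) : Prop :=
  IsDef L {p : Fin 2 → ℝ | p 0 ∈ Set.Ioo a b ∧ p 1 = f (p 0)}

/-- A binary operation on the interval `(a, b)` is definable, i.e. its graph is. -/
def IsDefIntervalOp {a b : ℝ} (op : Set.Ioo a b → Set.Ioo a b → Set.Ioo a b) : Prop :=
  IsDef L {p : Fin 3 → ℝ | ∃ x y : Set.Ioo a b, p 0 = x ∧ p 1 = y ∧ p 2 = op x y}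

/-- A binary operation on a set `X` of real tuples is definable, i.e. its graph is. -/
def IsDefOp {α : Type} {X : Set (α → ℝ)} (op : X → X → X) : Prop :=
  IsDef L {p : α ⊕ (α ⊕ α) → ℝ | ∃ x y : X,
    p = Sum.elim (x : α → ℝ) (Sum.elim (y : α → ℝ) (op x y : α → ℝ))}

/-- A relation between two sets `X`, `Y` of real tuples is definable. -/
def IsDefRel {α β : Type} {X : Set (α → ℝ)} {Y : Set (β → ℝ)} (r : X → Y → Prop) : Prop :=
  IsDef L {p : α ⊕ β → ℝ | ∃ (x : X) (y : Y),
    p = Sum.elim (x : α → ℝ) (y : β → ℝ) ∧ r x y}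

/-- Field-type: on some nonempty bounded open interval `I` there are definable operations `⊕`, `⊗`
for which `(I, <, ⊕, ⊗)` is isomorphic to the ordered field `(ℝ, <, +, ·)`. -/
def IsFieldType : Prop :=
  ∃ (a b : ℝ), a < b ∧ ∃ oplus otimes : Set.Ioo a b → Set.Ioo a b → Set.Ioo a b,
    IsDefIntervalOp L oplus ∧ IsDefIntervalOp L otimes ∧
    ∃ τ : Set.Ioo a b ≃o ℝ,
      (∀ x y, τ (oplus x y) = τ x + τ y) ∧ (∀ x y, τ (otimes x y) = τ x * τ y)

/-- The structure defines an isomorphic copy of the two-sorted structure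
`(𝒫(ℕ), ℕ, ∈, +, ·)`: there are definable sets `S` (the sort of sets) and `N` (the sort of
numbers), a definable relation between `N` and `S` and two definable binary operations on `N`
that form a two-sorted structure isomorphic to it. -/
def DefinesSecondOrderArithmetic : Prop :=
  ∃ (m n : ℕ) (S : Set (Fin m → ℝ)) (N : Set (Fin n → ℝ)),
    IsDef L S ∧ IsDef L N ∧
    ∃ (mem : N → S → Prop) (add mul : N → N → N),
      IsDefRel L mem ∧ IsDefOp L add ∧ IsDefOp L mul ∧
      ∃ (σ : S ≃ Set ℕ) (ν : N ≃ ℕ),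
        (∀ x X, mem x X ↔ ν x ∈ σ X) ∧
        (∀ x y, ν (add x y) = ν x + ν y) ∧
        (∀ x y, ν (mul x y) = ν x * ν y)

end

/-- `f` is affine on `(a, b)`. -/
def IsAffineOn (f : ℝ → ℝ) (a b : ℝ) : Prop :=
  ∃ m c : ℝ, ∀ x ∈ Set.Ioo a b, f x = m * x + c

/-- `f'` is strictly increasing or strictly decreasing on some nonempty open subinterval
of `(a, b)`. -/
def DerivStrictMonoSomewhere (f : ℝ → ℝ) (a b : ℝ) : Prop :=
  ∃ c d : ℝ, c < d ∧ Set.Ioo c d ⊆ Set.Ioo a b ∧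
    (StrictMonoOn (deriv f) (Set.Ioo c d) ∨ StrictAntiOn (deriv f) (Set.Ioo c d))

end RealExpansion

namespace RealExpansion

/-! Part (a). Let a point `x` stand for the slope `g x = f'(x)`. The germs `t ↦ f (x + t) - f x` are
definable from `+`; adding germs adds slopes and composing them multiplies slopes. Eventual
comparison of germs is blind to ties, but `SlopeData.lt_iff` recovers the exact order of slopes,
because `f` is not affine on an interval where `f'` varies. Once `f` is replaced by `n f - m x`, its
slopes cover `[-9, 9]`, identities between bounded polynomial terms in slopes become definable, and
stretching `(-1, 1)` onto `ℝ` yields a definable copy of the real field on slopes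
(`SlopeData.def_field`). If `f'` is strictly monotone on an interval, slopes are parametrised by an
interval, which is field-type. Otherwise the leftmost point of each slope serves as its
representative, and `f'` becomes a continuous, nowhere monotone function into a definable real
field. For each `r > 0` only finitely many values are attained at local extrema of radius at least
`r`, yet extremal values are dense.

Such a situation produces second-order arithmetic. `secondOrderArith_of_superlevel` turns it into a
rank function for which points of rank at least `r` are `r`-separated while points of positive rank
are dense. A fast sequence of such points, recoverable from its limit, plays the role of `ℕ`
(`Tower`). For a real `c`, the largest points of successive ranks below `c` form a branch of a tree.
The offset of `c` at level `k`, measured in units of the rank, can be prescribed at all levels at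
once, so one real codes a whole function on `ℕ`; staying or moving to the next point at each level
codes a subset of `ℕ`.

Part (b). One direction is (a). Conversely, let `τ : (a, b) → ℝ` be the isomorphism given by
field-type. Without second-order arithmetic, the superlevel criterion becomes a definable Baire
theorem (`FieldChart.exists_forall_mem_Ioo`). With it, and with almost everywhere differentiability
of monotone functions, `τ` is shown to have a positive derivative at some point and then to be `C¹`
with positive derivative on some interval. There `τ⁻¹ (τ u + (τ u - τ z)²)` is definable, `C¹`, and
touches the identity only at `z`, so it is not affine. -/

open Set Filter Topology

/-! ### Definability as closure under first-order operations. -/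

/-- A structure on the real line: a family of definable predicates on tuples that is closed under
first-order operations and contains all constants. -/
structure DefStr where
  Def : ∀ {α : Type}, ((α → ℝ) → Prop) → Prop
  and : ∀ {α : Type} {P Q : (α → ℝ) → Prop}, Def P → Def Q → Def fun v => P v ∧ Q v
  not : ∀ {α : Type} [Finite α] {P : (α → ℝ) → Prop}, Def P → Def fun v => ¬ P v
  ex : ∀ {α : Type} [Finite α] {P : (α → ℝ) → ℝ → Prop},
    Def (fun p : Option α → ℝ => P (fun i => p (some i)) (p none)) → Def fun v => ∃ y, P v y
  reindex : ∀ {α β : Type} [Finite β] (f : α → β) {P : (α → ℝ) → Prop},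
    Def P → Def fun v : β → ℝ => P fun i => v (f i)
  eqVar : ∀ {α : Type} [Finite α] (i j : α), Def fun v : α → ℝ => v i = v j
  eqConst : ∀ {α : Type} [Finite α] (i : α) (c : ℝ), Def fun v : α → ℝ => v i = c

namespace DefStr

variable {S : DefStr} {α β : Type}

theorem congr {P Q : (α → ℝ) → Prop} (h : S.Def P) (e : ∀ v, Q v ↔ P v) : S.Def Q := by
  rwa [funext fun v => propext (e v)]

section connectives

variable [Finite α] {P Q : (α → ℝ) → Prop}

theorem or (hP : S.Def P) (hQ : S.Def Q) : S.Def fun v => P v ∨ Q v := by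
  have := S.not (S.and (S.not hP) (S.not hQ))
  simpa only [not_and_or, not_not] using this

theorem imp (hP : S.Def P) (hQ : S.Def Q) : S.Def fun v => P v → Q v := by
  simpa only [imp_iff_not_or] using or (S.not hP) hQ

theorem all {P : (α → ℝ) → ℝ → Prop}
    (h : S.Def fun p : Option α → ℝ => P (fun i => p (some i)) (p none)) :
    S.Def fun v => ∀ y, P v y := by
  have := S.not (S.ex (P := fun v y => ¬ P v y) (S.not h))
  simpa only [not_exists, not_not] using this

theorem prop (p : Prop) : S.Def fun _ : α → ℝ => p := by
  have h : S.Def fun _ : α → ℝ => True := by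
    have := S.ex (α := α) (P := fun _ y => y = y) (S.eqVar none none)
    simpa using this
  by_cases hp : p
  · simpa [hp] using h
  · simpa [hp] using S.not h

theorem forallFinite {ι : Type} [Finite ι] {P : ι → (α → ℝ) → Prop} (h : ∀ i, S.Def (P i)) :
    S.Def fun v => ∀ i, P i v := by
  classical
  cases nonempty_fintype ι
  have : ∀ s : Finset ι, S.Def fun v => ∀ i ∈ s, P i v := by
    intro s
    induction s using Finset.induction_on with
    | empty => simpa using prop True
    | insert i s _ ih => simpa only [Finset.forall_mem_insert] using S.and (h i) ih
  simpa using this Finset.univ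

end connectives

/-- Definable real-valued functions on tuples. -/
def DFun (S : DefStr) (t : (α → ℝ) → ℝ) : Prop :=
  S.Def fun p : Option α → ℝ => p none = t fun i => p (some i)

/-- Definable unary relations. -/
def Def1 (S : DefStr) (R : ℝ → Prop) : Prop := S.Def fun v : Fin 1 → ℝ => R (v 0)

/-- Definable binary relations. -/
def Def2 (S : DefStr) (R : ℝ → ℝ → Prop) : Prop := S.Def fun v : Fin 2 → ℝ => R (v 0) (v 1)

/-- Definable ternary relations. -/
def Def3 (S : DefStr) (R : ℝ → ℝ → ℝ → Prop) : Prop :=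
  S.Def fun v : Fin 3 → ℝ => R (v 0) (v 1) (v 2)

/-- Definable unary functions. -/
def Fun1 (S : DefStr) (F : ℝ → ℝ) : Prop := S.Def2 fun x y => y = F x

/-- Definable binary functions. -/
def Fun2 (S : DefStr) (F : ℝ → ℝ → ℝ) : Prop := S.Def3 fun x y z => z = F x y

section terms

variable [Finite α]

theorem var (i : α) : S.DFun fun v : α → ℝ => v i := S.eqVar none (some i)

theorem const (c : ℝ) : S.DFun fun _ : α → ℝ => c := S.eqConst none c

theorem subst {P : (α → ℝ) → ℝ → Prop} {t : (α → ℝ) → ℝ} (ht : S.DFun t)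
    (h : S.Def fun p : Option α → ℝ => P (fun i => p (some i)) (p none)) :
    S.Def fun v => P v (t v) := by
  have := S.ex (P := fun v y => y = t v ∧ P v y) (S.and ht h)
  simpa using this

theorem DFun.weaken {t : (α → ℝ) → ℝ} (ht : S.DFun t) :
    S.DFun fun p : Option α → ℝ => t fun i => p (some i) :=
  S.reindex (α := Option α) (β := Option (Option α)) (fun o => o.elim none fun i => some (some i)) ht

theorem Def1.app {R : ℝ → Prop} (hR : S.Def1 R) {s : (α → ℝ) → ℝ} (hs : S.DFun s) :
    S.Def fun v => R (s v) :=
  subst (P := fun _ x => R x) hs (S.reindex (β := Option α) (fun _ => none) hR)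

theorem Def2.app {R : ℝ → ℝ → Prop} (hR : S.Def2 R) {s t : (α → ℝ) → ℝ} (hs : S.DFun s)
    (ht : S.DFun t) : S.Def fun v => R (s v) (t v) := by
  refine subst (P := fun v x => R x (t v)) hs ?_
  refine subst (P := fun (v : Option α → ℝ) x => R (v none) x) ht.weaken ?_
  exact S.reindex (β := Option (Option α)) ![some none, none] hR

theorem Def3.app {R : ℝ → ℝ → ℝ → Prop} (hR : S.Def3 R) {r s t : (α → ℝ) → ℝ} (hr : S.DFun r)
    (hs : S.DFun s) (ht : S.DFun t) : S.Def fun v => R (r v) (s v) (t v) := by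
  refine subst (P := fun v x => R x (s v) (t v)) hr ?_
  refine subst (P := fun (v : Option α → ℝ) x => R (v none) x (t fun i => v (some i)))
    hs.weaken ?_
  refine subst (P := fun (v : Option (Option α) → ℝ) x => R (v (some none)) (v none) x)
    ht.weaken.weaken ?_
  exact S.reindex (β := Option (Option (Option α))) ![some (some none), some none, none] hR

theorem Fun1.app {F : ℝ → ℝ} (hF : S.Fun1 F) {s : (α → ℝ) → ℝ} (hs : S.DFun s) :
    S.DFun fun v => F (s v) :=
  Def2.app (α := Option α) hF hs.weaken (var none)

theorem Fun2.app {F : ℝ → ℝ → ℝ} (hF : S.Fun2 F) {s t : (α → ℝ) → ℝ} (hs : S.DFun s)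
    (ht : S.DFun t) : S.DFun fun v => F (s v) (t v) :=
  Def3.app (α := Option α) hF hs.weaken ht.weaken (var none)

theorem eq {s t : (α → ℝ) → ℝ} (hs : S.DFun s) (ht : S.DFun t) : S.Def fun v => s v = t v :=
  Def2.app (R := fun x y => x = y) (S.eqVar 0 1) hs ht

end terms

/-- The ordered additive group of reals is definable. -/
structure OrdGroup (S : DefStr) : Prop where
  lt_rel : S.Def2 fun x y => x < y
  add_fun : S.Fun2 fun x y => x + y

/-- The ordered field of reals is definable. -/
structure OrdField (S : DefStr) : Prop extends OrdGroup S where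
  mul_fun : S.Fun2 fun x y => x * y

namespace OrdGroup

variable [Finite α] (h : S.OrdGroup) {s t : (α → ℝ) → ℝ}
include h

theorem lt (hs : S.DFun s) (ht : S.DFun t) : S.Def fun v => s v < t v := h.lt_rel.app hs ht

theorem le (hs : S.DFun s) (ht : S.DFun t) : S.Def fun v => s v ≤ t v := by
  simpa only [not_lt] using S.not (h.lt ht hs)

theorem add (hs : S.DFun s) (ht : S.DFun t) : S.DFun fun v => s v + t v := h.add_fun.app hs ht

theorem sub (hs : S.DFun s) (ht : S.DFun t) : S.DFun fun v => s v - t v := by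
  have : S.Fun2 fun x y => x - y := by
    have h1 : S.Def3 fun x y z => z + y = x := eq (h.add (var 2) (var 1)) (var 0)
    simpa only [Fun2, eq_sub_iff_add_eq] using h1
  exact this.app hs ht

theorem neg (hs : S.DFun s) : S.DFun fun v => - s v := by
  simpa only [zero_sub] using h.sub (const 0) hs

theorem nsmul (n : ℕ) (hs : S.DFun s) : S.DFun fun v => n * s v := by
  induction n with
  | zero => simpa using const 0
  | succ n ih => simpa only [Nat.cast_succ, add_mul, one_mul] using h.add ih hs

theorem zsmul (n : ℤ) (hs : S.DFun s) : S.DFun fun v => n * s v := by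
  obtain ⟨m, rfl | rfl⟩ := n.eq_nat_or_neg
  · simpa using h.nsmul m hs
  · simpa using h.neg (h.nsmul m hs)

end OrdGroup

theorem OrdField.mul [Finite α] (h : S.OrdField) {s t : (α → ℝ) → ℝ} (hs : S.DFun s)
    (ht : S.DFun t) : S.DFun fun v => s v * t v := h.mul_fun.app hs ht

/-- `A` encodes `ℕ` and `B` encodes its power set by reals, with definable ranges, membership,
addition and multiplication. -/
def SecondOrderArith (S : DefStr) : Prop :=
  ∃ (A : ℕ → ℝ) (B : Set ℕ → ℝ), A.Injective ∧ B.Injective ∧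
    S.Def1 (fun x => ∃ k, x = A k) ∧ S.Def1 (fun x => ∃ X, x = B X) ∧
    S.Def2 (fun x y => ∃ k X, x = A k ∧ y = B X ∧ k ∈ X) ∧
    S.Def3 (fun x y z => ∃ i j, x = A i ∧ y = A j ∧ z = A (i + j)) ∧
    S.Def3 (fun x y z => ∃ i j, x = A i ∧ y = A j ∧ z = A (i * j))

/-- The structure induced on `ℝ` by a definable set `X` and a bijection `τ : X → ℝ`
with inverse `σ`. -/
def pullback (S : DefStr) (X : ℝ → Prop) (hX : S.Def1 X) (τ σ : ℝ → ℝ) (hσ : ∀ y, X (σ y))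
    (hτσ : ∀ y, τ (σ y) = y) (hστ : ∀ x, X x → σ (τ x) = x) : DefStr where
  Def {α} P := S.Def fun v : α → ℝ => (∀ i, X (v i)) ∧ P fun i => τ (v i)
  and {α P Q} hP hQ := by
    have := S.and hP hQ
    convert this using 2 with v
    tauto
  not {α _ P} hP := by
    convert S.and (forallFinite fun i => hX.app (var i)) (S.not hP) using 2 with v
    tauto
  ex {α _ P} h := by
    have := S.ex (P := fun v y => (∀ i, X (v i)) ∧ X y ∧ P (fun i => τ (v i)) (τ y)) (by
      convert h using 2 with v
      simp only [Option.forall]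
      tauto)
    convert this using 2 with v
    constructor
    · rintro ⟨h1, y, hy⟩
      exact ⟨σ y, h1, hσ y, by rwa [hτσ]⟩
    · rintro ⟨y, h1, -, h2⟩
      exact ⟨h1, _, h2⟩
  reindex {α β _} f P h := by
    convert S.and (forallFinite fun i => hX.app (var i)) (S.reindex f h) using 2 with v
    exact ⟨fun h => ⟨h.1, fun i => h.1 _, h.2⟩, fun h => ⟨h.1, h.2.2⟩⟩
  eqVar {α _} i j := by
    convert S.and (forallFinite fun i => hX.app (var i)) (S.eqVar i j) using 2 with v
    refine and_congr_right fun h => ⟨fun e => ?_, fun e => congrArg τ e⟩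
    change τ (v i) = τ (v j) at e
    rw [← hστ _ (h i), e, hστ _ (h j)]
  eqConst {α _} i c := by
    convert S.and (forallFinite fun i => hX.app (var i)) (S.eqConst i (σ c)) using 2 with v
    refine and_congr_right fun h => ⟨fun e => ?_, fun e => (congrArg τ e).trans (hτσ c)⟩
    change τ (v i) = c at e
    rw [← e, hστ _ (h i)]

theorem pullback_def_iff {X : ℝ → Prop} {hX : S.Def1 X} {τ σ : ℝ → ℝ}
    {hσ : ∀ y, X (σ y)} {hτσ : ∀ y, τ (σ y) = y} {hστ : ∀ x, X x → σ (τ x) = x}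
    {P : (α → ℝ) → Prop} : (S.pullback X hX τ σ hσ hτσ hστ).Def P ↔
      S.Def fun v : α → ℝ => (∀ i, X (v i)) ∧ P fun i => τ (v i) := Iff.rfl

/-- The codes are moved into `X` by `σ`. A relation of the induced structure is by definition a
relation between points of `X` in the original one, so only the equivalence `x = σ y ↔ X x ∧ τ x =
y` is needed. -/
theorem SecondOrderArith.of_pullback {X : ℝ → Prop} {hX : S.Def1 X} {τ σ : ℝ → ℝ}
    {hσ : ∀ y, X (σ y)} {hτσ : ∀ y, τ (σ y) = y} {hστ : ∀ x, X x → σ (τ x) = x}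
    (h : (S.pullback X hX τ σ hσ hτσ hστ).SecondOrderArith) : S.SecondOrderArith := by
  obtain ⟨A, B, hA, hB, dA, dB, dmem, dadd, dmul⟩ := h
  have hinj : σ.Injective := fun x y e => by rw [← hτσ x, e, hτσ]
  have key : ∀ x y, x = σ y ↔ X x ∧ τ x = y := fun x y =>
    ⟨fun e => by rw [e]; exact ⟨hσ y, hτσ y⟩, fun e => by rw [← e.2, hστ _ e.1]⟩
  simp only [Def1, Def2, Def3, pullback_def_iff, Fin.forall_fin_succ, Fin.forall_fin_zero,
    ] at dA dB dmem dadd dmul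
  refine ⟨fun k => σ (A k), fun Y => σ (B Y), hinj.comp hA, hinj.comp hB, ?_, ?_, ?_, ?_, ?_⟩
  · refine congr dA fun v => ?_
    simp [key]
  · refine congr dB fun v => ?_
    simp [key]
  · refine congr dmem fun v => ?_
    simp only [key]
    grind
  · refine congr dadd fun v => ?_
    simp only [key]
    grind
  · refine congr dmul fun v => ?_
    simp only [key]
    grind

end DefStr

/-! ### First-order languages as instances of `DefStr`. -/

section language

variable (L : FirstOrder.Language.{u, v}) [L.Structure ℝ]

/-- The structure of sets definable with parameters in a first-order structure on `ℝ`. -/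
def langStr : DefStr where
  Def P := IsDef L {v | P v}
  and hP hQ := hP.inter hQ
  not hP := hP.compl
  ex {α _ P} h := by
    have := Set.Definable.image_comp h (some : α → Option α)
    refine (congrArg (IsDef L) ?_).mpr this
    ext v
    simp only [Set.mem_ofPred_eq, Set.mem_image]
    constructor
    · rintro ⟨y, hy⟩
      exact ⟨fun o => o.elim y v, hy, rfl⟩
    · rintro ⟨p, hp, rfl⟩
      exact ⟨_, hp⟩
  reindex f _ h := h.preimage_comp f
  eqVar {α _} i j := by
    simpa [IsDef] using Set.Definable.preimage_comp ![i, j]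
      (Set.Definable.diagonal (L := L) (M := ℝ) Set.univ)
  eqConst {α _} i c := by
    simpa [IsDef] using Set.Definable.preimage_comp (fun _ => i)
      (Set.Definable.singleton_of_mem (L := L) (Set.mem_univ c))

theorem langStr_ordGroup (φ : ordAddLang →ᴸ L) [φ.IsExpansionOn ℝ] : (langStr L).OrdGroup where
  lt_rel := by
    have h : (∅ : Set ℝ).Definable ordAddLang {v : Fin 2 → ℝ | v 0 < v 1} := by
      rw [Set.empty_definable_iff]
      exact ⟨FirstOrder.Language.Relations.formula (L := ordAddLang) OrdAddRel.lt
        ![.var 0, .var 1], by ext v; exact Iff.rfl⟩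
    exact (h.map_expansion φ).mono (Set.empty_subset _)
  add_fun := by
    have h : (∅ : Set ℝ).Definable ordAddLang {v : Fin 3 → ℝ | v 2 = v 0 + v 1} := by
      rw [Set.empty_definable_iff]
      exact ⟨FirstOrder.Language.Term.equal (.var 2)
        (.func (L := ordAddLang) (l := 2) OrdAddFunc.add ![.var 0, .var 1]),
        by ext v; simp [FirstOrder.Language.Formula.realize_equal]; exact Iff.rfl⟩
    exact (h.map_expansion φ).mono (Set.empty_subset _)

theorem definesSecondOrderArithmetic_of_langStr (h : (langStr L).SecondOrderArith) :
    DefinesSecondOrderArithmetic L := by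
  obtain ⟨A, B, hA, hB, dA, dB, dmem, dadd, dmul⟩ := h
  let N : Set (Fin 1 → ℝ) := {v | ∃ k, v 0 = A k}
  let T : Set (Fin 1 → ℝ) := {v | ∃ X, v 0 = B X}
  have hN : Function.Bijective fun k : ℕ => (⟨fun _ => A k, k, rfl⟩ : N) := by
    constructor
    · intro k l e
      exact hA (congrFun (congrArg Subtype.val e) 0)
    · rintro ⟨v, k, hk⟩
      exact ⟨k, Subtype.ext (funext fun i => by rw [Subsingleton.elim i 0]; exact hk.symm)⟩
  have hT : Function.Bijective fun X : Set ℕ => (⟨fun _ => B X, X, rfl⟩ : T) := by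
    constructor
    · intro k l e
      exact hB (congrFun (congrArg Subtype.val e) 0)
    · rintro ⟨v, k, hk⟩
      exact ⟨k, Subtype.ext (funext fun i => by rw [Subsingleton.elim i 0]; exact hk.symm)⟩
  let eN := Equiv.ofBijective _ hN
  let eT := Equiv.ofBijective _ hT
  have op_def : ∀ f : ℕ → ℕ → ℕ,
      (langStr L).Def3 (fun x y z => ∃ i j, x = A i ∧ y = A j ∧ z = A (f i j)) →
      IsDefOp L (X := N) fun x y => eN (f (eN.symm x) (eN.symm y)) := by
    intro f hf
    have := Set.Definable.preimage_comp
      (![Sum.inl 0, Sum.inr (Sum.inl 0), Sum.inr (Sum.inr 0)] :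
        Fin 3 → Fin 1 ⊕ (Fin 1 ⊕ Fin 1)) hf
    refine (congrArg (IsDef L) ?_).mpr this
    ext p
    constructor
    · rintro ⟨x, y, rfl⟩
      obtain ⟨i, rfl⟩ := eN.surjective x
      obtain ⟨j, rfl⟩ := eN.surjective y
      refine ⟨i, j, rfl, rfl, ?_⟩
      simp only [Equiv.symm_apply_apply]
      rfl
    · rintro ⟨i, j, h0, h1, h2⟩
      refine ⟨eN i, eN j, ?_⟩
      simp only [Equiv.symm_apply_apply]
      funext c
      rcases c with c | c | c <;> rw [Subsingleton.elim c 0]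
      exacts [h0, h1, h2]
  refine ⟨1, 1, T, N, dB, dA, fun x X => eN.symm x ∈ eT.symm X, _, _, ?_, op_def (· + ·) dadd,
    op_def (· * ·) dmul, eT.symm, eN.symm, fun _ _ => Iff.rfl, fun x y => by simp,
    fun x y => by simp⟩
  have := Set.Definable.preimage_comp (![Sum.inl 0, Sum.inr 0] : Fin 2 → Fin 1 ⊕ Fin 1) dmem
  refine (congrArg (IsDef L) ?_).mpr this
  ext p
  constructor
  · rintro ⟨x, y, rfl, h⟩
    obtain ⟨i, rfl⟩ := eN.surjective x
    obtain ⟨j, rfl⟩ := eT.surjective y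
    exact ⟨i, j, rfl, rfl, by simpa using h⟩
  · rintro ⟨i, j, h0, h1, h2⟩
    refine ⟨eN i, eT j, ?_, by simpa using h2⟩
    funext c
    rcases c with c | c <;> rw [Subsingleton.elim c 0]
    exacts [h0, h1]

end language

open DefStr

/-! ### Separated ranks, towers and the reals they code. -/

/-- A rank function supported on `(p, q)`, with positive rank on a dense set, such that points of
rank at least `r` are at distance at least `r` from each other. -/
structure SepRank (ρ : ℝ → ℝ) (p q : ℝ) : Prop where
  lt : p < q
  length_le : q - p ≤ 1
  supp : ∀ x, 0 < ρ x → p < x ∧ x < q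
  sep : ∀ x y r, 0 < r → r ≤ ρ x → r ≤ ρ y → x < y → r ≤ y - x
  dense : ∀ x y, p ≤ x → x < y → y ≤ q → ∃ z, x < z ∧ z < y ∧ 0 < ρ z

/-- Points of rank at least `r` meet all subintervals of `[p, q]` of length more than `δ`. -/
def Fine (ρ : ℝ → ℝ) (p q r δ : ℝ) : Prop :=
  ∀ x y, p ≤ x → y ≤ q → δ < y - x → ∃ z, x < z ∧ z < y ∧ r ≤ ρ z

/-- `l` is the largest point of rank at least `r` not exceeding `c`. -/
def Floor (ρ : ℝ → ℝ) (r c l : ℝ) : Prop :=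
  r ≤ ρ l ∧ l ≤ c ∧ ∀ e, l < e → e ≤ c → ρ e < r

theorem Floor.unique {ρ : ℝ → ℝ} {r c l l' : ℝ} (h : Floor ρ r c l) (h' : Floor ρ r c l') :
    l = l' := by
  rcases lt_trichotomy l l' with H | H | H
  · exact absurd (h.2.2 _ H h'.2.1) (not_lt.2 h'.1)
  · exact H
  · exact absurd (h'.2.2 _ H h.2.1) (not_lt.2 h.1)

theorem Fine.mono {ρ : ℝ → ℝ} {p q r δ r' δ' : ℝ} (h : Fine ρ p q r δ) (hr : r' ≤ r)
    (hδ : δ ≤ δ') : Fine ρ p q r' δ' := fun x y hx hy hxy =>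
  let ⟨z, h1, h2, h3⟩ := h x y hx hy (hδ.trans_lt hxy)
  ⟨z, h1, h2, hr.trans h3⟩

namespace SepRank

variable {ρ : ℝ → ℝ} {p q : ℝ} (H : SepRank ρ p q)
include H

/-- Points of rank at least `r` are `r`-separated and lie in a bounded interval, so `x ↦ ⌊x / r⌋` is
injective on them with bounded values. -/
theorem finite {r : ℝ} (hr : 0 < r) : {x | r ≤ ρ x}.Finite := by
  refine Set.Finite.of_finite_image (f := fun x => ⌊x / r⌋) ?_ ?_
  · refine (Set.finite_Icc ⌊p / r⌋ ⌊q / r⌋).subset ?_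
    rintro _ ⟨x, hx, rfl⟩
    have := H.supp x (hr.trans_le hx)
    exact ⟨Int.floor_le_floor (by gcongr; exact this.1.le),
      Int.floor_le_floor (by gcongr; exact this.2.le)⟩
  · have key : ∀ x y, r ≤ ρ x → r ≤ ρ y → ⌊x / r⌋ = ⌊y / r⌋ → ¬ x < y := by
      intro x y hx hy e hxy
      have h1 := H.sep x y r hr hx hy hxy
      have h2 := Int.abs_sub_lt_one_of_floor_eq_floor e
      rw [← sub_div, abs_div, abs_of_pos hr, div_lt_one hr, abs_sub_comm,
        abs_of_pos (sub_pos.2 hxy)] at h2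
      linarith
    intro x hx y hy e
    exact le_antisymm (not_lt.1 (key y x hy hx e.symm)) (not_lt.1 (key x y hx hy e))

/-- By compactness finitely many points of positive rank already form a `δ / 2`-net of `[p, q]`; `ε`
is the least of their ranks. -/
theorem exists_fine {δ : ℝ} (hδ : 0 < δ) : ∃ ε, 0 < ε ∧ Fine ρ p q ε δ := by
  obtain ⟨t, hcov⟩ := isCompact_Icc.elim_finite_subcover (s := Icc p q)
    (fun z : {z // 0 < ρ z} => Metric.ball (z : ℝ) (δ / 2)) (fun _ => Metric.isOpen_ball) (by
      intro x hx
      have hpq := H.lt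
      obtain ⟨z, h1, h2, h3⟩ := H.dense (max p (x - δ / 2)) (min q (x + δ / 2)) (le_max_left _ _)
        (by simp only [max_lt_iff, lt_min_iff]; refine ⟨⟨?_, ?_⟩, ?_, ?_⟩ <;>
              linarith [hx.1, hx.2]) (min_le_left _ _)
      rw [max_lt_iff] at h1
      rw [lt_min_iff] at h2
      refine mem_iUnion.2 ⟨⟨z, h3⟩, ?_⟩
      rw [Metric.mem_ball, Real.dist_eq, abs_lt]
      constructor <;> simp only <;> linarith)
  have : ∃ ε, 0 < ε ∧ ∀ z ∈ t, ε ≤ ρ z := by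
    rcases t.eq_empty_or_nonempty with rfl | hne
    · exact ⟨1, one_pos, by simp⟩
    · obtain ⟨z, hz, hmin⟩ := t.exists_min_image (fun z => ρ z) hne
      exact ⟨ρ z, z.2, hmin⟩
  obtain ⟨ε, hε, hle⟩ := this
  refine ⟨ε, hε, fun x y hx hy hxy => ?_⟩
  have hm : (x + y) / 2 ∈ Icc p q := ⟨by linarith, by linarith⟩
  obtain ⟨z, hz, hzb⟩ := mem_iUnion₂.1 (hcov hm)
  rw [Metric.mem_ball, Real.dist_eq, abs_lt] at hzb
  exact ⟨z, by linarith, by linarith, hle z hz⟩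

theorem exists_gap {r : ℝ} (hr : 0 < r) {x u : ℝ} (hxu : x < u) :
    ∃ u', x < u' ∧ u' < u ∧ ∀ e, x < e → e < u' → ρ e < r := by
  have hfin : ({e | r ≤ ρ e} ∩ Ioi x).Finite := (H.finite hr).inter_of_left _
  rcases ({e | r ≤ ρ e} ∩ Ioi x).eq_empty_or_nonempty with he | hne
  · refine ⟨(x + u) / 2, by linarith, by linarith, fun e h1 _ => ?_⟩
    by_contra hc
    have : e ∈ ({e | r ≤ ρ e} ∩ Ioi x) := ⟨not_lt.1 hc, h1⟩
    rw [he] at this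
    exact this
  · obtain ⟨m, hm, hmin⟩ := Set.exists_min_image _ id hfin hne
    refine ⟨min m ((x + u) / 2), lt_min hm.2 (by linarith),
      (min_le_right _ _).trans_lt (by linarith), fun e h1 h2 => ?_⟩
    by_contra hc
    exact absurd (hmin e ⟨not_lt.1 hc, h1⟩) (not_le.2 (h2.trans_le (min_le_left _ _)))

theorem exists_next {r a e : ℝ} (hr : 0 < r) (hae : a < e) (he : r ≤ ρ e) :
    ∃ b, a < b ∧ b ≤ e ∧ r ≤ ρ b ∧ ∀ x, a < x → x < b → ρ x < r := by
  obtain ⟨m, hm, hmin⟩ := Set.exists_min_image ({e | r ≤ ρ e} ∩ Ioi a) id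
    ((H.finite hr).inter_of_left _) ⟨e, he, hae⟩
  refine ⟨m, hm.2, hmin e ⟨he, hae⟩, hm.1, fun x h1 h2 => ?_⟩
  by_contra hc
  exact absurd (hmin x ⟨not_lt.1 hc, h1⟩) (not_le.2 h2)

/-- A point of `(x, u)` whose rank exceeds those of all points between `x` and it. -/
theorem exists_record {x u : ℝ} (hx : p ≤ x) (hxu : x < u) (hu : u ≤ q) :
    ∃ n, x < n ∧ n < u ∧ 0 < ρ n ∧ ∀ e, x < e → e < n → ρ e < ρ n := by
  obtain ⟨z, h1, h2, h3⟩ := H.dense x u hx hxu hu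
  obtain ⟨m, hm, hmax⟩ := Set.exists_max_image ({e | ρ z ≤ ρ e} ∩ Ioo x u) ρ
    ((H.finite h3).inter_of_left _) ⟨z, le_refl (ρ z), h1, h2⟩
  obtain ⟨n, hn1, hn2, hn3, hn4⟩ := H.exists_next (h3.trans_le hm.1) hm.2.1 le_rfl
  exact ⟨n, hn1, hn2.trans_lt hm.2.2, (h3.trans_le hm.1).trans_le hn3,
    fun e he1 he2 => (hn4 e he1 he2).trans_le hn3⟩

/-- Data for one step of the construction of a sparse sequence. -/
theorem exists_step (n u g : ℝ) (hn : p ≤ n) (hnu : n < u) (hu : u ≤ q) (hρ : 0 < ρ n)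
    (hg : 0 < g) : ∃ n' u', n < n' ∧ n' < u' ∧ u' < u ∧ 0 < ρ n' ∧ ρ n' ≤ ρ n / 2 ∧
      (∀ e, n < e → e < n' → ρ e < ρ n') ∧ (∀ e, n' < e → e < u' → ρ e < ρ n') ∧
      Fine ρ p q (ρ n') (ρ n * g / 4) := by
  obtain ⟨ε, hε, hfine⟩ := H.exists_fine (δ := ρ n * g / 4) (by positivity)
  obtain ⟨u₁, h1, h2, h3⟩ := H.exists_gap (r := min ε (ρ n / 2)) (by positivity) hnu
  obtain ⟨n', h4, h5, h6, h7⟩ := H.exists_record hn h1 (h2.le.trans hu)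
  obtain ⟨u', h8, h9, h10⟩ := H.exists_gap h6 h5
  have h11 := h3 n' h4 h5
  exact ⟨n', u', h4, h8, h9.trans h2, h6, (h11.trans_le (min_le_right _ _)).le, h7, h10,
    hfine.mono (h11.trans_le (min_le_left _ _)).le le_rfl⟩

end SepRank

/-- A rapidly refining sequence of points `n 0 < n 1 < ⋯` that is recoverable from its limit `c`,
together with neighbouring points `a < b` of rank at least `ρ (n 0)`. -/
structure Tower (ρ : ℝ → ℝ) (p q : ℝ) (n : ℕ → ℝ) (c a b : ℝ) : Prop extends SepRank ρ p q where
  mono : StrictMono n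
  pos : ∀ k, 0 < ρ (n k)
  lt_lim : ∀ k, n k < c
  record : ∀ k e, n k < e → e ≤ c → ρ e < ρ (n k)
  between : ∀ k e, n k < e → e < n (k + 1) → ρ e < ρ (n (k + 1))
  covers : ∀ e, n 0 ≤ e → e < c → ∃ k, n k ≤ e ∧ e < n (k + 1)
  fine : ∀ j k, j < k → Fine ρ p q (ρ (n (k + 1))) (ρ (n k) * (n (j + 1) - n j) / 4)
  fine_one : ∀ k, Fine ρ p q (ρ (n (k + 1))) (ρ (n k) / 4)
  halving : ∀ k, ρ (n (k + 1)) ≤ ρ (n k) / 2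
  base_lt : a < b
  base_left : ρ (n 0) ≤ ρ a
  base_right : ρ (n 0) ≤ ρ b
  base_adj : ∀ e, a < e → e < b → ρ e < ρ (n 0)

/-- Each new point is a record of rank just to the right of the previous one, of rank so small that
its level is dense on the scale set by the previous rank and all earlier gaps. Right ends decreasing
strictly along with the points keep the limit inside every record region. -/
theorem SepRank.exists_tower {ρ : ℝ → ℝ} {p q : ℝ} (H : SepRank ρ p q) :
    ∃ n c a b, Tower ρ p q n c a b := by
  obtain ⟨a, ha1, ha2, ha⟩ := H.dense p q le_rfl H.lt le_rfl
  obtain ⟨b', hb1, hb2, hb'⟩ := H.dense a q ha1.le ha2 le_rfl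
  -- Near `p` all ranks are smaller than those of `a` and `b'`. Starting the sequence there makes
  -- `a` and a next point `b` available at the level of its first term.
  obtain ⟨v, hv1, hv2, hv⟩ := H.exists_gap (r := min (ρ a) (ρ b')) (by positivity) H.lt
  obtain ⟨m, hm1, hm2, hm⟩ := H.dense p v le_rfl hv1 hv2.le
  have hm3 := hv m hm1 hm2
  obtain ⟨b, hab, hbb, hb, hadj⟩ := H.exists_next hm hb1 (hm3.le.trans (min_le_right _ _))
  obtain ⟨u, hu1, hu2, hu⟩ := H.exists_gap hm (hm2.trans hv2)
  -- A state `(n, u, g)`: the current point, a right end with all ranks in `(n, u)` below `ρ n`, and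
  -- a positive number `g ≤ 1` that will bound all gaps so far from below.
  let T := {s : ℝ × ℝ × ℝ // p ≤ s.1 ∧ s.1 < s.2.1 ∧ s.2.1 ≤ q ∧ 0 < ρ s.1 ∧ 0 < s.2.2 ∧
    (∀ e, s.1 < e → e < s.2.1 → ρ e < ρ s.1) ∧ s.2.2 ≤ 1}
  have step : ∀ s : T, ∃ s' : T, s.1.1 < s'.1.1 ∧ s'.1.2.1 < s.1.2.1 ∧ ρ s'.1.1 ≤ ρ s.1.1 / 2 ∧
      (∀ e, s.1.1 < e → e < s'.1.1 → ρ e < ρ s'.1.1) ∧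
      Fine ρ p q (ρ s'.1.1) (ρ s.1.1 * s.1.2.2 / 4) ∧
      s'.1.2.2 = min s.1.2.2 (s'.1.1 - s.1.1) := by
    rintro ⟨⟨n, u, g⟩, h1, h2, h3, h4, h5, h6, h7⟩
    obtain ⟨n', u', k1, k2, k3, k4, k5, k6, k7, k8⟩ := H.exists_step n u g h1 h2 h3 h4 h5
    exact ⟨⟨⟨n', u', min g (n' - n)⟩, h1.trans k1.le, k2, k3.le.trans h3, k4,
      lt_min h5 (sub_pos.2 k1), k7, (min_le_left _ _).trans h7⟩, k1, k3, k5, k6, k8, rfl⟩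
  choose f hf using step
  let s : ℕ → T := fun k => f^[k] ⟨⟨m, u, 1⟩, hm1.le, hu1, by linarith, hm, one_pos, hu, le_rfl⟩
  have hs : ∀ k, s (k + 1) = f (s k) := fun k => Function.iterate_succ_apply' _ _ _
  have F := fun k => hf (s k)
  simp only [← hs] at F
  set n : ℕ → ℝ := fun k => (s k).1.1 with hn
  have nmono : StrictMono n := strictMono_nat_of_lt_succ fun k => (F k).1
  have uanti : StrictAnti fun k => (s k).1.2.1 := strictAnti_nat_of_succ_lt fun k => (F k).2.1
  have nu : ∀ j k, n j ≤ (s k).1.2.1 := fun j k =>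
    (nmono.monotone (le_max_left j k)).trans ((s (max j k)).2.2.1.le.trans
      (uanti.antitone (le_max_right j k)))
  have bdd : BddAbove (range n) := ⟨_, by rintro _ ⟨j, rfl⟩; exact nu j 0⟩
  have ncl : ∀ k, n k < sSup (range n) := fun k =>
    (nmono k.lt_succ_self).trans_le (le_csSup bdd ⟨_, rfl⟩)
  have cu : ∀ k, sSup (range n) < (s k).1.2.1 := fun k =>
    (csSup_le (range_nonempty n) (by rintro _ ⟨j, rfl⟩; exact nu j (k + 1))).trans_lt
      (uanti k.lt_succ_self)
  have gap : ∀ j k, j < k → (s k).1.2.2 ≤ n (j + 1) - n j := by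
    intro j k hjk
    induction k, hjk using Nat.le_induction with
    | base => rw [(F j).2.2.2.2.2]; exact min_le_right _ _
    | succ k _ ih => rw [(F k).2.2.2.2.2]; exact (min_le_left _ _).trans ih
  refine ⟨n, sSup (range n), a, b, ⟨H, nmono, fun k => (s k).2.2.2.2.1, ncl, ?_, ?_, ?_, ?_, ?_,
    fun k => (F k).2.2.1, hab, hm3.le.trans (min_le_left _ _), hb, hadj⟩⟩
  · exact fun k e h1 h2 => (s k).2.2.2.2.2.2.1 e h1 (h2.trans_lt (cu k))
  · exact fun k e h1 h2 => (F k).2.2.2.1 e h1 h2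
  · intro e h1 h2
    obtain ⟨_, ⟨k, rfl⟩, hk⟩ := exists_lt_of_lt_csSup (range_nonempty n) h2
    classical
    have hex : ∃ k, e < n k := ⟨k, hk⟩
    have hne : Nat.find hex ≠ 0 := fun h0 => by
      have := Nat.find_spec hex
      rw [h0] at this
      exact absurd this (not_lt.2 h1)
    obtain ⟨l, hl⟩ := Nat.exists_eq_succ_of_ne_zero hne
    refine ⟨l, not_lt.1 (Nat.find_min hex (m := l) (by omega)), ?_⟩
    have := Nat.find_spec hex
    rwa [hl] at this
  · intro j k hjk
    refine (F k).2.2.2.2.1.mono le_rfl ?_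
    have h1 := gap j k hjk
    have h2 : 0 < ρ (n k) := (s k).2.2.2.2.1
    gcongr
  · intro k
    refine (F k).2.2.2.2.1.mono le_rfl ?_
    have h2 : 0 < ρ (n k) := (s k).2.2.2.2.1
    have := mul_le_of_le_one_right h2.le (s k).2.2.2.2.2.2.2
    change ρ (n k) * (s k).1.2.2 / 4 ≤ _
    linarith

/-- Consecutive points `a < b` among those of rank at least `r`. -/
def Adj (ρ : ℝ → ℝ) (r a b : ℝ) : Prop :=
  a < b ∧ r ≤ ρ a ∧ r ≤ ρ b ∧ ∀ e, a < e → e < b → ρ e < r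

theorem Adj.floor {ρ : ℝ → ℝ} {r a b c : ℝ} (h : Adj ρ r a b) (ha : a ≤ c) (hb : c < b) :
    Floor ρ r c a :=
  ⟨h.2.1, ha, fun e h1 h2 => h.2.2.2 e h1 (h2.trans_lt hb)⟩

theorem Adj.unique {ρ : ℝ → ℝ} {r a b b' : ℝ} (h : Adj ρ r a b) (h' : Adj ρ r a b') : b = b' := by
  rcases lt_trichotomy b b' with H | H | H
  · exact absurd (h'.2.2.2 _ h.1 H) (not_lt.2 h.2.2.1)
  · exact H
  · exact absurd (h.2.2.2 _ h'.1 H) (not_lt.2 h'.2.2.1)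

namespace SepRank

variable {ρ : ℝ → ℝ} {p q : ℝ} (H : SepRank ρ p q)
include H

/-- Each half of `(x, y)` contains a point of the level; the successor of the left one is still
before `y`. -/
theorem exists_adj {r δ x y : ℝ} (hr : 0 < r) (hF : Fine ρ p q r δ) (hx : p ≤ x) (hy : y ≤ q)
    (hlt : x < y) (hxy : 2 * δ < y - x) : ∃ a b, Adj ρ r a b ∧ x < a ∧ b < y := by
  obtain ⟨a, h1, h2, h3⟩ := hF x ((x + y) / 2) hx (by linarith) (by linarith)
  obtain ⟨b', h4, h5, h6⟩ := hF ((x + y) / 2) y (by linarith) hy (by linarith)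
  obtain ⟨b, h7, h8, h9, h10⟩ := H.exists_next hr (h2.trans h4) h6
  exact ⟨a, b, ⟨h7, h3, h9, h10⟩, h1, h8.trans_lt h5⟩

end SepRank

/-- Nested adjacent pairs contain a common point. -/
theorem exists_mem_nested {a b : ℕ → ℝ} (hab : ∀ k, a k < b k) (ha : ∀ k, a k ≤ a (k + 1))
    (hb : ∀ k, b (k + 1) < b k) : ∃ c, ∀ k, a k ≤ c ∧ c < b k := by
  have am := monotone_nat_of_le_succ ha
  have bm := strictAnti_nat_of_succ_lt hb
  have h : ∀ j k, a j ≤ b k := fun j k => (am (le_max_left j k)).trans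
    ((hab _).le.trans (bm.antitone (le_max_right j k)))
  refine ⟨sSup (range a), fun k => ⟨le_csSup ⟨b 0, ?_⟩ ⟨k, rfl⟩, ?_⟩⟩
  · rintro _ ⟨j, rfl⟩
    exact h j 0
  · exact (csSup_le (range_nonempty a) (by rintro _ ⟨j, rfl⟩; exact h j (k + 1))).trans_lt (hb k)

namespace Tower

variable {ρ : ℝ → ℝ} {p q c₀ a₀ b₀ : ℝ} {n : ℕ → ℝ} (T : Tower ρ p q n c₀ a₀ b₀)
include T

/-- This makes the sequence definable from its limit: its terms are exactly the points before `c₀`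
whose rank beats everything up to `c₀`. A point strictly between two terms is outranked by the later
one. -/
theorem mem_range_iff (x : ℝ) : (∃ k, x = n k) ↔
    n 0 ≤ x ∧ x < c₀ ∧ 0 < ρ x ∧ ∀ e, x < e → e ≤ c₀ → ρ e < ρ x := by
  constructor
  · rintro ⟨k, rfl⟩
    exact ⟨T.mono.monotone k.zero_le, T.lt_lim k, T.pos k, T.record k⟩
  · rintro ⟨h1, h2, h3, h4⟩
    obtain ⟨k, hk1, hk2⟩ := T.covers x h1 h2
    refine ⟨k, le_antisymm (not_lt.1 fun h => ?_) hk1⟩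
    exact lt_asymm (T.between k x h hk2) (h4 _ hk2 (T.lt_lim _).le)

theorem adj_base : Adj ρ (ρ (n 0)) a₀ b₀ := ⟨T.base_lt, T.base_left, T.base_right, T.base_adj⟩

theorem adj_bounds {k : ℕ} {a b : ℝ} (h : Adj ρ (ρ (n k)) a b) :
    p < a ∧ b < q ∧ ρ (n k) ≤ b - a :=
  ⟨(T.supp _ ((T.pos k).trans_le h.2.1)).1, (T.supp _ ((T.pos k).trans_le h.2.2.1)).2,
    T.sep _ _ _ (T.pos k) h.2.1 h.2.2.1 h.1⟩

/-- A point whose successive offsets from its floors lie in prescribed intervals. -/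
theorem exists_path {lo hi : ℕ → ℝ} (hlo : ∀ k, 0 ≤ lo k) (hlh : ∀ k, lo k < hi k)
    (hhi : ∀ k, hi k ≤ 1)
    (hF : ∀ k, Fine ρ p q (ρ (n (k + 1))) (ρ (n k) * (hi k - lo k) / 4)) :
    ∃ c, ∀ k, ∃ l, Floor ρ (ρ (n k)) c l ∧ ρ (n k) * lo k < c - l ∧ c - l < ρ (n k) * hi k := by
  have step : ∀ k (s : {s : ℝ × ℝ // Adj ρ (ρ (n k)) s.1 s.2}),
      ∃ s' : {s : ℝ × ℝ // Adj ρ (ρ (n (k + 1))) s.1 s.2},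
        s.1.1 + ρ (n k) * lo k < s'.1.1 ∧ s'.1.2 < s.1.1 + ρ (n k) * hi k := by
    rintro k ⟨⟨a, b⟩, h⟩
    obtain ⟨h1, h2, h3⟩ := T.adj_bounds h
    have hp := T.pos k
    have e1 := mul_nonneg hp.le (hlo k)
    have e2 := mul_le_of_le_one_right hp.le (hhi k)
    have e3 := mul_pos hp (sub_pos.2 (hlh k))
    -- Adjacent points of level `k` are at least `ρ (n k)` apart, so the prescribed window after `a`
    -- lies within the current interval, and the next level is fine enough to put an adjacent pair
    -- in it.
    obtain ⟨a', b', h', h4, h5⟩ := T.toSepRank.exists_adj (T.pos (k + 1)) (hF k)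
      (x := a + ρ (n k) * lo k) (y := a + ρ (n k) * hi k) (by linarith) (by simp only at *; linarith)
      (by linarith) (by linarith)
    exact ⟨⟨(a', b'), h'⟩, h4, h5⟩
  choose f hf using step
  let s : ∀ k, {s : ℝ × ℝ // Adj ρ (ρ (n k)) s.1 s.2} :=
    fun k => Nat.rec ⟨(a₀, b₀), T.adj_base⟩ f k
  have F : ∀ k, (s k).1.1 + ρ (n k) * lo k < (s (k + 1)).1.1 ∧
      (s (k + 1)).1.2 < (s k).1.1 + ρ (n k) * hi k := fun k => hf k (s k)
  obtain ⟨c, hc⟩ := exists_mem_nested (a := fun k => (s k).1.1) (b := fun k => (s k).1.2)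
    (fun k => (s k).2.1) (fun k => by
      have := mul_nonneg (T.pos k).le (hlo k)
      linarith [(F k).1]) (fun k => by
      have e2 := mul_le_of_le_one_right (T.pos k).le (hhi k)
      linarith [(F k).2, (T.adj_bounds (s k).2).2.2])
  refine ⟨c, fun k => ⟨_, (s k).2.floor (hc k).1 (hc k).2, ?_, ?_⟩⟩
  · linarith [(F k).1, (hc (k + 1)).1]
  · linarith [(F k).2, (hc (k + 1)).2]

/-- A single real codes a function on `ℕ` that is bounded by the identity. -/
theorem exists_code_fun (F : ℕ → ℕ) (hF : ∀ k, 1 ≤ k → F k < k) :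
    ∃ c, ∀ k, 1 ≤ k → ∀ j, (∃ l, Floor ρ (ρ (n k)) c l ∧ ρ (n k) * (n j - p) < c - l ∧
      c - l < ρ (n k) * (n (j + 1) - p)) ↔ j = F k := by
  have hn : ∀ j, p < n j ∧ n j < q := fun j => T.supp _ (T.pos j)
  obtain ⟨c, hc⟩ := T.exists_path
    -- Windows for different values of `F k` are disjoint, and they fit in `[0, 1]` because `q - p ≤
    -- 1`. Level `0` carries no information. The bound `F k < k` is what lets level `k + 1` resolve
    -- the window.
    (lo := fun k => if k = 0 then 0 else n (F k) - p)
    (hi := fun k => if k = 0 then 1 else n (F k + 1) - p)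
    (fun k => by split_ifs; exacts [le_rfl, (sub_pos.2 (hn _).1).le])
    (fun k => by
      split_ifs
      exacts [one_pos, by linarith [T.mono (F k).lt_succ_self]])
    (fun k => by
      split_ifs
      exacts [le_rfl, by linarith [(hn (F k + 1)).2, T.length_le]])
    (fun k => by
      split_ifs with hk
      · simpa using T.fine_one k
      · have := T.fine (F k) k (hF k (by omega))
        simpa using this)
  refine ⟨c, fun k hk j => ?_⟩
  obtain ⟨l, hl, h1, h2⟩ := hc k
  rw [if_neg (by omega)] at h1 h2
  constructor
  · rintro ⟨l', hl', h3, h4⟩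
    obtain rfl := hl.unique hl'
    have h5 : n j < n (F k + 1) := by
      have := lt_of_mul_lt_mul_left (h3.trans h2) (T.pos k).le
      linarith
    have h6 : n (F k) < n (j + 1) := by
      have := lt_of_mul_lt_mul_left (h1.trans h4) (T.pos k).le
      linarith
    have := T.mono.lt_iff_lt.1 h5
    have := T.mono.lt_iff_lt.1 h6
    omega
  · rintro rfl
    exact ⟨l, hl, h1, h2⟩

/-- Each set of natural numbers determines a branch in the tree of floors. -/
theorem exists_branch (X : Set ℕ) : ∃ (c : ℝ) (a : ℕ → ℝ), a 0 = a₀ ∧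
    (∀ k, Floor ρ (ρ (n k)) c (a k)) ∧
    ∀ k, (k ∉ X ∧ a (k + 1) = a k) ∨ (k ∈ X ∧ Adj ρ (ρ (n (k + 1))) (a k) (a (k + 1))) := by
  have step : ∀ k (s : {s : ℝ × ℝ // Adj ρ (ρ (n k)) s.1 s.2}),
      ∃ s' : {s : ℝ × ℝ // Adj ρ (ρ (n (k + 1))) s.1 s.2}, s'.1.2 < s.1.2 ∧
        ((k ∉ X ∧ s'.1.1 = s.1.1) ∨ (k ∈ X ∧ Adj ρ (ρ (n (k + 1))) s.1.1 s'.1.1)) := by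
    rintro k ⟨⟨a, b⟩, h⟩
    obtain ⟨h1, h2, h3⟩ := T.adj_bounds h
    have hp := T.pos k
    have hp' := T.pos (k + 1)
    simp only at *
    obtain ⟨a', b', h', h4, h5⟩ := T.toSepRank.exists_adj hp' (T.fine_one k)
      (x := a) (y := b) h1.le h2.le h.1 (by linarith)
    -- `d` and `d'` are the first two points of the finer level after `a`, both before `b`. The
    -- branch continues in `(a, d)` when `k ∉ X` and in `(d, d')` when `k ∈ X`.
    obtain ⟨d, d1, d2, d3, d4⟩ := T.toSepRank.exists_next hp' h4 h'.2.1
    obtain ⟨d', e1, e2, e3, e4⟩ := T.toSepRank.exists_next hp' (d2.trans_lt h'.1) h'.2.2.1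
    have hr : ρ (n (k + 1)) ≤ ρ a := by linarith [T.halving k, h.2.1]
    by_cases hk : k ∈ X
    · exact ⟨⟨(d, d'), e1, d3, e3, e4⟩, e2.trans_lt h5, Or.inr ⟨hk, d1, hr, d3, d4⟩⟩
    · exact ⟨⟨(a, d), d1, hr, d3, d4⟩, (d2.trans_lt h'.1).trans h5, Or.inl ⟨hk, rfl⟩⟩
  choose f hf using step
  let s : ∀ k, {s : ℝ × ℝ // Adj ρ (ρ (n k)) s.1 s.2} :=
    fun k => Nat.rec ⟨(a₀, b₀), T.adj_base⟩ f k
  have F := fun k => hf k (s k)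
  obtain ⟨c, hc⟩ := exists_mem_nested (a := fun k => (s k).1.1) (b := fun k => (s k).1.2)
    (fun k => (s k).2.1) (fun k => by
      rcases (F k).2 with h | h
      · exact h.2.ge
      · exact h.2.1.le) (fun k => (F k).1)
  exact ⟨c, fun k => (s k).1.1, rfl, fun k => (s k).2.floor (hc k).1 (hc k).2, fun k => (F k).2⟩

/-- A branch has only one limit: between two distinct candidates lies a point of positive rank, and
as `ρ (n k)` tends to zero some level contains it, so the floors at that level differ. -/
theorem eq_of_floors {c c' : ℝ} {a : ℕ → ℝ} (h0 : a 0 = a₀) (h : ∀ k, Floor ρ (ρ (n k)) c (a k))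
    (h' : ∀ k, Floor ρ (ρ (n k)) c' (a k)) : c = c' := by
  have small : ∀ k, ρ (n k) ≤ (1 / 2) ^ k * ρ (n 0) := by
    intro k
    induction k with
    | zero => simp
    | succ k ih =>
      have := T.halving k
      rw [pow_succ]
      linarith
  have key : ∀ {c c' : ℝ}, (∀ k, Floor ρ (ρ (n k)) c (a k)) → (∀ k, Floor ρ (ρ (n k)) c' (a k)) →
      ¬ c < c' := by
    intro c c' h h' hlt
    have h1 : p < c := (T.adj_bounds T.adj_base).1.trans_le (h0 ▸ (h 0).2.1)
    have h2 : c' < q := by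
      refine lt_of_not_ge fun hq => ?_
      refine absurd ((h' 0).2.2 b₀ (h0 ▸ T.base_lt) ?_) (not_lt.2 T.base_right)
      exact (T.adj_bounds T.adj_base).2.1.le.trans hq
    obtain ⟨z, z1, z2, z3⟩ := T.dense c c' h1.le hlt h2.le
    obtain ⟨k, hk⟩ := exists_pow_lt_of_lt_one (div_pos z3 (T.pos 0)) (by norm_num : (1 / 2 : ℝ) < 1)
    rw [lt_div_iff₀ (T.pos 0)] at hk
    refine absurd ((h' k).2.2 z ((h k).2.1.trans_lt z1) z2.le) (not_lt.2 ?_)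
    exact (small k).trans hk.le
  exact le_antisymm (not_lt.1 (key h' h)) (not_lt.1 (key h h'))

end Tower

/-! ### Second-order arithmetic from a separated rank. -/

/-- Every nonempty countable graph of a binary operation fixing `0` at `(0, 0)` is enumerated by
three functions below the identity. -/
theorem exists_slow_enumeration (f : ℕ → ℕ → ℕ) (hf : f 0 0 = 0) :
    ∃ X Y : ℕ → ℕ, (∀ k, 1 ≤ k → X k < k ∧ Y k < k ∧ f (X k) (Y k) < k) ∧
      ∀ i j, ∃ k, 1 ≤ k ∧ X k = i ∧ Y k = j := by
  let g : ℕ → ℕ × ℕ := fun k => Nat.unpair (Nat.unpair k).1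
  let good : ℕ → Prop := fun k => (g k).1 < k ∧ (g k).2 < k ∧ f (g k).1 (g k).2 < k
  classical
  -- At bad indices the entry `(0, 0, 0)` is used: it lies on the graph since `f 0 0 = 0`, and it is
  -- below every `k ≥ 1`.
  refine ⟨fun k => if good k then (g k).1 else 0, fun k => if good k then (g k).2 else 0, ?_, ?_⟩
  · intro k hk
    by_cases h : good k
    · simpa only [if_pos h] using h
    · simp only [if_neg h, hf]
      omega
  · intro i j
    -- The second component is padding, discarded by `g`, that makes the index exceed `i`, `j` and
    -- `f i j`.
    let k := Nat.pair (Nat.pair i j) (i + j + f i j + 1)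
    have hg : g k = (i, j) := by simp [g, k]
    have hk : i + j + f i j + 1 ≤ k := Nat.right_le_pair _ _
    have h : good k := by
      simp only [good, hg]
      omega
    exact ⟨k, by omega, by simp only [if_pos h, hg], by simp only [if_pos h, hg]⟩

theorem def_floor {S : DefStr} (h : S.OrdGroup) {ρ : ℝ → ℝ} (hρ : S.Fun1 ρ) :
    S.Def3 (Floor ρ) := by
  unfold Floor Def3
  repeat' with_reducible first
    | exact var _ | apply S.and | apply all | apply imp | apply h.lt | apply h.le | apply hρ.app

/-- Numbers are the terms of a tower. Functions below the identity are definable from one real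
parameter each, and the graph of an operation is the image of a curve whose three coordinates are
such functions. Sets are the reals whose floor either stays or moves to the next point at each
level. Multiplication is used only to measure offsets in units of the rank. -/
theorem SepRank.secondOrderArith {S : DefStr} (h : S.OrdField) {ρ : ℝ → ℝ} {p q : ℝ}
    (H : SepRank ρ p q) (hρ : S.Fun1 ρ) : S.SecondOrderArith := by
  obtain ⟨n, c₀, a₀, b₀, T⟩ := H.exists_tower
  have dFloor := def_floor h.toOrdGroup hρ
  have hN : S.Def1 fun x => ∃ k, x = n k := by
    simp only [T.mem_range_iff]
    unfold Def1
    repeat' with_reducible first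
      | exact var _ | exact const _ | apply S.and | apply all | apply imp | apply h.lt
      | apply h.le | apply hρ.app
  have hsuc : ∀ x y, (∃ k, x = n k ∧ y = n (k + 1)) ↔ (∃ k, x = n k) ∧ (∃ k, y = n k) ∧ x < y ∧
      ∀ e, (∃ k, e = n k) → x < e → ¬ e < y := by
    intro x y
    constructor
    · rintro ⟨k, rfl, rfl⟩
      refine ⟨⟨k, rfl⟩, ⟨k + 1, rfl⟩, T.mono k.lt_succ_self, ?_⟩
      rintro _ ⟨j, rfl⟩ h1 h2
      have := T.mono.lt_iff_lt.1 h1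
      have := T.mono.lt_iff_lt.1 h2
      omega
    · rintro ⟨⟨k, rfl⟩, ⟨l, rfl⟩, h1, h2⟩
      refine ⟨k, rfl, ?_⟩
      have h3 := T.mono.lt_iff_lt.1 h1
      rcases (Nat.succ_le_of_lt h3).eq_or_lt with h4 | h4
      · rw [← h4]
      · exact absurd (T.mono h4) (h2 _ ⟨k + 1, rfl⟩ (T.mono k.lt_succ_self))
  have dsuc : S.Def2 fun x y => ∃ k, x = n k ∧ y = n (k + 1) := by
    simp only [hsuc]
    unfold Def2
    repeat' with_reducible first
      | exact var _ | apply S.and | apply all | apply S.not | apply imp | apply h.lt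
      | apply hN.app
  have dfun : ∀ F : ℕ → ℕ, (∀ k, 1 ≤ k → F k < k) →
      S.Def2 fun x y => ∃ k, 1 ≤ k ∧ x = n k ∧ y = n (F k) := by
    intro F hF
    obtain ⟨c, hc⟩ := T.exists_code_fun F hF
    have : S.Def2 fun x y => (∃ k, x = n k) ∧ ¬ x = n 0 ∧ ∃ y', (∃ k, y = n k ∧ y' = n (k + 1)) ∧
        ∃ l, Floor ρ (ρ x) c l ∧ ρ x * (y - p) < c - l ∧ c - l < ρ x * (y' - p) := by
      unfold Def2
      repeat' with_reducible first
        | exact var _ | exact const _ | apply S.and | apply S.not | apply S.ex | apply h.lt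
        | apply h.sub | apply h.mul | apply hρ.app | apply hN.app | apply dsuc.app
        | apply dFloor.app | apply eq
    refine congr this fun v => ⟨?_, ?_⟩
    · rintro ⟨k, hk, e1, e2⟩
      rw [e1, e2]
      refine ⟨⟨k, rfl⟩, fun e => ?_, _, ⟨F k, rfl, rfl⟩, (hc k hk _).2 rfl⟩
      have := T.mono.injective e
      omega
    · rintro ⟨⟨k, e1⟩, e2, y', ⟨j, e3, e4⟩, e5⟩
      rw [e1, e3, e4] at e5
      have hk : 1 ≤ k := by
        rcases Nat.eq_zero_or_pos k with rfl | hk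
        · exact absurd e1 e2
        · exact hk
      exact ⟨k, hk, e1, by rw [e3, (hc k hk j).1 e5]⟩
  have dop : ∀ f : ℕ → ℕ → ℕ, f 0 0 = 0 →
      S.Def3 fun x y z => ∃ i j, x = n i ∧ y = n j ∧ z = n (f i j) := by
    intro f hf
    obtain ⟨X, Y, hlt, hsurj⟩ := exists_slow_enumeration f hf
    have dX := dfun X fun k hk => (hlt k hk).1
    have dY := dfun Y fun k hk => (hlt k hk).2.1
    have dZ := dfun (fun k => f (X k) (Y k)) fun k hk => (hlt k hk).2.2
    have : S.Def3 fun x y z => ∃ w, (∃ k, 1 ≤ k ∧ w = n k ∧ x = n (X k)) ∧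
        (∃ k, 1 ≤ k ∧ w = n k ∧ y = n (Y k)) ∧
        ∃ k, 1 ≤ k ∧ w = n k ∧ z = n (f (X k) (Y k)) := by
      unfold Def3
      repeat' with_reducible first
        | exact var _ | apply S.and | apply dX.app | apply dY.app | apply dZ.app | apply S.ex
    refine congr this fun v => ⟨?_, ?_⟩
    · rintro ⟨i, j, e1, e2, e3⟩
      obtain ⟨k, hk, rfl, rfl⟩ := hsurj i j
      exact ⟨n k, ⟨k, hk, rfl, e1⟩, ⟨k, hk, rfl, e2⟩, ⟨k, hk, rfl, e3⟩⟩
    · rintro ⟨w, ⟨k, hk, rfl, e1⟩, ⟨k', _, e, e2⟩, ⟨k'', _, e', e3⟩⟩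
      obtain rfl := T.mono.injective e
      obtain rfl := T.mono.injective e'
      exact ⟨_, _, e1, e2, e3⟩
  choose C A hA0 hA hAX using T.exists_branch
  have hmem : ∀ X k, k ∈ X ↔ ∃ l, Floor ρ (ρ (n k)) (C X) l ∧ ¬ Floor ρ (ρ (n (k + 1))) (C X) l := by
    intro X k
    constructor
    · intro hk
      refine ⟨A X k, hA X k, fun hl => ?_⟩
      rcases hAX X k with h1 | h1
      · exact h1.1 hk
      · exact h1.2.1.ne (hl.unique (hA X (k + 1)))
    · rintro ⟨l, h1, h2⟩
      obtain rfl := h1.unique (hA X k)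
      rcases hAX X k with h3 | h3
      · exact absurd (hA X (k + 1)) (h3.2 ▸ h2)
      · exact h3.1
  have hC : ∀ c, (∃ X, c = C X) ↔ Floor ρ (ρ (n 0)) c a₀ ∧
      ∀ x y, (∃ k, x = n k ∧ y = n (k + 1)) → ∃ l l', Floor ρ (ρ x) c l ∧ Floor ρ (ρ y) c l' ∧
        (l' = l ∨ (l < l' ∧ ∀ e, l < e → e < l' → ρ e < ρ y)) := by
    intro c
    constructor
    · rintro ⟨X, rfl⟩
      refine ⟨hA0 X ▸ hA X 0, ?_⟩
      rintro _ _ ⟨k, rfl, rfl⟩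
      refine ⟨_, _, hA X k, hA X (k + 1), ?_⟩
      rcases hAX X k with h1 | h1
      · exact Or.inl h1.2
      · exact Or.inr ⟨h1.2.1, h1.2.2.2.2⟩
    · rintro ⟨h0, hs⟩
      have hex : ∀ k, ∃ l, Floor ρ (ρ (n k)) c l := by
        intro k
        obtain ⟨l, _, hl, _⟩ := hs _ _ ⟨k, rfl, rfl⟩
        exact ⟨l, hl⟩
      choose l hl using hex
      have hl0 : l 0 = a₀ := (hl 0).unique h0
      have hstep : ∀ k, l (k + 1) = l k ∨ Adj ρ (ρ (n (k + 1))) (l k) (l (k + 1)) := by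
        intro k
        obtain ⟨l', l'', h1, h2, h3⟩ := hs _ _ ⟨k, rfl, rfl⟩
        obtain rfl := h1.unique (hl k)
        obtain rfl := h2.unique (hl (k + 1))
        refine h3.imp_right fun h3 => ⟨h3.1, ?_, (hl (k + 1)).1, h3.2⟩
        linarith [(hl k).1, T.halving k, T.pos k]
      -- The set is read off the levels where the floor moves; since the move is always to the
      -- adjacent point, the branch coded by `X` has the same floors as `c`.
      let X : Set ℕ := {k | l (k + 1) ≠ l k}
      have hlA : ∀ k, A X k = l k := by
        intro k
        induction k with
        | zero => rw [hA0, hl0]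
        | succ k ih =>
          rcases hAX X k with h1 | h1
          · rw [h1.2, ih]
            exact (not_not.1 h1.1).symm
          · have h2 := (hstep k).resolve_left h1.1
            rw [← ih] at h2
            exact h1.2.unique h2
      exact ⟨X, T.eq_of_floors hl0 hl fun k => hlA k ▸ hA X k⟩
  have dC : S.Def1 fun x => ∃ X, x = C X := by
    simp only [hC]
    unfold Def1
    repeat' with_reducible first
      | exact var _ | exact const _ | apply S.and | apply all | apply dsuc.app | apply S.ex
      | apply imp | apply DefStr.or | apply eq | apply h.lt | apply hρ.app | apply dFloor.app
  refine ⟨n, C, T.mono.injective, ?_, hN, dC, ?_, dop (· + ·) rfl, dop (· * ·) rfl⟩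
  · intro X Y e
    ext k
    rw [hmem, hmem, e]
  · have : S.Def2 fun x c => (∃ X, c = C X) ∧ ∃ y l, (∃ k, x = n k ∧ y = n (k + 1)) ∧
        Floor ρ (ρ x) c l ∧ ¬ Floor ρ (ρ y) c l := by
      unfold Def2
      repeat' with_reducible first
        | exact var _ | apply S.and | apply dsuc.app | apply dC.app | apply S.ex
        | apply S.not | apply dFloor.app | apply hρ.app
    refine congr this fun v => ⟨?_, ?_⟩
    · rintro ⟨k, X, e1, e2, e3⟩
      rw [e1, e2]
      obtain ⟨l, h1, h2⟩ := (hmem X k).1 e3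
      exact ⟨⟨X, rfl⟩, _, l, ⟨k, rfl, rfl⟩, h1, h2⟩
    · rintro ⟨⟨X, e1⟩, y, l, ⟨k, e2, rfl⟩, h1, h2⟩
      rw [e1, e2] at h1
      rw [e1] at h2
      exact ⟨k, X, e2, e1, (hmem X k).2 ⟨l, h1, h2⟩⟩

/-! ### Criteria for second-order arithmetic: superlevel sets and local extrema. -/

/-- `x` is, within distance `r`, a strict maximum of `b` on its left and a maximum on its right. -/
def LeftStrictMax (b : ℝ → ℝ) (p q x r : ℝ) : Prop :=
  0 < r ∧ p ≤ x - r ∧ x + r ≤ q ∧ (∀ y, x - r < y → y < x → b y < b x) ∧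
    ∀ y, x < y → y < x + r → b y ≤ b x

theorem LeftStrictMax.mono {b : ℝ → ℝ} {p q x r r' : ℝ} (h : LeftStrictMax b p q x r)
    (h0 : 0 < r') (hr : r' ≤ r) : LeftStrictMax b p q x r' :=
  ⟨h0, by linarith [h.2.1], by linarith [h.2.2.1], fun y h1 h2 => h.2.2.2.1 y (by linarith) h2,
    fun y h1 h2 => h.2.2.2.2 y h1 (by linarith)⟩

/-- The supremum of the admissible radii is itself admissible, because the conditions on values only
concern distances strictly less than the radius. Thus ranks can be handled without limits. -/
theorem le_sSup_leftStrictMax {b : ℝ → ℝ} {p q x r : ℝ} (hr : 0 < r) :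
    r ≤ sSup {r | LeftStrictMax b p q x r} ↔ LeftStrictMax b p q x r := by
  have hbdd : BddAbove {r | LeftStrictMax b p q x r} :=
    ⟨q - p, fun r h => by linarith [h.2.1, h.2.2.1, h.1]⟩
  refine ⟨fun h => ?_, fun h => le_csSup hbdd h⟩
  have key : ∀ r', 0 < r' → r' < r → LeftStrictMax b p q x r' := by
    intro r' h0 h1
    have hne : {r | LeftStrictMax b p q x r}.Nonempty := by
      rw [Set.nonempty_iff_ne_empty]
      intro he
      rw [he, Real.sSup_empty] at h
      linarith
    obtain ⟨r'', h2, h3⟩ := exists_lt_of_lt_csSup hne (h1.trans_le h)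
    exact LeftStrictMax.mono h2 h0 h3.le
  refine ⟨hr, ?_, ?_, fun y h1 h2 => ?_, fun y h1 h2 => ?_⟩
  · refine le_of_forall_pos_lt_add fun ε hε => ?_
    have := (key (max (r / 2) (r - ε / 2)) (by positivity) (max_lt (by linarith) (by linarith))).2.1
    linarith [le_max_right (r / 2) (r - ε / 2)]
  · refine le_of_forall_pos_lt_add fun ε hε => ?_
    have := (key (max (r / 2) (r - ε / 2)) (by positivity)
      (max_lt (by linarith) (by linarith))).2.2.1
    linarith [le_max_right (r / 2) (r - ε / 2)]
  · exact (key ((x - y + r) / 2) (by linarith) (by linarith)).2.2.2.1 y (by linarith) h2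
  · exact (key ((y - x + r) / 2) (by linarith) (by linarith)).2.2.2.2 y h1 (by linarith)

/-- A non-negative upper semicontinuous function whose positive superlevel sets are nowhere dense
but have dense union yields second-order arithmetic. -/
theorem secondOrderArith_of_superlevel {S : DefStr} (h : S.OrdField) {b : ℝ → ℝ} {p q : ℝ}
    (hpq : p < q) (hlt : S.Def2 fun x y => b x < b y)
    (hclosed : ∀ e, 0 < e → IsClosed {x | x ∈ Icc p q ∧ e ≤ b x})
    (hint : ∀ e x y, 0 < e → p ≤ x → x < y → y ≤ q → ∃ z, x < z ∧ z < y ∧ b z < e)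
    (hdense : ∀ x y, p ≤ x → x < y → y ≤ q → ∃ z, x < z ∧ z < y ∧ 0 < b z) :
    S.SecondOrderArith := by
  -- `SepRank` requires an interval of length at most one.
  set q' := min q (p + 1) with hq'
  have hq'q : q' ≤ q := min_le_left _ _
  set ρ : ℝ → ℝ := fun x => sSup {r | LeftStrictMax b p q' x r} with hρdef
  have hle : ∀ x r, 0 < r → (r ≤ ρ x ↔ LeftStrictMax b p q' x r) :=
    fun x r hr => le_sSup_leftStrictMax hr
  have H : SepRank ρ p q' := by
    refine ⟨lt_min hpq (by linarith), by linarith [min_le_right q (p + 1)], ?_, ?_, ?_⟩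
    · intro x hx
      have h1 := (hle x (ρ x) hx).1 le_rfl
      constructor <;> linarith [h1.2.1, h1.2.2.1]
    · intro x y r hr hx hy hxy
      -- Two points closer than `r` would fall in each other's range, giving `b y ≤ b x` and `b x <
      -- b y`; this is why the maximum is strict on one side only.
      by_contra hc
      have h1 := ((hle x r hr).1 hx).2.2.2.2 y hxy (by linarith)
      have h2 := ((hle y r hr).1 hy).2.2.2.1 x (by linarith) hxy
      linarith
    · intro x y hx hxy hy
      obtain ⟨z₀, hz1, hz2, hz3⟩ := hdense x y hx hxy (hy.trans hq'q)
      obtain ⟨x', hx1, hx2, hx3⟩ := hint _ x z₀ hz3 hx hz1 (by linarith)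
      obtain ⟨y', hy1, hy2, hy3⟩ := hint _ z₀ y hz3 (by linarith) hz2 (by linarith)
      have hcl : ∀ e, 0 < e → IsCompact (Icc x' y' ∩ {w | w ∈ Icc p q ∧ e ≤ b w}) :=
        fun e he => isCompact_Icc.inter_right (hclosed e he)
      have hsub : ∀ w, w ∈ Icc x' y' → w ∈ Icc p q := fun w hw =>
        ⟨by linarith [hw.1], by linarith [hw.2]⟩
      have husc : UpperSemicontinuousOn b (Icc x' y' ∩ {w | w ∈ Icc p q ∧ b z₀ ≤ b w}) := by
        intro w hw y hwy
        have hy0 : 0 < y := hz3.trans_le (hw.2.2.trans hwy.le)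
        have : w ∉ {w | w ∈ Icc p q ∧ y ≤ b w} := fun hc => absurd hc.2 (not_le.2 hwy)
        filter_upwards [mem_nhdsWithin_of_mem_nhds ((hclosed y hy0).isOpen_compl.mem_nhds this),
          self_mem_nhdsWithin] with u hu1 hu2
        by_contra hc
        exact hu1 ⟨hu2.2.1, not_lt.1 hc⟩
      have hz0 : z₀ ∈ Icc x' y' := ⟨hx2.le, hy1.le⟩
      have hne : (Icc x' y' ∩ {w | w ∈ Icc p q ∧ b z₀ ≤ b w}).Nonempty :=
        ⟨z₀, hz0, hsub _ hz0, le_rfl⟩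
      obtain ⟨m, hm, hmax⟩ := UpperSemicontinuousOn.exists_isMaxOn hne (hcl _ hz3) husc
      have hmax' : ∀ w ∈ Icc x' y', b w ≤ b m := by
        intro w hw
        rcases le_total (b z₀) (b w) with h1 | h1
        · exact isMaxOn_iff.1 hmax w ⟨hw, hsub w hw, h1⟩
        · exact h1.trans hm.2.2
      have hbm : 0 < b m := hz3.trans_le hm.2.2
      -- Taking the leftmost point where the maximum is attained gives strictness on the left. It is
      -- interior because `b` is smaller at both ends `x'` and `y'`.
      obtain ⟨z, hz, hleast⟩ := (hcl _ hbm).exists_isLeast ⟨m, hm.1, hm.2.1, le_rfl⟩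
      have hx'z : x' < z := lt_of_le_of_ne hz.1.1 fun e => by
        have := hz.2.2
        rw [← e] at this
        linarith [hm.2.2]
      have hzy' : z < y' := lt_of_le_of_ne hz.1.2 fun e => by
        have := hz.2.2
        rw [e] at this
        linarith [hm.2.2]
      refine ⟨z, by linarith, by linarith, ?_⟩
      have hr : 0 < min (z - x') (y' - z) := lt_min (by linarith) (by linarith)
      refine hr.trans_le ((hle z _ hr).2 ⟨hr, ?_, ?_, fun w h1 h2 => ?_, fun w h1 h2 => ?_⟩)
      · linarith [min_le_left (z - x') (y' - z)]
      · linarith [min_le_right (z - x') (y' - z)]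
      · by_contra hc
        have hw : w ∈ Icc x' y' := ⟨by linarith [min_le_left (z - x') (y' - z)], by linarith⟩
        have := hleast ⟨hw, hsub w hw, hz.2.2.trans (not_lt.1 hc)⟩
        linarith
      · exact (hmax' w ⟨by linarith, by linarith [min_le_right (z - x') (y' - z)]⟩).trans hz.2.2
  refine H.secondOrderArith h (ρ := ρ) ?_
  have hR : S.Def2 fun x r => LeftStrictMax b p q' x r := by
    unfold LeftStrictMax Def2
    simp only [← not_lt (a := b _)]
    repeat' with_reducible first
      | exact var _ | exact const _ | apply S.and | apply all | apply S.not | apply imp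
      | apply hlt.app | apply h.lt | apply h.le | apply h.sub | apply h.add
  have : S.Def2 fun x v => (v = 0 ∧ ∀ r, ¬ LeftStrictMax b p q' x r) ∨
      (LeftStrictMax b p q' x v ∧ ∀ r, v < r → ¬ LeftStrictMax b p q' x r) := by
    unfold Def2
    repeat' with_reducible first
      | exact var _ | exact const _ | apply S.and | apply DefStr.or | apply all | apply S.not
      | apply imp | apply hR.app | apply h.lt | apply eq
  refine congr this fun v => ?_
  generalize v 0 = x
  generalize v 1 = t
  constructor
  · rintro rfl
    rcases le_or_gt (ρ x) 0 with h0 | h0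
    · left
      have hn : ∀ r, ¬ LeftStrictMax b p q' x r := fun r hr =>
        absurd ((hle x r hr.1).2 hr) (not_le.2 (h0.trans_lt hr.1))
      refine ⟨?_, hn⟩
      simp [hρdef, hn]
    · right
      exact ⟨(hle x _ h0).1 le_rfl, fun r hr hc => absurd ((hle x r hc.1).2 hc) (not_le.2 hr)⟩
  · rintro (⟨rfl, hn⟩ | ⟨h1, h2⟩)
    · simp [hρdef, hn]
    · have h3 := (hle x t h1.1).2 h1
      refine le_antisymm h3 (not_lt.1 fun h4 => h2 _ h4 ((hle x _ (h1.1.trans_le h3)).1 le_rfl))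

/-- `v` is the value of `H` at a local extremum of radius `r` inside `[c, d]`. -/
def ExtrValue (H : ℝ → ℝ) (c d v r : ℝ) : Prop :=
  ∃ x, c ≤ x - r ∧ x + r ≤ d ∧ H x = v ∧
    ((∀ y, x - r < y → y < x + r → H y ≤ H x) ∨ ∀ y, x - r < y → y < x + r → H x ≤ H y)

theorem ExtrValue.mono {H : ℝ → ℝ} {c d v r r' : ℝ} (h : ExtrValue H c d v r) (hr : r' ≤ r) :
    ExtrValue H c d v r' := by
  obtain ⟨x, h1, h2, h3, h4⟩ := h
  refine ⟨x, by linarith, by linarith, h3, ?_⟩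
  exact h4.imp (fun h y h1 h2 => h y (by linarith) (by linarith))
    fun h y h1 h2 => h y (by linarith) (by linarith)

/-- Two maxima of radius `r` at distance less than `r` dominate each other and so have the same
value. Hence the integer part of position over `r` determines the value; minima follow by negation.
-/
theorem finite_extrValue (H : ℝ → ℝ) (c d : ℝ) {r : ℝ} (hr : 0 < r) :
    {v | ExtrValue H c d v r}.Finite := by
  have key : ∀ H : ℝ → ℝ, {v | ∃ x, c ≤ x - r ∧ x + r ≤ d ∧ H x = v ∧
      ∀ y, x - r < y → y < x + r → H y ≤ H x}.Finite := by
    intro H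
    have : ∀ v : {v | ∃ x, c ≤ x - r ∧ x + r ≤ d ∧ H x = v ∧
      ∀ y, x - r < y → y < x + r → H y ≤ H x}, ∃ x, c ≤ x - r ∧ x + r ≤ d ∧ H x = v ∧
      ∀ y, x - r < y → y < x + r → H y ≤ H x := fun v => v.2
    choose x hx using this
    rw [← Set.finite_coe_iff]
    refine Finite.of_injective (β := Set.Icc ⌊c / r⌋ ⌊d / r⌋) (fun v => ⟨⌊x v / r⌋, ?_, ?_⟩) ?_
    · exact Int.floor_le_floor (by gcongr; linarith [(hx v).1])
    · exact Int.floor_le_floor (by gcongr; linarith [(hx v).2.1])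
    · intro v w e
      have h2 := Int.abs_sub_lt_one_of_floor_eq_floor (congrArg Subtype.val e)
      rw [← sub_div, abs_div, abs_of_pos hr, div_lt_one hr, abs_lt] at h2
      refine Subtype.ext ?_
      rw [← (hx v).2.2.1, ← (hx w).2.2.1]
      exact le_antisymm ((hx w).2.2.2 _ (by linarith) (by linarith))
        ((hx v).2.2.2 _ (by linarith) (by linarith))
  refine ((key H).union ((key fun x => -H x).image fun v => -v)).subset ?_
  rintro v ⟨x, h1, h2, h3, h4⟩
  rcases h4 with h4 | h4
  · exact Or.inl ⟨x, h1, h2, h3, h4⟩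
  · exact Or.inr ⟨-v, ⟨x, h1, h2, by rw [h3], fun y h5 h6 => neg_le_neg (h4 y h5 h6)⟩, by simp⟩

/-- A continuous injection on an interval is strictly monotone. Otherwise some value is taken twice,
and an extremum lies strictly between, as in Rolle's theorem. -/
theorem exists_extr_of_not_strictMono {H : ℝ → ℝ} {c d : ℝ} (hcd : c < d)
    (hH : ContinuousOn H (Icc c d)) (h1 : ¬ StrictMonoOn H (Ioo c d))
    (h2 : ¬ StrictAntiOn H (Ioo c d)) : ∃ x r, 0 < r ∧ c ≤ x - r ∧ x + r ≤ d ∧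
    ((∀ y, x - r < y → y < x + r → H y ≤ H x) ∨ ∀ y, x - r < y → y < x + r → H x ≤ H y) := by
  have hinj : ¬ InjOn H (Ioo c d) := fun hi =>
    (ContinuousOn.strictMonoOn_of_injOn_Ioo hcd (hH.mono Ioo_subset_Icc_self) hi).elim h1 h2
  have : ∃ x y, c < x ∧ x < y ∧ y < d ∧ H x = H y := by
    simp only [InjOn, not_forall] at hinj
    obtain ⟨x, hx, y, hy, e, hne⟩ := hinj
    rcases lt_or_gt_of_ne hne with h | h
    · exact ⟨x, y, hx.1, h, hy.2, e⟩
    · exact ⟨y, x, hy.1, h, hx.2, e.symm⟩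
  obtain ⟨x, y, hx, hxy, hy, e⟩ := this
  obtain ⟨z, hz, hext⟩ := exists_Ioo_extr_on_Icc hxy (hH.mono (Icc_subset_Icc hx.le hy.le)) e
  refine ⟨z, min (z - x) (y - z), lt_min (by linarith [hz.1]) (by linarith [hz.2]), ?_, ?_, ?_⟩
  · linarith [min_le_left (z - x) (y - z)]
  · linarith [min_le_right (z - x) (y - z)]
  · have hmem : ∀ w, z - min (z - x) (y - z) < w → w < z + min (z - x) (y - z) → w ∈ Icc x y :=
      fun w h1 h2 => ⟨by linarith [min_le_left (z - x) (y - z)],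
        by linarith [min_le_right (z - x) (y - z)]⟩
    exact hext.symm.imp (fun h w h1 h2 => h (hmem w h1 h2)) fun h w h1 h2 => h (hmem w h1 h2)

/-- A continuous function that is strictly monotone on no interval and whose local extremal values
are compared definably yields second-order arithmetic. -/
theorem secondOrderArith_of_extrValue {S : DefStr} (h : S.OrdField) {H : ℝ → ℝ} {c d v₁ v₂ : ℝ}
    (hH : ContinuousOn H (Icc c d)) (hv : v₁ < v₂) (hrange : Icc v₁ v₂ ⊆ H '' Icc c d)
    (hmono : ∀ x y, c ≤ x → x < y → y ≤ d → ¬ StrictMonoOn H (Ioo x y) ∧ ¬ StrictAntiOn H (Ioo x y))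
    (hdef : S.Def2 fun v w => ∃ s r, 0 ≤ s ∧ s < r ∧ ExtrValue H c d w r ∧
      ∀ s', s < s' → ¬ ExtrValue H c d v s') : S.SecondOrderArith := by
  -- The criterion is applied on the line of values, to the largest radius of an extremum with a
  -- given value. Only the comparison of two such radii has to be definable, so the domain of `H`
  -- need not be the line of the structure `S`.
  set b : ℝ → ℝ := fun v => sSup {r | 0 < r ∧ ExtrValue H c d v r} with hb
  have hbdd : ∀ v, BddAbove {r | 0 < r ∧ ExtrValue H c d v r} := by
    refine fun v => ⟨d - c, ?_⟩
    rintro r ⟨h0, x, h1, h2, -⟩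
    linarith
  have b0 : ∀ v, 0 ≤ b v := fun v => Real.sSup_nonneg fun r hr => hr.1.le
  have hlt : ∀ e v, 0 < e → e ≤ b v → ExtrValue H c d v (e / 2) := by
    intro e v he hev
    have hne : {r | 0 < r ∧ ExtrValue H c d v r}.Nonempty := by
      rw [Set.nonempty_iff_ne_empty]
      intro h0
      rw [hb] at hev
      simp only [h0, Real.sSup_empty] at hev
      linarith
    obtain ⟨r, hr, hr2⟩ := exists_lt_of_lt_csSup hne (show e / 2 < b v by linarith)
    exact hr.2.mono hr2.le
  have hfin : ∀ e, 0 < e → {v | e ≤ b v}.Finite := fun e he =>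
    (finite_extrValue H c d (half_pos he)).subset fun v hv => hlt e v he hv
  refine secondOrderArith_of_superlevel h hv (b := b) (congr hdef fun v => ?_) ?_ ?_ ?_
  · constructor
    · intro hvw
      have hne : {r | 0 < r ∧ ExtrValue H c d (v 1) r}.Nonempty := ⟨b (v 1) / 2, by
        linarith [b0 (v 0)], hlt _ _ (by linarith [b0 (v 0)]) le_rfl⟩
      obtain ⟨r, hr, hr2⟩ := exists_lt_of_lt_csSup hne hvw
      refine ⟨b (v 0), r, b0 _, hr2, hr.2, fun s' hs' hc => ?_⟩
      have : s' ≤ b (v 0) := le_csSup (hbdd _) ⟨(b0 _).trans_lt hs', hc⟩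
      linarith
    · rintro ⟨s, r, h1, h2, h3, h4⟩
      have h5 : r ≤ b (v 1) := le_csSup (hbdd _) ⟨by linarith, h3⟩
      have h6 : b (v 0) ≤ s := Real.sSup_le (fun x hx => not_lt.1 fun hc => h4 x hc hx.2) h1
      linarith
  · exact fun e he => ((hfin e he).subset fun x hx => hx.2).isClosed
  · intro e x y he hx hxy hy
    obtain ⟨z, hz, hz2⟩ := ((Ioo_infinite hxy).sdiff (hfin e he)).nonempty
    exact ⟨z, hz.1, hz.2, not_le.1 hz2⟩
  · intro x y hx hxy hy
    obtain ⟨u, hu, hu2⟩ := hrange (show (x + y) / 2 ∈ Icc v₁ v₂ from ⟨by linarith, by linarith⟩)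
    have hcd : c < d := by
      rcases (hu.1.trans hu.2).lt_or_eq with h | h
      · exact h
      · obtain ⟨w, hw, hw2⟩ := hrange (left_mem_Icc.2 hv.le)
        obtain ⟨w', hw', hw2'⟩ := hrange (right_mem_Icc.2 hv.le)
        have : w = w' := by linarith [hw.1, hw.2, hw'.1, hw'.2]
        rw [this] at hw2
        linarith
    have hnhds : H ⁻¹' Ioo x y ∈ 𝓝[Icc c d] u :=
      hH u hu (Ioo_mem_nhds (by linarith) (by linarith))
    obtain ⟨ε, hε, hball⟩ := Metric.mem_nhdsWithin_iff.1 hnhds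
    obtain ⟨c', d', h1, h2, h3, h4⟩ : ∃ c' d', c ≤ c' ∧ c' < d' ∧ d' ≤ d ∧
        Icc c' d' ⊆ Metric.ball u ε := by
      refine ⟨max c (u - ε / 2), min d (u + ε / 2), le_max_left _ _, ?_, min_le_left _ _, ?_⟩
      · simp only [max_lt_iff, lt_min_iff]
        refine ⟨⟨hcd, ?_⟩, ?_, ?_⟩ <;> linarith [hu.1, hu.2]
      · intro w hw
        rw [Metric.mem_ball, Real.dist_eq, abs_lt]
        constructor <;> linarith [hw.1, hw.2, le_max_right c (u - ε / 2),
          min_le_right d (u + ε / 2)]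
    obtain ⟨z, r, hr, h5, h6, h7⟩ := exists_extr_of_not_strictMono h2
      (hH.mono (Icc_subset_Icc h1 h3)) (hmono c' d' h1 h2 h3).1 (hmono c' d' h1 h2 h3).2
    have hz := hball ⟨h4 (show z ∈ Icc c' d' from ⟨by linarith, by linarith⟩),
      ⟨by linarith, by linarith⟩⟩
    refine ⟨H z, hz.1, hz.2, hr.trans_le (le_csSup (hbdd _) ⟨hr, z, ?_, ?_, rfl, h7⟩)⟩ <;> linarith

/-! ### Germs, slopes and their definable comparison. -/

/-- `a t < b t` for all sufficiently small `t > 0`. -/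
def Ev (a b : ℝ → ℝ) : Prop := ∃ ε, 0 < ε ∧ ∀ t, 0 < t → t < ε → a t < b t

/-- `a` is a germ at `0` with slope `A` from the right. -/
def IsGerm (a : ℝ → ℝ) (A : ℝ) : Prop := Tendsto (fun t => a t / t) (𝓝[>] 0) (𝓝 A)

theorem IsGerm.ev_of_lt {a b : ℝ → ℝ} {A B : ℝ} (ha : IsGerm a A) (hb : IsGerm b B)
    (h : A < B) : Ev a b := by
  have h1 := ha.eventually_lt hb h
  obtain ⟨ε, hε, hsub⟩ := mem_nhdsGT_iff_exists_Ioo_subset.1 h1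
  exact ⟨ε, hε, fun t h0 h2 => (div_lt_div_iff_of_pos_right h0).1 (hsub ⟨h0, h2⟩)⟩

/-- Strictness is lost in the limit: germs of equal slope may still be eventually ordered. This is
the ambiguity that `SlopeData.lt_iff` removes. -/
theorem IsGerm.le_of_ev {a b : ℝ → ℝ} {A B : ℝ} (ha : IsGerm a A) (hb : IsGerm b B)
    (h : Ev a b) : A ≤ B := by
  obtain ⟨ε, hε, h⟩ := h
  refine le_of_tendsto_of_tendsto ha hb ?_
  filter_upwards [Ioo_mem_nhdsGT hε] with t ht
  exact ((div_lt_div_iff_of_pos_right ht.1).2 (h t ht.1 ht.2)).le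

theorem IsGerm.unique {a b : ℝ → ℝ} {A B ε : ℝ} (ha : IsGerm a A) (hb : IsGerm b B)
    (hε : 0 < ε) (h : ∀ t, 0 < t → t < ε → a t = b t) : A = B := by
  refine tendsto_nhds_unique ha (hb.congr' ?_)
  filter_upwards [Ioo_mem_nhdsGT hε] with t ht
  rw [h t ht.1 ht.2]

theorem isGerm_of_hasDerivAt {f : ℝ → ℝ} {A x : ℝ} (h : HasDerivAt f A x) :
    IsGerm (fun t => f (x + t) - f x) A := by
  refine h.tendsto_slope_zero_right.congr fun t => ?_
  rw [smul_eq_mul, div_eq_inv_mul]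

theorem IsGerm.add {a b : ℝ → ℝ} {A B : ℝ} (ha : IsGerm a A) (hb : IsGerm b B) :
    IsGerm (fun t => a t + b t) (A + B) := by
  refine (Tendsto.add ha hb).congr fun t => ?_
  rw [add_div]

/-- The chain rule: composing germs multiplies slopes, so products of slopes are available although
only addition is definable. -/
theorem isGerm_comp {f : ℝ → ℝ} {A B x y : ℝ} (hx : HasDerivAt f A x) (hy : HasDerivAt f B y) :
    IsGerm (fun t => f (x + (f (y + t) - f y)) - f x) (A * B) := by
  have h1 : HasDerivAt (fun t => f (y + t)) B 0 := by
    have : HasDerivAt f B (y + 0) := by simpa using hy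
    simpa using this.comp_const_add y 0
  have h2 : HasDerivAt (fun t => x + (f (y + t) - f y)) B 0 := (h1.sub_const _).const_add _
  have h3 : HasDerivAt f A (x + (f (y + 0) - f y)) := by simpa using hx
  have h4 : HasDerivAt (fun t => f (x + (f (y + t) - f y))) (A * B) 0 := h3.comp 0 h2
  have := isGerm_of_hasDerivAt h4
  simpa using this

/-- A subinterval on which a continuous function lies strictly between two of its values and
which it crosses. -/
theorem exists_crossing {g : ℝ → ℝ} {x y : ℝ} (hg : ContinuousOn g (Icc x y)) (hxy : x ≤ y)
    (h : g x < g y) : ∃ u v, x ≤ u ∧ u < v ∧ v ≤ y ∧ g u < g v ∧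
      ∀ z, u < z → z < v → g x < g z ∧ g z < g y := by
  have c1 : IsCompact (Icc x y ∩ g ⁻¹' Iic (g x)) :=
    isCompact_Icc.of_isClosed_subset (hg.preimage_isClosed_of_isClosed isClosed_Icc isClosed_Iic)
      inter_subset_left
  obtain ⟨u, hu, hgr⟩ := c1.exists_isGreatest ⟨x, ⟨le_rfl, hxy⟩, le_refl (g x)⟩
  have c2 : IsCompact (Icc u y ∩ g ⁻¹' Ici (g y)) :=
    isCompact_Icc.of_isClosed_subset ((hg.mono (Icc_subset_Icc hu.1.1 le_rfl)).preimage_isClosed_of_isClosed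
      isClosed_Icc isClosed_Ici) inter_subset_left
  obtain ⟨v, hv, hl⟩ := c2.exists_isLeast ⟨y, ⟨hu.1.2, le_rfl⟩, le_refl (g y)⟩
  have huv : g u < g v := (show g u ≤ g x from hu.2).trans_lt (h.trans_le hv.2)
  refine ⟨u, v, hu.1.1, lt_of_le_of_ne hv.1.1 fun e => ?_, hv.1.2, huv, fun z h1 h2 => ⟨?_, ?_⟩⟩
  · rw [e] at huv
    exact lt_irrefl _ huv
  · by_contra hc
    have := hgr (a := z) ⟨⟨hu.1.1.trans h1.le, h2.le.trans hv.1.2⟩, not_lt.1 hc⟩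
    linarith
  · by_contra hc
    have := hl (a := z) ⟨⟨h1.le, h2.le.trans hv.1.2⟩, not_lt.1 hc⟩
    linarith

/-- A definable function on the line whose derivative `g` on `[c, d]` is continuous and takes
the values `-9` and `9`. -/
structure SlopeData (S : DefStr) (f g : ℝ → ℝ) (c d e₁ e₂ : ℝ) : Prop where
  grp : S.OrdGroup
  fn : S.Fun1 f
  deriv : ∀ x ∈ Icc c d, HasDerivAt f (g x) x
  cont : ContinuousOn g (Icc c d)
  mem₁ : e₁ ∈ Icc c d
  mem₂ : e₂ ∈ Icc c d
  val₁ : g e₁ = -9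
  val₂ : g e₂ = 9

namespace SlopeData

variable {S : DefStr} {f g : ℝ → ℝ} {c d e₁ e₂ : ℝ} (D : SlopeData S f g c d e₁ e₂)
include D

theorem exists_value {t : ℝ} (ht : t ∈ Icc (-9) 9) : ∃ x ∈ Icc c d, g x = t := by
  have h1 : uIcc e₁ e₂ ⊆ Icc c d := uIcc_subset_Icc D.mem₁ D.mem₂
  have h2 := intermediate_value_uIcc (D.cont.mono h1)
  rw [D.val₁, D.val₂, uIcc_of_le (by norm_num)] at h2
  obtain ⟨x, hx, hx2⟩ := h2 ht
  exact ⟨x, h1 hx, hx2⟩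

/-- On the crossing interval `g` lies strictly between the two values. It has different values at
the ends, so by continuity it is not constant on the open interval either. -/
theorem exists_between {x y : ℝ} (hx : x ∈ Icc c d) (hy : y ∈ Icc c d) (h : g x < g y) :
    ∃ u v, c ≤ u ∧ u < v ∧ v ≤ d ∧ (∃ z z', u < z ∧ z < v ∧ u < z' ∧ z' < v ∧ g z < g z') ∧
      ∀ z, u < z → z < v → g x < g z ∧ g z < g y := by
  have key : ∀ u v, c ≤ u → u < v → v ≤ d → g u ≠ g v →
      ∃ z z', u < z ∧ z < v ∧ u < z' ∧ z' < v ∧ g z < g z' := by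
    intro u v h1 h2 h3 h4
    by_contra! hc
    have heq : EqOn g (fun _ => g ((u + v) / 2)) (Icc u v) :=
      EqOn.of_subset_closure (s := Ioo u v)
        (fun z hz => le_antisymm (hc _ z (by linarith) (by linarith) hz.1 hz.2)
          (hc z _ hz.1 hz.2 (by linarith) (by linarith)))
        (D.cont.mono (Icc_subset_Icc h1 h3)) continuousOn_const Ioo_subset_Icc_self
        (closure_Ioo h2.ne).ge
    exact h4 ((heq (left_mem_Icc.2 h2.le)).trans (heq (right_mem_Icc.2 h2.le)).symm)
  rcases le_total x y with hxy | hxy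
  · obtain ⟨u, v, h1, h2, h3, h4, h5⟩ :=
      exists_crossing (D.cont.mono (Icc_subset_Icc hx.1 hy.2)) hxy h
    exact ⟨u, v, hx.1.trans h1, h2, h3.trans hy.2,
      key u v (hx.1.trans h1) h2 (h3.trans hy.2) h4.ne, h5⟩
  · obtain ⟨u, v, h1, h2, h3, h4, h5⟩ :=
      exists_crossing (D.cont.mono (Icc_subset_Icc hy.1 hx.2)).neg hxy (neg_lt_neg h)
    exact ⟨u, v, hy.1.trans h1, h2, h3.trans hx.2,
      key u v (hy.1.trans h1) h2 (h3.trans hx.2) (neg_lt_neg_iff.1 h4).ne',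
      fun z h6 h7 => ⟨neg_lt_neg_iff.1 (h5 z h6 h7).2, neg_lt_neg_iff.1 (h5 z h6 h7).1⟩⟩

theorem germ {x : ℝ} (hx : x ∈ Icc c d) : IsGerm (fun t => f (x + t) - f x) (g x) :=
  isGerm_of_hasDerivAt (D.deriv x hx)

/-- An interval whose germs all lie eventually between those of `x` and `y` has slopes in `[g x, g
y]`. If `g y ≤ g x` these slopes are all equal, so increments of `f` over a given step are equal
throughout the interval, contrary to the last clause. Conversely a strict inequality supplies such
an interval through `exists_between`. The right side mentions only `f`, `+` and `<`. -/
theorem lt_iff {x y : ℝ} (hx : x ∈ Icc c d) (hy : y ∈ Icc c d) : g x < g y ↔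
    ∃ u v, c ≤ u ∧ u < v ∧ v ≤ d ∧
      (∀ z, u < z → z < v → Ev (fun t => f (x + t) - f x) (fun t => f (z + t) - f z) ∧
        Ev (fun t => f (z + t) - f z) (fun t => f (y + t) - f y)) ∧
      ∃ z z' t, u < z ∧ u < z' ∧ 0 < t ∧ z + t < v ∧ z' + t < v ∧
        ¬ f (z + t) - f z = f (z' + t) - f z' := by
  constructor
  · intro h
    obtain ⟨u, v, h1, h2, h3, ⟨w, w', hw1, hw2, hw3, hw4, h4⟩, h5⟩ := D.exists_between hx hy h
    have hm : ∀ z, u < z → z < v → z ∈ Icc c d := fun z h6 h7 =>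
      ⟨h1.trans h6.le, h7.le.trans h3⟩
    refine ⟨u, v, h1, h2, h3, fun z h6 h7 =>
      ⟨(D.germ hx).ev_of_lt (D.germ (hm z h6 h7)) (h5 z h6 h7).1,
        (D.germ (hm z h6 h7)).ev_of_lt (D.germ hy) (h5 z h6 h7).2⟩, ?_⟩
    by_contra hc
    push Not at hc
    refine h4.ne ((D.germ (hm w hw1 hw2)).unique (D.germ (hm w' hw3 hw4))
      (ε := min (v - w) (v - w')) (lt_min (by linarith) (by linarith)) fun t h10 h11 => ?_)
    rw [lt_min_iff] at h11
    exact hc w w' t hw1 hw3 h10 (by linarith) (by linarith)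
  · rintro ⟨u, v, h1, h2, h3, h4, z, z', t, h5, h6, h7, h8, h9, h10⟩
    have hm : ∀ z, u < z → z < v → z ∈ Icc c d := fun z h6 h7 =>
      ⟨h1.trans h6.le, h7.le.trans h3⟩
    by_contra hc
    have hconst : ∀ z, u < z → z < v → g z = g x := by
      intro z h11 h12
      have h13 := (D.germ hx).le_of_ev (D.germ (hm z h11 h12)) (h4 z h11 h12).1
      have h14 := (D.germ (hm z h11 h12)).le_of_ev (D.germ hy) (h4 z h11 h12).2
      linarith
    have hslope : ∀ z, u < z → z + t < v → f (z + t) - f z = t * g x := by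
      intro z h11 h12
      have hm' : ∀ w ∈ Icc z (z + t), w ∈ Icc c d := fun w hw =>
        hm w (by linarith [hw.1]) (by linarith [hw.2])
      obtain ⟨w, hw, hw2⟩ := exists_hasDerivAt_eq_slope f g (show z < z + t by linarith)
        (fun w hw => (D.deriv w (hm' w hw)).continuousAt.continuousWithinAt)
        (fun w hw => D.deriv w (hm' w (Ioo_subset_Icc_self hw)))
      rw [hconst w (by linarith [hw.1]) (by linarith [hw.2]), add_sub_cancel_left,
        eq_div_iff h7.ne'] at hw2
      linarith
    exact h10 ((hslope z h5 h8).trans (hslope z' h6 h9).symm)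

theorem def_lt : S.Def2 fun x y => (c ≤ x ∧ x ≤ d) ∧ (c ≤ y ∧ y ≤ d) ∧ g x < g y := by
  have h := D.grp
  have hf := D.fn
  have : S.Def2 fun x y => (c ≤ x ∧ x ≤ d) ∧ (c ≤ y ∧ y ≤ d) ∧ ∃ u v, c ≤ u ∧ u < v ∧ v ≤ d ∧
      (∀ z, u < z → z < v → Ev (fun t => f (x + t) - f x) (fun t => f (z + t) - f z) ∧
        Ev (fun t => f (z + t) - f z) (fun t => f (y + t) - f y)) ∧
      ∃ z z' t, u < z ∧ u < z' ∧ 0 < t ∧ z + t < v ∧ z' + t < v ∧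
        ¬ f (z + t) - f z = f (z' + t) - f z' := by
    unfold Ev Def2
    repeat' with_reducible first
      | exact var _ | exact const _ | apply S.and | apply S.ex | apply all | apply S.not | apply imp
      | apply h.lt | apply h.le | apply eq | apply h.sub | apply h.add | apply hf.app
  refine congr this fun v => ?_
  refine and_congr_right fun h1 => and_congr_right fun h2 => D.lt_iff h1 h2

end SlopeData

/-! ### The definable field of slopes. -/

/-- The order isomorphism from `(-1, 1)` to `ℝ`. -/
noncomputable def expand (u : ℝ) : ℝ := u / (1 - |u|)

/-- The inverse of `expand`. -/
noncomputable def shrink (y : ℝ) : ℝ := y / (1 + |y|)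

theorem abs_shrink_lt (y : ℝ) : |shrink y| < 1 := by
  have : 0 < 1 + |y| := by positivity
  rw [shrink, abs_div, abs_of_pos this, div_lt_one this]
  linarith

theorem expand_shrink (y : ℝ) : expand (shrink y) = y := by
  have h : 0 < 1 + |y| := by positivity
  rw [expand, shrink, abs_div, abs_of_pos h]
  field_simp
  ring

theorem shrink_expand {u : ℝ} (hu : |u| < 1) : shrink (expand u) = u := by
  have h : 0 < 1 - |u| := by linarith
  rw [expand, shrink, abs_div, abs_of_pos h]
  field_simp
  ring

theorem expand_lt_expand {u v : ℝ} (hu : |u| < 1) (hv : |v| < 1) :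
    expand u < expand v ↔ u < v := by
  have key : ∀ {u v : ℝ}, |u| < 1 → |v| < 1 → u < v → expand u < expand v := by
    intro u v hu hv h
    rw [expand, expand, div_lt_div_iff₀ (by linarith) (by linarith)]
    rw [abs_lt] at hu hv
    rcases abs_cases u with ⟨h1, h2⟩ | ⟨h1, h2⟩ <;> rcases abs_cases v with ⟨h3, h4⟩ | ⟨h3, h4⟩ <;>
      rw [h1, h3] <;> nlinarith
  refine ⟨fun h => ?_, key hu hv⟩
  by_contra hc
  rcases (not_lt.1 hc).lt_or_eq with h1 | h1
  · exact lt_asymm h (key hv hu h1)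
  · rw [h1] at h
    exact lt_irrefl _ h

/-- Clearing denominators leaves an identity between bounded terms built from sums, products and
absolute values, which can be evaluated among slopes. -/
theorem expand_add_iff {u v w : ℝ} (hu : |u| < 1) (hv : |v| < 1) (hw : |w| < 1) :
    expand u + expand v = expand w ↔
      w * (1 - |u|) * (1 - |v|) = (1 - |w|) * (u * (1 - |v|) + v * (1 - |u|)) := by
  have h1 : 1 - |u| ≠ 0 := by linarith
  have h2 : 1 - |v| ≠ 0 := by linarith
  have h3 : 1 - |w| ≠ 0 := by linarith
  rw [expand, expand, expand, div_add_div _ _ h1 h2, div_eq_div_iff (mul_ne_zero h1 h2) h3]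
  constructor <;> intro h <;> linarith

theorem expand_mul_iff {u v w : ℝ} (hu : |u| < 1) (hv : |v| < 1) (hw : |w| < 1) :
    expand u * expand v = expand w ↔ w * (1 - |u|) * (1 - |v|) = (1 - |w|) * (u * v) := by
  have h1 : 1 - |u| ≠ 0 := by linarith
  have h2 : 1 - |v| ≠ 0 := by linarith
  have h3 : 1 - |w| ≠ 0 := by linarith
  rw [expand, expand, expand, div_mul_div_comm, div_eq_div_iff (mul_ne_zero h1 h2) h3]
  constructor <;> intro h <;> linarith

/-- `z ∈ [c, d]` has slope strictly between `-9` and `9`. -/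
def Mid (g : ℝ → ℝ) (c d z : ℝ) : Prop := (c ≤ z ∧ z ≤ d) ∧ -9 < g z ∧ g z < 9

/-- The slopes of points of `[c, d]` equal to `t` depend definably on the arguments of `t`,
and `|t| ≤ M`. -/
def Val (S : DefStr) (g : ℝ → ℝ) (c d M : ℝ) {α : Type} (t : (α → ℝ) → ℝ) : Prop :=
  (S.Def fun p : Option α → ℝ => Mid g c d (p none) ∧ g (p none) = t fun i => p (some i)) ∧
    ∀ v, |t v| ≤ M

namespace SlopeData

variable {S : DefStr} {f g : ℝ → ℝ} {c d e₁ e₂ : ℝ} (D : SlopeData S f g c d e₁ e₂)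
  {α : Type} [Finite α]
include D

theorem def_mid : S.Def1 (Mid g c d) := by
  have hl := D.def_lt
  have : S.Def1 fun z => ((c ≤ e₁ ∧ e₁ ≤ d) ∧ (c ≤ z ∧ z ≤ d) ∧ g e₁ < g z) ∧
      ((c ≤ z ∧ z ≤ d) ∧ (c ≤ e₂ ∧ e₂ ≤ d) ∧ g z < g e₂) := by
    unfold Def1
    repeat' with_reducible first
      | exact var _ | exact const _ | apply hl.app | apply S.and
  refine congr this fun v => ?_
  rw [D.val₁, D.val₂]
  have h1 := D.mem₁
  have h2 := D.mem₂
  simp only [Mid]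
  grind

theorem exists_mid {t : ℝ} (h1 : -9 < t) (h2 : t < 9) : ∃ z, Mid g c d z ∧ g z = t := by
  obtain ⟨z, hz, rfl⟩ := D.exists_value ⟨h1.le, h2.le⟩
  exact ⟨z, ⟨hz, h1, h2⟩, rfl⟩

/-- The points whose slope is that of a definable family of germs form a definable family. -/
theorem def_germ {P : (α → ℝ) → Prop} (hP : S.Def P) {a : (α → ℝ) → ℝ → ℝ}
    (ha : S.DFun fun p : Option α → ℝ => a (fun i => p (some i)) (p none)) {A : (α → ℝ) → ℝ}
    (hA : ∀ v, P v → IsGerm (a v) (A v)) :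
    S.Def fun p : Option α → ℝ => P (fun i => p (some i)) ∧ Mid g c d (p none) ∧
      g (p none) = A fun i => p (some i) := by
  have h := D.grp
  have hf := D.fn
  have hl := D.def_lt
  have hm := D.def_mid
  have hP' : S.Def fun p : Option α → ℝ => P (fun i => p (some i)) := S.reindex some hP
  have hEv : S.Def fun p : Option (Option α) → ℝ =>
      Ev (fun t => f (p none + t) - f (p none)) (a fun i => p (some (some i))) := by
    have ha' : S.DFun fun p : Option (Option (Option (Option α))) → ℝ =>
      a (fun i => p (some (some (some (some i))))) (p none) :=
        S.reindex (β := Option (Option (Option (Option (Option α))))) (fun o : Option (Option α) =>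
          o.elim none fun o => o.elim (some none) fun i => some (some (some (some (some i))))) ha
    unfold Ev
    repeat' with_reducible first
      | exact var _ | exact const _ | exact ha' | apply S.and | apply S.ex | apply all | apply imp
      | apply h.lt | apply h.sub | apply h.add | apply hf.app
  have hEv' : S.Def fun p : Option (Option α) → ℝ =>
      Ev (a fun i => p (some (some i))) (fun t => f (p none + t) - f (p none)) := by
    have ha' : S.DFun fun p : Option (Option (Option (Option α))) → ℝ =>
      a (fun i => p (some (some (some (some i))))) (p none) :=
        S.reindex (β := Option (Option (Option (Option (Option α))))) (fun o : Option (Option α) =>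
          o.elim none fun o => o.elim (some none) fun i => some (some (some (some (some i))))) ha
    unfold Ev
    repeat' with_reducible first
      | exact var _ | exact const _ | exact ha' | apply S.and | apply S.ex | apply all | apply imp
      | apply h.lt | apply h.sub | apply h.add | apply hf.app
  -- Equality of slopes is tested by cuts: the germ `a` must lie below every germ of larger slope
  -- than `p none` and above every one of smaller slope. This suffices because the available slopes
  -- fill `(-9, 9)`.
  have : S.Def fun p : Option α → ℝ => P (fun i => p (some i)) ∧ Mid g c d (p none) ∧
      ∀ z', (((c ≤ p none ∧ p none ≤ d) ∧ (c ≤ z' ∧ z' ≤ d) ∧ g (p none) < g z') →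
          Ev (a fun i => p (some i)) fun t => f (z' + t) - f z') ∧
        (((c ≤ z' ∧ z' ≤ d) ∧ (c ≤ p none ∧ p none ≤ d) ∧ g z' < g (p none)) →
          Ev (fun t => f (z' + t) - f z') (a fun i => p (some i))) := by
    repeat' with_reducible first
      | exact var _ | exact hP' | exact hEv | exact hEv' | apply hm.app | apply hl.app
      | apply S.and | apply all | apply imp
  refine congr this fun p => ?_
  refine and_congr_right fun h1 => and_congr_right fun h2 => ?_
  have hz : p none ∈ Icc c d := h2.1
  constructor
  · intro e z'
    constructor
    · rintro ⟨-, h3, h4⟩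
      exact (hA _ h1).ev_of_lt (D.germ h3) (e ▸ h4)
    · rintro ⟨h3, -, h4⟩
      exact (D.germ h3).ev_of_lt (hA _ h1) (e ▸ h4)
  · intro H
    rcases lt_trichotomy (g (p none)) (A fun i => p (some i)) with h3 | h3 | h3
    · obtain ⟨t, ht1, ht2⟩ := _root_.exists_between (lt_min h3 h2.2.2)
      rw [lt_min_iff] at ht2
      obtain ⟨z', hz', rfl⟩ := D.exists_mid (h2.2.1.trans ht1) ht2.2
      have := (hA _ h1).le_of_ev (D.germ hz'.1) ((H z').1 ⟨h2.1, hz'.1, ht1⟩)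
      linarith
    · exact h3
    · obtain ⟨t, ht1, ht2⟩ := _root_.exists_between (max_lt h3 h2.2.1)
      rw [max_lt_iff] at ht1
      obtain ⟨z', hz', rfl⟩ := D.exists_mid ht1.2 (ht2.trans h2.2.2)
      have := (D.germ hz'.1).le_of_ev (hA _ h1) ((H z').2 ⟨hz'.1, h2.1, ht2⟩)
      linarith

theorem def_add : S.Def3 fun x y z => (Mid g c d x ∧ Mid g c d y) ∧ Mid g c d z ∧
    g z = g x + g y := by
  have h := D.grp
  have hf := D.fn
  have hm := D.def_mid
  have := D.def_germ (α := Fin 2) (P := fun v => Mid g c d (v 0) ∧ Mid g c d (v 1))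
    (a := fun v t => (f (v 0 + t) - f (v 0)) + (f (v 1 + t) - f (v 1)))
    (A := fun v => g (v 0) + g (v 1)) (S.and (hm.app (var _)) (hm.app (var _))) (by
      repeat' with_reducible first
        | exact var _ | apply h.sub | apply h.add | apply hf.app)
    fun v hv => (D.germ hv.1.1).add (D.germ hv.2.1)
  exact S.reindex (β := Fin 3) (fun o : Option (Fin 2) => o.elim 2 ![0, 1]) this

theorem def_mul : S.Def3 fun x y z => (Mid g c d x ∧ Mid g c d y) ∧ Mid g c d z ∧
    g z = g x * g y := by
  have h := D.grp
  have hf := D.fn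
  have hm := D.def_mid
  have := D.def_germ (α := Fin 2) (P := fun v => Mid g c d (v 0) ∧ Mid g c d (v 1))
    (a := fun v t => f (v 0 + (f (v 1 + t) - f (v 1))) - f (v 0))
    (A := fun v => g (v 0) * g (v 1)) (S.and (hm.app (var _)) (hm.app (var _))) (by
      repeat' with_reducible first
        | exact var _ | apply h.sub | apply h.add | apply hf.app)
    fun v hv => isGerm_comp (D.deriv _ hv.1.1) (D.deriv _ hv.2.1)
  exact S.reindex (β := Fin 3) (fun o : Option (Fin 2) => o.elim 2 ![0, 1]) this

theorem def_eq : S.Def2 fun x y => Mid g c d x ∧ Mid g c d y ∧ g x = g y := by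
  have hl := D.def_lt
  have hm := D.def_mid
  have : S.Def2 fun x y => Mid g c d x ∧ Mid g c d y ∧
      ¬ ((c ≤ x ∧ x ≤ d) ∧ (c ≤ y ∧ y ≤ d) ∧ g x < g y) ∧
      ¬ ((c ≤ y ∧ y ≤ d) ∧ (c ≤ x ∧ x ≤ d) ∧ g y < g x) := by
    unfold Def2
    repeat' with_reducible first
      | exact var _ | exact const _ | apply hl.app | apply hm.app | apply S.and | apply S.not
  refine congr this fun v => and_congr_right fun h1 => and_congr_right fun h2 => ?_
  have h3 := h1.1
  have h4 := h2.1
  grind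

/-- Operands bounded below `9` are slopes of actual points, so they can be quantified over. The
result may have a larger bound, which matters only when it is used as an operand again. -/
theorem val_binary {F : ℝ → ℝ → ℝ} (hF : S.Def3 fun x y z => (Mid g c d x ∧ Mid g c d y) ∧
    Mid g c d z ∧ g z = F (g x) (g y)) {M N K : ℝ} {s t : (α → ℝ) → ℝ} (hs : Val S g c d M s)
    (ht : Val S g c d N t) (hM : M < 9) (hN : N < 9)
    (hK : ∀ x y, |x| ≤ M → |y| ≤ N → |F x y| ≤ K) :
    Val S g c d K fun v => F (s v) (t v) := by
  refine ⟨?_, fun v => hK _ _ (hs.2 v) (ht.2 v)⟩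
  have hs1 : S.Def fun p : Option (Option (Option α)) → ℝ => Mid g c d (p (some none)) ∧
      g (p (some none)) = s fun i => p (some (some (some i))) :=
    S.reindex (β := Option (Option (Option α)))
      (fun o : Option α => o.elim (some none) fun i => some (some (some i))) hs.1
  have ht1 : S.Def fun p : Option (Option (Option α)) → ℝ => Mid g c d (p none) ∧
      g (p none) = t fun i => p (some (some (some i))) :=
    S.reindex (β := Option (Option (Option α)))
      (fun o : Option α => o.elim none fun i => some (some (some i))) ht.1
  have := S.ex (α := Option α) (P := fun p x => ∃ y,
    (Mid g c d x ∧ g x = s fun i => p (some i)) ∧ (Mid g c d y ∧ g y = t fun i => p (some i)) ∧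
    (Mid g c d x ∧ Mid g c d y) ∧ Mid g c d (p none) ∧ g (p none) = F (g x) (g y))
    (S.ex (S.and hs1 (S.and ht1 (hF.app (var (some none)) (var none) (var (some (some none)))))))
  refine congr this fun p => ?_
  constructor
  · rintro ⟨h1, h2⟩
    have b1 := abs_lt.1 ((hs.2 fun i => p (some i)).trans_lt hM)
    have b2 := abs_lt.1 ((ht.2 fun i => p (some i)).trans_lt hN)
    obtain ⟨x, hx, ex⟩ := D.exists_mid b1.1 b1.2
    obtain ⟨y, hy, ey⟩ := D.exists_mid b2.1 b2.2
    exact ⟨x, y, ⟨hx, ex⟩, ⟨hy, ey⟩, ⟨hx, hy⟩, h1, by rw [ex, ey, h2]⟩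
  · rintro ⟨x, y, ⟨-, ex⟩, ⟨-, ey⟩, -, h1, h2⟩
    exact ⟨h1, by rw [h2, ex, ey]⟩

theorem val_add {M N : ℝ} {s t : (α → ℝ) → ℝ} (hs : Val S g c d M s) (ht : Val S g c d N t)
    (hM : M < 9) (hN : N < 9) : Val S g c d (M + N) fun v => s v + t v :=
  D.val_binary (F := fun x y => x + y) D.def_add hs ht hM hN fun x y hx hy =>
    (abs_add_le x y).trans (add_le_add hx hy)

theorem val_mul {M N : ℝ} {s t : (α → ℝ) → ℝ} (hs : Val S g c d M s) (ht : Val S g c d N t)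
    (hM : M < 9) (hN : N < 9) : Val S g c d (M * N) fun v => s v * t v :=
  D.val_binary (F := fun x y => x * y) D.def_mul hs ht hM hN fun x y hx hy => by
    rw [abs_mul]
    exact mul_le_mul hx hy (abs_nonneg y) ((abs_nonneg x).trans hx)

theorem val_const (k : ℝ) (hk : |k| < 9) : Val S g c d |k| fun _ : α → ℝ => k := by
  obtain ⟨e, he, rfl⟩ := D.exists_mid (abs_lt.1 hk).1 (abs_lt.1 hk).2
  refine ⟨congr (D.def_eq.app (var none) (const e)) fun p => ?_, fun _ => le_rfl⟩
  simp [he]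

theorem val_sub {M N : ℝ} {s t : (α → ℝ) → ℝ} (hs : Val S g c d M s) (ht : Val S g c d N t)
    (hM : M < 9) (hN : N < 9) : Val S g c d (M + N) fun v => s v - t v := by
  have h1 := D.val_mul (D.val_const (α := α) (-1) (by norm_num)) ht (by norm_num) hN
  have h2 := D.val_add hs h1 hM (by norm_num; exact hN)
  norm_num at h2
  simpa only [sub_eq_add_neg] using h2

theorem val_abs {M : ℝ} {s : (α → ℝ) → ℝ} (hs : Val S g c d M s) (hM : M < 9) :
    Val S g c d M fun v => |s v| := by
  obtain ⟨e, he, e0⟩ := D.exists_mid (t := 0) (by norm_num) (by norm_num)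
  have hl := D.def_lt
  have h1 := D.val_mul (D.val_const (α := α) (-1) (by norm_num)) hs (by norm_num) hM
  have : S.Def fun p : Option α → ℝ =>
      ((Mid g c d (p none) ∧ g (p none) = s fun i => p (some i)) ∨
        (Mid g c d (p none) ∧ g (p none) = -1 * s fun i => p (some i))) ∧
      ¬ ((c ≤ p none ∧ p none ≤ d) ∧ (c ≤ e ∧ e ≤ d) ∧ g (p none) < g e) :=
    S.and (DefStr.or hs.1 h1.1) (S.not (hl.app (var none) (const e)))
  refine ⟨congr this fun p => ?_, fun v => by rw [abs_abs]; exact hs.2 v⟩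
  rw [← and_or_left, and_assoc]
  refine and_congr_right fun h2 => ?_
  have h3 := h2.1
  have h4 := he.1
  rw [e0]
  beta_reduce
  generalize s (fun i => p (some i)) = w
  constructor
  · intro h5
    rw [h5]
    refine ⟨?_, fun h => absurd h.2.2 (not_lt.2 (abs_nonneg _))⟩
    rcases abs_choice w with h | h <;> rw [h] <;> simp
  · rintro ⟨h5, h6⟩
    have h7 : 0 ≤ g (p none) := not_lt.1 fun h => h6 ⟨h3, h4, h⟩
    rcases h5 with h5 | h5
    · rw [h5] at h7 ⊢
      exact (abs_of_nonneg h7).symm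
    · rw [h5] at h7 ⊢
      rw [abs_of_nonpos (by linarith)]
      ring

theorem def_val_eq {M N : ℝ} {s t : (α → ℝ) → ℝ} (hs : Val S g c d M s) (ht : Val S g c d N t)
    (hM : M < 9) : S.Def fun v => s v = t v := by
  have := S.ex (P := fun v z => (Mid g c d z ∧ g z = s v) ∧ (Mid g c d z ∧ g z = t v))
    (S.and hs.1 ht.1)
  refine congr this fun v => ?_
  constructor
  · intro e
    have b1 := abs_lt.1 ((hs.2 v).trans_lt hM)
    obtain ⟨x, hx, ex⟩ := D.exists_mid b1.1 b1.2
    exact ⟨x, ⟨hx, ex⟩, hx, by rw [ex, e]⟩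
  · rintro ⟨z, h1, h2⟩
    rw [← h1.2, h2.2]

open Classical in
theorem val_var {X : ℝ → Prop} (hX : S.Def1 X) (hmid : ∀ x, X x → c ≤ x ∧ x ≤ d)
    (hlt : ∀ x, X x → |g x| < 1) (i : α) :
    Val S g c d 1 fun v : α → ℝ => if X (v i) then g (v i) else 0 := by
  have h0 := D.val_const (α := α) 0 (by norm_num)
  have := DefStr.or (S.and (hX.app (var (some i)))
    (D.def_eq.app (α := Option α) (var none) (var (some i))))
    (S.and (S.not (hX.app (var (some i)))) h0.1)
  refine ⟨congr this fun p => ?_, fun v => ?_⟩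
  -- Off `X` the term takes the default value `0`, so that it is total and obeys the same bound.
  · by_cases h : X (p (some i))
    · have hm : Mid g c d (p (some i)) := by
        have := abs_lt.1 (hlt _ h)
        exact ⟨hmid _ h, by linarith, by linarith⟩
      simp [h, hm]
    · simp [h]
  · beta_reduce
    split_ifs with h
    · exact (hlt _ h).le
    · simp

/-- On a definable set of points of slope less than `1` in absolute value, the expanded slopes
carry the field operations definably. -/
theorem def_field {X : ℝ → Prop} (hX : S.Def1 X) (hmid : ∀ x, X x → c ≤ x ∧ x ≤ d)
    (hlt : ∀ x, X x → |g x| < 1) :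
    S.Def2 (fun x y => X x ∧ X y ∧ expand (g x) < expand (g y)) ∧
    S.Def3 (fun x y z => X x ∧ X y ∧ X z ∧ expand (g x) + expand (g y) = expand (g z)) ∧
    S.Def3 (fun x y z => X x ∧ X y ∧ X z ∧ expand (g x) * expand (g y) = expand (g z)) := by
  classical
  refine ⟨?_, ?_, ?_⟩
  · have := S.and (S.and (hX.app (var 0)) (hX.app (var 1))) (D.def_lt.app (var (0 : Fin 2)) (var 1))
    refine congr this fun v => ?_
    rw [and_assoc]
    refine and_congr_right fun h1 => and_congr_right fun h2 => ?_
    rw [expand_lt_expand (hlt _ h1) (hlt _ h2)]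
    have := hmid _ h1
    have := hmid _ h2
    tauto
  all_goals
    have hu := D.val_var hX hmid hlt (0 : Fin 3)
    have hv := D.val_var hX hmid hlt (1 : Fin 3)
    have hw := D.val_var hX hmid hlt (2 : Fin 3)
    have h1 := D.val_const (α := Fin 3) 1 (by norm_num)
    have hu' := D.val_sub h1 (D.val_abs hu (by norm_num)) (by norm_num) (by norm_num)
    have hv' := D.val_sub h1 (D.val_abs hv (by norm_num)) (by norm_num) (by norm_num)
    have hw' := D.val_sub h1 (D.val_abs hw (by norm_num)) (by norm_num) (by norm_num)
    -- The left side is bounded by `4`, and the right sides below by `8` for the sum and `2` for the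
    -- product; every bound stays under `9`.
    have hl := D.val_mul (D.val_mul hw hu' (by norm_num) (by norm_num)) hv' (by norm_num)
      (by norm_num)
    have hX3 := S.and (hX.app (var (0 : Fin 3))) (S.and (hX.app (var 1)) (hX.app (var 2)))
  · have hr := D.val_mul hw' (D.val_add (D.val_mul hu hv' (by norm_num) (by norm_num))
      (D.val_mul hv hu' (by norm_num) (by norm_num)) (by norm_num) (by norm_num)) (by norm_num)
      (by norm_num)
    refine congr (S.and hX3 (D.def_val_eq hl hr (by norm_num))) fun v => ?_
    rw [and_assoc, and_assoc]
    refine and_congr_right fun k1 => and_congr_right fun k2 => and_congr_right fun k3 => ?_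
    rw [expand_add_iff (hlt _ k1) (hlt _ k2) (hlt _ k3), if_pos k1, if_pos k2, if_pos k3]
  · have hr := D.val_mul hw' (D.val_mul hu hv (by norm_num) (by norm_num)) (by norm_num)
      (by norm_num)
    refine congr (S.and hX3 (D.def_val_eq hl hr (by norm_num))) fun v => ?_
    rw [and_assoc, and_assoc]
    refine and_congr_right fun k1 => and_congr_right fun k2 => and_congr_right fun k3 => ?_
    rw [expand_mul_iff (hlt _ k1) (hlt _ k2) (hlt _ k3), if_pos k1, if_pos k2, if_pos k3]

end SlopeData

/-! ### From slope fields to field-type and to second-order arithmetic. -/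

theorem DefStr.pullback_ordField {S : DefStr} {X : ℝ → Prop} {hX : S.Def1 X} {τ σ : ℝ → ℝ}
    {hσ : ∀ y, X (σ y)} {hτσ : ∀ y, τ (σ y) = y} {hστ : ∀ x, X x → σ (τ x) = x}
    (hl : S.Def2 fun x y => X x ∧ X y ∧ τ x < τ y)
    (ha : S.Def3 fun x y z => X x ∧ X y ∧ X z ∧ τ x + τ y = τ z)
    (hm : S.Def3 fun x y z => X x ∧ X y ∧ X z ∧ τ x * τ y = τ z) :
    (S.pullback X hX τ σ hσ hτσ hστ).OrdField where
  lt_rel := by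
    refine pullback_def_iff.2 (DefStr.congr (S := S) hl fun v => ?_)
    simp [Fin.forall_fin_succ, and_assoc]
  add_fun := by
    refine pullback_def_iff.2 (DefStr.congr (S := S) ha fun v => ?_)
    simp only [Fin.forall_fin_succ]
    simp [and_assoc, eq_comm]
  mul_fun := by
    refine pullback_def_iff.2 (DefStr.congr (S := S) hm fun v => ?_)
    simp only [Fin.forall_fin_succ]
    simp [and_assoc, eq_comm]

/-- Only integer multiples are definable from addition. An integer `n` stretches the gap between the
two slopes beyond `20`, and subtracting `m x` moves one to at most `-9` and the other above `9`. -/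
theorem exists_slopeData {S : DefStr} (h : S.OrdGroup) {f g : ℝ → ℝ} (hf : S.Fun1 f) {c d : ℝ}
    (hderiv : ∀ x ∈ Icc c d, HasDerivAt f (g x) x) (hcont : ContinuousOn g (Icc c d)) {x y : ℝ}
    (hx : x ∈ Icc c d) (hy : y ∈ Icc c d) (hxy : g x < g y) :
    ∃ (n : ℕ) (m : ℤ) (e₁ e₂ : ℝ), 0 < n ∧
      SlopeData S (fun x => n * f x - m * x) (fun x => n * g x - m) c d e₁ e₂ := by
  obtain ⟨n, hn⟩ := exists_nat_gt (20 / (g y - g x))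
  have hpos : 0 < g y - g x := sub_pos.2 hxy
  have hn0 : (0 : ℝ) < n := lt_trans (by positivity) hn
  rw [div_lt_iff₀ hpos] at hn
  set m : ℤ := ⌈(n : ℝ) * g x⌉ + 9 with hm
  have hc : ContinuousOn (fun x => n * g x - m) (Icc c d) := by fun_prop
  have h1 := Int.le_ceil ((n : ℝ) * g x)
  have h2 := Int.ceil_lt_add_one ((n : ℝ) * g x)
  have hm' : (m : ℝ) = ⌈(n : ℝ) * g x⌉ + 9 := by rw [hm]; push_cast; ring
  have hsub : uIcc x y ⊆ Icc c d := uIcc_subset_Icc hx hy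
  have hiv := intermediate_value_uIcc (hc.mono hsub)
  rw [uIcc_of_le (by linarith)] at hiv
  obtain ⟨e₁, he₁, v₁⟩ := hiv (show (-9 : ℝ) ∈ _ from ⟨by linarith, by linarith⟩)
  obtain ⟨e₂, he₂, v₂⟩ := hiv (show (9 : ℝ) ∈ _ from ⟨by linarith, by linarith⟩)
  refine ⟨n, m, e₁, e₂, by exact_mod_cast hn0, h, ?_, fun x hx => ?_, hc, hsub he₁, hsub he₂,
    v₁, v₂⟩
  · exact eq (var 1) (h.sub (h.nsmul n (hf.app (var 0))) (h.zsmul m (var 0)))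
  · have := ((hderiv x hx).const_mul (n : ℝ)).sub ((hasDerivAt_id x).const_mul (m : ℝ))
    rwa [mul_one] at this

/-- When `g` is strictly increasing, the points with slope in `(-1, 1)` form an interval and `x ↦
expand (g x)` is an order isomorphism onto `ℝ`. -/
theorem SlopeData.isFieldType (L : FirstOrder.Language.{u, v}) [L.Structure ℝ] {f g : ℝ → ℝ}
    {c d e₁ e₂ : ℝ} (D : SlopeData (langStr L) f g c d e₁ e₂) (hmono : StrictMonoOn g (Icc c d)) :
    IsFieldType L := by
  obtain ⟨a, ha, hga⟩ := D.exists_mid (t := -1) (by norm_num) (by norm_num)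
  obtain ⟨b, hb, hgb⟩ := D.exists_mid (t := 1) (by norm_num) (by norm_num)
  have hab : a < b := (hmono.lt_iff_lt ha.1 hb.1).1 (by linarith)
  have hmid : ∀ x, x ∈ Ioo a b → c ≤ x ∧ x ≤ d := fun x hx =>
    ⟨ha.1.1.trans hx.1.le, hx.2.le.trans hb.1.2⟩
  have hlt : ∀ x, x ∈ Ioo a b → |g x| < 1 := fun x hx => by
    have h1 := hmono ha.1 (hmid x hx) hx.1
    have h2 := hmono (hmid x hx) hb.1 hx.2
    rw [abs_lt]
    constructor <;> linarith
  have hX : (langStr L).Def1 fun x => x ∈ Ioo a b := by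
    have h := D.grp
    exact (langStr L).and (h.lt (const a) (var 0)) (h.lt (var 0) (const b))
  obtain ⟨-, dadd, dmul⟩ := D.def_field hX hmid hlt
  have hτmono : StrictMono fun x : Ioo a b => expand (g x) := fun x y hxy =>
    (expand_lt_expand (hlt x x.2) (hlt y y.2)).2 (hmono (hmid x x.2) (hmid y y.2) hxy)
  have hτsurj : Function.Surjective fun x : Ioo a b => expand (g x) := by
    intro y
    have h1 := abs_lt.1 (abs_shrink_lt y)
    obtain ⟨z, hz, hgz⟩ := D.exists_mid (t := shrink y) (by linarith) (by linarith)
    refine ⟨⟨z, (hmono.lt_iff_lt ha.1 hz.1).1 (by linarith),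
      (hmono.lt_iff_lt hz.1 hb.1).1 (by linarith)⟩, ?_⟩
    simp only [hgz, expand_shrink]
  let τ : Ioo a b ≃o ℝ := hτmono.orderIsoOfSurjective _ hτsurj
  have hτ : ∀ x : Ioo a b, τ x = expand (g x) := fun x => rfl
  have key : ∀ F : ℝ → ℝ → ℝ, (langStr L).Def3 (fun x y z => x ∈ Ioo a b ∧ y ∈ Ioo a b ∧
      z ∈ Ioo a b ∧ F (expand (g x)) (expand (g y)) = expand (g z)) →
      IsDefIntervalOp L fun x y : Ioo a b => τ.symm (F (τ x) (τ y)) := by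
    intro F hF
    refine (congrArg (IsDef L) ?_).mpr hF
    ext p
    constructor
    · rintro ⟨x, y, h0, h1, h2⟩
      have h3 := τ.apply_symm_apply (F (τ x) (τ y))
      rw [hτ, ← h2, hτ, hτ, ← h0, ← h1] at h3
      refine ⟨h0 ▸ x.2, h1 ▸ y.2, h2 ▸ Subtype.coe_prop _, h3.symm⟩
    · rintro ⟨h0, h1, h2, h3⟩
      refine ⟨⟨p 0, h0⟩, ⟨p 1, h1⟩, rfl, rfl, ?_⟩
      have : τ ⟨p 2, h2⟩ = F (τ ⟨p 0, h0⟩) (τ ⟨p 1, h1⟩) := h3.symm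
      beta_reduce
      rw [← this, τ.symm_apply_apply]
  exact ⟨a, b, hab, _, _, key (· + ·) dadd, key (· * ·) dmul, τ, fun x y => τ.apply_symm_apply _,
    fun x y => τ.apply_symm_apply _⟩

/-- Slopes still carry a definable real field, but on a set of representatives. In that field `x ↦
expand (g x)` is continuous and nowhere strictly monotone, so its extremal values yield arithmetic,
which is carried back through the pullback. -/
theorem SlopeData.secondOrderArith {S : DefStr} {f g : ℝ → ℝ} {c d e₁ e₂ : ℝ}
    (D : SlopeData S f g c d e₁ e₂) (hno : ∀ x y, c ≤ x → x < y → y ≤ d →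
      ¬ StrictMonoOn g (Ioo x y) ∧ ¬ StrictAntiOn g (Ioo x y)) : S.SecondOrderArith := by
  have h := D.grp
  have hl := D.def_lt
  have heq := D.def_eq
  obtain ⟨a, ha, hga⟩ := D.exists_mid (t := -1) (by norm_num) (by norm_num)
  obtain ⟨b, hb, hgb⟩ := D.exists_mid (t := 1) (by norm_num) (by norm_num)
  -- The leftmost point of each slope, which exists by compactness of the fibres of `g`, is a
  -- definable choice of representative.
  let X : ℝ → Prop := fun x => (c ≤ x ∧ x ≤ d) ∧ |g x| < 1 ∧ ∀ w, c ≤ w → w < x → g w ≠ g x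
  have hmid : ∀ x, X x → c ≤ x ∧ x ≤ d := fun x hx => hx.1
  have hlt : ∀ x, X x → |g x| < 1 := fun x hx => hx.2.1
  have hX : S.Def1 X := by
    have : S.Def1 fun x => ((c ≤ a ∧ a ≤ d) ∧ (c ≤ x ∧ x ≤ d) ∧ g a < g x) ∧
        ((c ≤ x ∧ x ≤ d) ∧ (c ≤ b ∧ b ≤ d) ∧ g x < g b) ∧
        ∀ w, w < x → ¬ (Mid g c d w ∧ Mid g c d x ∧ g w = g x) := by
      unfold Def1
      repeat' with_reducible first
        | exact var _ | exact const _ | apply hl.app | apply heq.app | apply S.and | apply all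
        | apply S.not | apply imp | apply h.lt
    refine congr this fun v => ?_
    simp only [X, abs_lt, hga, hgb]
    constructor
    · rintro ⟨h1, h2, h3⟩
      exact ⟨⟨ha.1, h1, h2.1⟩, ⟨h1, hb.1, h2.2⟩, fun w hw hc => h3 w hc.1.1.1 hw hc.2.2⟩
    · rintro ⟨⟨-, h1, h2⟩, ⟨-, -, h3⟩, h4⟩
      refine ⟨h1, ⟨h2, h3⟩, fun w hw hw2 e => h4 w hw2 ⟨?_, ?_, e⟩⟩
      · exact ⟨⟨hw, hw2.le.trans h1.2⟩, by linarith, by linarith⟩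
      · exact ⟨h1, by linarith, by linarith⟩
  have hex : ∀ y, ∃ x, X x ∧ g x = shrink y := by
    intro y
    have h1 := abs_lt.1 (abs_shrink_lt y)
    obtain ⟨z, hz, hgz⟩ := D.exists_mid (t := shrink y) (by linarith) (by linarith)
    have hcpt : IsCompact (Icc c d ∩ g ⁻¹' {shrink y}) :=
      isCompact_Icc.of_isClosed_subset
        (D.cont.preimage_isClosed_of_isClosed isClosed_Icc isClosed_singleton) inter_subset_left
    obtain ⟨x, hx, hmin⟩ := hcpt.exists_isLeast ⟨z, hz.1, hgz⟩
    have hgx : g x = shrink y := hx.2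
    refine ⟨x, ⟨hx.1, hgx ▸ abs_shrink_lt y, fun w hw hwx e => ?_⟩, hgx⟩
    exact absurd (hmin ⟨⟨hw, hwx.le.trans hx.1.2⟩, e.trans hgx⟩) (not_le.2 hwx)
  choose σ hσX hσg using hex
  have hτσ : ∀ y, expand (g (σ y)) = y := fun y => by rw [hσg, expand_shrink]
  have hinj : ∀ x y, X x → X y → g x = g y → x = y := by
    intro x y hx hy e
    rcases lt_trichotomy x y with h1 | h1 | h1
    · exact absurd e (hy.2.2 x hx.1.1 h1)
    · exact h1
    · exact absurd e.symm (hx.2.2 y hy.1.1 h1)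
  have hστ : ∀ x, X x → σ (expand (g x)) = x := fun x hx =>
    hinj _ _ (hσX _) hx (by rw [hσg, shrink_expand (hlt x hx)])
  obtain ⟨dlt, dadd, dmul⟩ := D.def_field hX hmid hlt
  have hK := pullback_ordField (hX := hX) (hσ := hσX) (hτσ := hτσ) (hστ := hστ) dlt dadd dmul
  refine SecondOrderArith.of_pullback (hX := hX) (hσ := hσX) (hτσ := hτσ) (hστ := hστ) ?_
  obtain ⟨u, v, h1, h2, h3, ⟨z, z', hz1, hz2, hz3, hz4, hzz⟩, h5⟩ :=
    D.exists_between ha.1 hb.1 (by linarith)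
  have hsub : ∀ x ∈ uIcc z z', u < x ∧ x < v := fun x hx =>
    ⟨(lt_min hz1 hz3).trans_le hx.1, hx.2.trans_lt (max_lt hz2 hz4)⟩
  set p := min z z' with hp
  set q := max z z' with hq
  have hpq : uIcc z z' = Icc p q := rfl
  rw [hpq] at hsub
  have hin : ∀ x ∈ Icc p q, x ∈ Icc c d := fun x hx =>
    ⟨h1.trans (hsub x hx).1.le, (hsub x hx).2.le.trans h3⟩
  have habs : ∀ x ∈ Icc p q, |g x| < 1 := fun x hx => by
    have := h5 x (hsub x hx).1 (hsub x hx).2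
    rw [abs_lt]
    constructor <;> linarith
  have hHc : ContinuousOn (fun x => expand (g x)) (Icc p q) := by
    unfold expand
    refine ContinuousOn.div (D.cont.mono hin) ?_ fun x hx => ?_
    · exact continuousOn_const.sub (D.cont.mono hin).abs
    · linarith [habs x hx]
  have hzm : z ∈ Icc p q := left_mem_uIcc
  have hzm' : z' ∈ Icc p q := right_mem_uIcc
  have hHz := (expand_lt_expand (habs z hzm) (habs z' hzm')).2 hzz
  have hiv := intermediate_value_uIcc (f := fun x => expand (g x)) (a := z) (b := z') hHc
  rw [uIcc_of_le hHz.le] at hiv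
  refine secondOrderArith_of_extrValue hK hHc hHz hiv ?_ ?_
  · intro x y hx hxy hy
    have hm : ∀ w ∈ Ioo x y, w ∈ Icc p q := fun w hw =>
      ⟨hx.trans hw.1.le, hw.2.le.trans hy⟩
    obtain ⟨n1, n2⟩ := hno x y (hin x ⟨hx, hxy.le.trans hy⟩).1 hxy (hin y ⟨hx.trans hxy.le, hy⟩).2
    refine ⟨fun hs => n1 fun w hw w' hw' hww => ?_, fun hs => n2 fun w hw w' hw' hww => ?_⟩
    · exact (expand_lt_expand (habs w (hm w hw)) (habs w' (hm w' hw'))).1 (hs hw hw' hww)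
    · exact (expand_lt_expand (habs w' (hm w' hw')) (habs w (hm w hw))).1 (hs hw hw' hww)
  -- Positions and radii belong to the original line, while values belong to the field of slopes.
  -- `E` states the extremality in the original structure, comparing slopes through `def_lt` and
  -- `def_eq`.
  · let E : ℝ → ℝ → Prop := fun y r => ∃ x, p ≤ x - r ∧ x + r ≤ q ∧
      (Mid g c d x ∧ Mid g c d y ∧ g x = g y) ∧
      ((∀ w, x - r < w → w < x + r → ¬ ((c ≤ x ∧ x ≤ d) ∧ (c ≤ w ∧ w ≤ d) ∧ g x < g w)) ∨
        ∀ w, x - r < w → w < x + r → ¬ ((c ≤ w ∧ w ≤ d) ∧ (c ≤ x ∧ x ≤ d) ∧ g w < g x))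
    have dE : S.Def2 E := by
      unfold Def2
      repeat' with_reducible first
        | exact var _ | exact const _ | apply hl.app | apply heq.app | apply S.and | apply S.ex
        | apply all | apply S.not | apply imp | apply DefStr.or | apply h.lt | apply h.le
        | apply h.sub | apply h.add
    have hE : ∀ y r, X y → 0 < r →
        (ExtrValue (fun x => expand (g x)) p q (expand (g y)) r ↔ E y r) := by
      intro y r hy hr
      have hmidI : ∀ x ∈ Icc p q, Mid g c d x := fun x hx => by
        have := abs_lt.1 (habs x hx)
        exact ⟨hin x hx, by linarith, by linarith⟩
      have hym : Mid g c d y := by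
        have := abs_lt.1 (hlt y hy)
        exact ⟨hy.1, by linarith, by linarith⟩
      have hle : ∀ x x', x ∈ Icc p q → x' ∈ Icc p q → (expand (g x) ≤ expand (g x') ↔
          ¬ ((c ≤ x' ∧ x' ≤ d) ∧ (c ≤ x ∧ x ≤ d) ∧ g x' < g x)) := by
        intro x x' hx hx'
        have k1 := hin x hx
        have k2 := hin x' hx'
        rw [← not_lt, expand_lt_expand (habs x' hx') (habs x hx)]
        exact not_congr ⟨fun k => ⟨k2, k1, k⟩, fun k => k.2.2⟩
      refine exists_congr fun x => and_congr_right fun k1 => and_congr_right fun k2 => ?_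
      have hx : x ∈ Icc p q := ⟨by linarith, by linarith⟩
      refine and_congr ⟨fun e => ⟨hmidI x hx, hym, ?_⟩, fun e => congrArg expand e.2.2⟩
        (or_congr (forall_congr' fun w => ?_) (forall_congr' fun w => ?_))
      · change expand (g x) = _ at e
        rw [← shrink_expand (habs x hx), e, shrink_expand (hlt y hy)]
      all_goals
        refine imp_congr_right fun k3 => imp_congr_right fun k4 => ?_
        have hw : w ∈ Icc p q := ⟨by linarith, by linarith⟩
      · exact hle w x hw hx
      · exact hle x w hx hw
    have : S.Def2 fun y y' => (X y ∧ X y') ∧ ∃ s r, 0 ≤ s ∧ s < r ∧ E y' r ∧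
        ∀ s', s < s' → ¬ E y s' := by
      unfold Def2
      repeat' with_reducible first
        | exact var _ | exact const _ | apply hX.app | apply dE.app | apply S.and | apply S.ex
        | apply all | apply S.not | apply imp | apply h.lt | apply h.le
    refine pullback_def_iff.2 (DefStr.congr (S := S) this fun w => ?_)
    simp only [Fin.forall_fin_two]
    refine and_congr_right fun k => exists_congr fun s => exists_congr fun r =>
      and_congr_right fun k1 => and_congr_right fun k2 => and_congr
        (hE _ _ k.2 (k1.trans_lt k2)) (forall_congr' fun s' => imp_congr_right fun k3 =>
          not_congr (hE _ _ k.1 (k1.trans_lt k3)))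

/-! ### Part (a) for functions definable in a language. -/

section

variable (L : FirstOrder.Language.{u, v}) [L.Structure ℝ]

open Classical in
theorem IsDefFunOn.fun1 {f : ℝ → ℝ} {a b : ℝ} (h : (langStr L).OrdGroup)
    (hf : IsDefFunOn L f a b) : (langStr L).Fun1 fun x => if x ∈ Ioo a b then f x else 0 := by
  have hf' : (langStr L).Def2 fun x y => x ∈ Ioo a b ∧ y = f x := hf
  have : (langStr L).Def2 fun x y => (x ∈ Ioo a b ∧ y = f x) ∨ (¬ (a < x ∧ x < b)) ∧ y = 0 := by
    unfold Def2
    repeat' with_reducible first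
      | exact var _ | exact const _ | apply hf'.app | apply DefStr.or | apply (langStr L).and
      | apply (langStr L).not | apply h.lt | apply eq
  refine DefStr.congr this fun v => ?_
  by_cases hv : v 0 ∈ Ioo a b
  · have : a < v 0 ∧ v 0 < b := hv
    simp [this]
  · have : ¬ (a < v 0 ∧ v 0 < b) := hv
    simp [this]

open Classical in
/-- A definable `C¹` function on an interval has a globally definable extension with the same
derivative on that interval. -/
theorem exists_fun1_hasDerivAt {f : ℝ → ℝ} {a b : ℝ} (h : (langStr L).OrdGroup)
    (hf : IsDefFunOn L f a b) (hC : ContDiffOn ℝ 1 f (Ioo a b)) :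
    ∃ F : ℝ → ℝ, (langStr L).Fun1 F ∧ (∀ x ∈ Ioo a b, HasDerivAt F (deriv f x) x) ∧
      ContinuousOn (deriv f) (Ioo a b) := by
  refine ⟨_, hf.fun1 L h, fun x hx => ?_, hC.continuousOn_deriv_of_isOpen isOpen_Ioo le_rfl⟩
  have hd := ((hC.differentiableOn one_ne_zero).differentiableAt
    (isOpen_Ioo.mem_nhds hx)).hasDerivAt
  refine hd.congr_of_eventuallyEq ?_
  filter_upwards [isOpen_Ioo.mem_nhds hx] with y hy
  simp [hy]

theorem isFieldType_of_strictMonoOn_deriv (h : (langStr L).OrdGroup) {F g : ℝ → ℝ}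
    (hF : (langStr L).Fun1 F) {c d : ℝ} (hcd : c < d)
    (hderiv : ∀ x ∈ Ioo c d, HasDerivAt F (g x) x) (hcont : ContinuousOn g (Ioo c d))
    (hmono : StrictMonoOn g (Ioo c d)) : IsFieldType L := by
  obtain ⟨c', h1, h2⟩ := exists_between hcd
  obtain ⟨d', h3, h4⟩ := exists_between h2
  have hsub : Icc c' d' ⊆ Ioo c d := fun x hx => ⟨h1.trans_le hx.1, hx.2.trans_lt h4⟩
  obtain ⟨n, m, e₁, e₂, hn, D⟩ := exists_slopeData h hF (fun x hx => hderiv x (hsub hx))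
    (hcont.mono hsub) (left_mem_Icc.2 h3.le) (right_mem_Icc.2 h3.le)
    (hmono (hsub (left_mem_Icc.2 h3.le)) (hsub (right_mem_Icc.2 h3.le)) h3)
  refine D.isFieldType L fun x hx y hy hxy => ?_
  have hn' : (0 : ℝ) < n := by exact_mod_cast hn
  have := mul_lt_mul_of_pos_left (hmono (hsub hx) (hsub hy) hxy) hn'
  simpa using this

theorem isFieldType_of_derivStrictMonoSomewhere (h : (langStr L).OrdGroup) {f : ℝ → ℝ} {a b : ℝ}
    (hf : IsDefFunOn L f a b) (hC : ContDiffOn ℝ 1 f (Ioo a b))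
    (hm : DerivStrictMonoSomewhere f a b) : IsFieldType L := by
  obtain ⟨F, hF, hd, hc⟩ := exists_fun1_hasDerivAt L h hf hC
  obtain ⟨c, d, hcd, hsub, hm | hm⟩ := hm
  · exact isFieldType_of_strictMonoOn_deriv L h hF hcd (fun x hx => hd x (hsub hx))
      (hc.mono hsub) hm
  · refine isFieldType_of_strictMonoOn_deriv L h (F := fun x => - F x)
      (g := fun x => - deriv f x) ?_ hcd (fun x hx => (hd x (hsub hx)).neg) (hc.mono hsub).neg
      hm.neg
    exact eq (var 1) (h.neg (hF.app (var 0)))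

theorem exists_deriv_lt_of_not_isAffineOn {f : ℝ → ℝ} {a b : ℝ} (hab : a < b)
    (hC : ContDiffOn ℝ 1 f (Ioo a b)) (hna : ¬ IsAffineOn f a b) :
    ∃ x ∈ Ioo a b, ∃ y ∈ Ioo a b, deriv f x < deriv f y := by
  by_contra! hcon
  apply hna
  obtain ⟨z, hz⟩ := nonempty_Ioo.2 hab
  have hd : ∀ x ∈ Ioo a b, deriv f x = deriv f z := fun x hx =>
    le_antisymm (hcon z hz x hx) (hcon x hx z hz)
  have hdf : DifferentiableOn ℝ f (Ioo a b) := hC.differentiableOn one_ne_zero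
  refine ⟨deriv f z, f z - deriv f z * z, fun x hx => ?_⟩
  have key := isOpen_Ioo.eqOn_of_deriv_eq (f := f)
    (g := fun x => deriv f z * x + (f z - deriv f z * z)) isPreconnected_Ioo hdf (by fun_prop)
    (fun x hx => by
      have : HasDerivAt (fun x => deriv f z * x + (f z - deriv f z * z)) (deriv f z * 1) x :=
        ((hasDerivAt_id x).const_mul _).add_const _
      rw [this.deriv, hd x hx, mul_one]) hz (by ring)
  exact key hx

theorem definesSecondOrderArithmetic_of_not_derivStrictMonoSomewhere (h : (langStr L).OrdGroup)
    {f : ℝ → ℝ} {a b : ℝ} (hab : a < b) (hf : IsDefFunOn L f a b)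
    (hC : ContDiffOn ℝ 1 f (Ioo a b)) (hna : ¬ IsAffineOn f a b)
    (hm : ¬ DerivStrictMonoSomewhere f a b) : DefinesSecondOrderArithmetic L := by
  obtain ⟨F, hF, hd, hc⟩ := exists_fun1_hasDerivAt L h hf hC
  obtain ⟨x, hx, y, hy, hxy⟩ := exists_deriv_lt_of_not_isAffineOn hab hC hna
  have hsub : uIcc x y ⊆ Ioo a b := ordConnected_Ioo.uIcc_subset hx hy
  obtain ⟨n, m, e₁, e₂, hn, D⟩ := exists_slopeData (c := min x y) (d := max x y) h hF
    (fun x hx => hd x (hsub hx)) (hc.mono hsub) left_mem_uIcc right_mem_uIcc hxy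
  have hn' : (0 : ℝ) < n := by exact_mod_cast hn
  refine definesSecondOrderArithmetic_of_langStr L (D.secondOrderArith fun u v hu huv hv => ?_)
  have hs : Ioo u v ⊆ Ioo a b := fun w hw => hsub ⟨hu.trans hw.1.le, hw.2.le.trans hv⟩
  refine ⟨fun hs1 => hm ⟨u, v, huv, hs, Or.inl fun w hw w' hw' hww => ?_⟩,
    fun hs1 => hm ⟨u, v, huv, hs, Or.inr fun w hw w' hw' hww => ?_⟩⟩
  all_goals
    have := hs1 hw hw' hww
    simp only [sub_lt_sub_iff_right] at this
    exact lt_of_mul_lt_mul_left this hn'.le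

/-- Since `f'` is not constant, `f''` is nonzero somewhere and, being continuous, keeps its sign
nearby. -/
theorem derivStrictMonoSomewhere_of_contDiffOn_two {f : ℝ → ℝ} {a b : ℝ} (hab : a < b)
    (hC : ContDiffOn ℝ 2 f (Ioo a b)) (hna : ¬ IsAffineOn f a b) :
    DerivStrictMonoSomewhere f a b := by
  obtain ⟨x, hx, y, hy, hxy⟩ :=
    exists_deriv_lt_of_not_isAffineOn hab (hC.of_le one_le_two) hna
  have hC1 : ContDiffOn ℝ 1 (deriv f) (Ioo a b) :=
    hC.deriv_of_isOpen isOpen_Ioo (by norm_num [one_add_one_eq_two])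
  have hd : DifferentiableOn ℝ (deriv f) (Ioo a b) := hC1.differentiableOn one_ne_zero
  have hcont := hC1.continuousOn_deriv_of_isOpen isOpen_Ioo le_rfl
  have hne : ∃ z ∈ Ioo a b, deriv (deriv f) z ≠ 0 := by
    by_contra! hcon
    exact hxy.ne (isOpen_Ioo.is_const_of_deriv_eq_zero isPreconnected_Ioo hd hcon hx hy)
  obtain ⟨z, hz, hne⟩ := hne
  have hca := hcont.continuousAt (isOpen_Ioo.mem_nhds hz)
  have key : ∀ U : Set ℝ, U ∈ 𝓝 (deriv (deriv f) z) → ∃ c d, c < d ∧ Ioo c d ⊆ Ioo a b ∧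
      ∀ x ∈ Ioo c d, deriv (deriv f) x ∈ U := fun U hU => by
    obtain ⟨c, d, hcd, hs⟩ := mem_nhds_iff_exists_Ioo_subset.1
      (inter_mem (isOpen_Ioo.mem_nhds hz) (hca hU))
    exact ⟨c, d, hcd.1.trans hcd.2, fun w hw => (hs hw).1, fun w hw => (hs hw).2⟩
  rcases lt_or_gt_of_ne hne with hneg | hpos
  · obtain ⟨c, d, hcd, hs, hU⟩ := key _ (Iio_mem_nhds hneg)
    refine ⟨c, d, hcd, hs, Or.inr (strictAntiOn_of_deriv_neg (convex_Ioo c d)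
      (hd.continuousOn.mono hs) fun w hw => hU w ?_)⟩
    rwa [interior_Ioo] at hw
  · obtain ⟨c, d, hcd, hs, hU⟩ := key _ (Ioi_mem_nhds hpos)
    refine ⟨c, d, hcd, hs, Or.inl (strictMonoOn_of_deriv_pos (convex_Ioo c d)
      (hd.continuousOn.mono hs) fun w hw => hU w ?_)⟩
    rwa [interior_Ioo] at hw

end

/-! ### Field charts and a definable Baire theorem. -/

/-- A definable copy of the real field on the interval `(a, b)`, with coordinate `τ`
(extended by zero) and inverse coordinate `σ`. -/
structure FieldChart (S : DefStr) (a b : ℝ) (τ σ : ℝ → ℝ) : Prop where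
  grp : S.OrdGroup
  mem : ∀ y, σ y ∈ Ioo a b
  left : ∀ y, τ (σ y) = y
  right : ∀ x ∈ Ioo a b, σ (τ x) = x
  out : ∀ x ∉ Ioo a b, τ x = 0
  mono : StrictMonoOn τ (Ioo a b)
  cont : ContinuousOn τ (Ioo a b)
  cont_inv : Continuous σ
  def_add : S.Def3 fun x y z => x ∈ Ioo a b ∧ y ∈ Ioo a b ∧ z ∈ Ioo a b ∧ τ x + τ y = τ z
  def_mul : S.Def3 fun x y z => x ∈ Ioo a b ∧ y ∈ Ioo a b ∧ z ∈ Ioo a b ∧ τ x * τ y = τ z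

open Classical in
theorem IsFieldType.exists_fieldChart {L : FirstOrder.Language.{u, v}} [L.Structure ℝ]
    (h : (langStr L).OrdGroup) (hL : IsFieldType L) :
    ∃ (a b : ℝ) (τ σ : ℝ → ℝ), a < b ∧ FieldChart (langStr L) a b τ σ := by
  obtain ⟨a, b, hab, oplus, otimes, hadd, hmul, τ, h1, h2⟩ := hL
  have hin : ∀ x (hx : x ∈ Ioo a b), (if h : x ∈ Ioo a b then τ ⟨x, h⟩ else 0) = τ ⟨x, hx⟩ :=
    fun x hx => dif_pos hx
  refine ⟨a, b, fun x => if h : x ∈ Ioo a b then τ ⟨x, h⟩ else 0, fun y => τ.symm y, hab, h,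
    fun y => (τ.symm y).2, fun y => ?_, fun x hx => ?_, fun x hx => dif_neg hx,
    fun x hx y hy hxy => ?_, ?_, ?_, ?_, ?_⟩
  · rw [hin _ (τ.symm y).2, Subtype.coe_eta, τ.apply_symm_apply]
  · rw [hin _ hx, τ.symm_apply_apply]
  · rw [hin _ hx, hin _ hy]
    exact τ.strictMono hxy
  · rw [continuousOn_iff_continuous_domRestrict]
    refine τ.continuous.congr fun x => ?_
    rw [domRestrict_apply, hin _ x.2]
  · exact continuous_subtype_val.comp τ.symm.continuous
  · refine DefStr.congr (S := langStr L) hadd fun v => ?_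
    constructor
    · rintro ⟨x1, x2, x3, e⟩
      rw [hin _ x1, hin _ x2, hin _ x3, ← h1] at e
      exact ⟨⟨_, x1⟩, ⟨_, x2⟩, rfl, rfl, congrArg Subtype.val (τ.injective e).symm⟩
    · rintro ⟨x, y, e1, e2, e3⟩
      rw [e1, e2, e3]
      refine ⟨x.2, y.2, Subtype.coe_prop _, ?_⟩
      rw [hin _ x.2, hin _ y.2, hin _ (Subtype.coe_prop _), Subtype.coe_eta, Subtype.coe_eta,
        Subtype.coe_eta, h1]
  · refine DefStr.congr (S := langStr L) hmul fun v => ?_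
    constructor
    · rintro ⟨x1, x2, x3, e⟩
      rw [hin _ x1, hin _ x2, hin _ x3, ← h2] at e
      exact ⟨⟨_, x1⟩, ⟨_, x2⟩, rfl, rfl, congrArg Subtype.val (τ.injective e).symm⟩
    · rintro ⟨x, y, e1, e2, e3⟩
      rw [e1, e2, e3]
      refine ⟨x.2, y.2, Subtype.coe_prop _, ?_⟩
      rw [hin _ x.2, hin _ y.2, hin _ (Subtype.coe_prop _), Subtype.coe_eta, Subtype.coe_eta,
        Subtype.coe_eta, h2]

namespace FieldChart

variable {S : DefStr} {a b : ℝ} {τ σ : ℝ → ℝ} {α : Type} [Finite α] {s t : (α → ℝ) → ℝ}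

theorem def_mem (D : FieldChart S a b τ σ) : S.Def1 fun x => x ∈ Ioo a b :=
  have h := D.grp
  S.and (h.lt (const a) (var 0)) (h.lt (var 0) (const b))

theorem strictMono_inv (D : FieldChart S a b τ σ) : StrictMono σ := fun x y hxy => by
  rwa [← D.mono.lt_iff_lt (D.mem x) (D.mem y), D.left, D.left]

theorem eq_inv_iff (D : FieldChart S a b τ σ) {x y : ℝ} : x = σ y ↔ x ∈ Ioo a b ∧ τ x = y :=
  ⟨fun e => by rw [e]; exact ⟨D.mem y, D.left y⟩, fun e => by rw [← e.2, D.right _ e.1]⟩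

theorem le (D : FieldChart S a b τ σ) (hs : S.DFun fun v => σ (s v))
    (ht : S.DFun fun v => σ (t v)) : S.Def fun v => s v ≤ t v :=
  DefStr.congr (D.grp.le hs ht) fun _ => D.strictMono_inv.le_iff_le.symm

theorem coord (D : FieldChart S a b τ σ) (hs : S.DFun s) : S.DFun fun v => σ (τ (s v)) := by
  have : S.Fun1 fun x => σ (τ x) := by
    have h := D.def_mem
    have : S.Def2 fun x y => (x ∈ Ioo a b ∧ y = x) ∨ (¬ x ∈ Ioo a b ∧ y = σ 0) := by
      unfold Def2
      repeat' with_reducible first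
        | exact var _ | exact const _ | apply h.app | apply DefStr.or | apply S.and
        | apply S.not | apply eq
    refine DefStr.congr this fun v => ?_
    by_cases hv : v 0 ∈ Ioo a b
    · simp only [hv, D.right _ hv, true_and, not_true_eq_false, false_and, or_false]
    · simp only [hv, D.out _ hv, true_and, not_false_eq_true, false_and, false_or]
  exact this.app hs

theorem add (D : FieldChart S a b τ σ) (hs : S.DFun fun v => σ (s v))
    (ht : S.DFun fun v => σ (t v)) : S.DFun fun v => σ (s v + t v) := by
  refine DefStr.congr (D.def_add.app hs.weaken ht.weaken (var none)) fun v => ?_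
  rw [D.eq_inv_iff, D.left, D.left]
  exact ⟨fun e => ⟨D.mem _, D.mem _, e.1, e.2.symm⟩, fun e => ⟨e.2.2.1, e.2.2.2.symm⟩⟩

theorem mul (D : FieldChart S a b τ σ) (hs : S.DFun fun v => σ (s v))
    (ht : S.DFun fun v => σ (t v)) : S.DFun fun v => σ (s v * t v) := by
  refine DefStr.congr (D.def_mul.app hs.weaken ht.weaken (var none)) fun v => ?_
  rw [D.eq_inv_iff, D.left, D.left]
  exact ⟨fun e => ⟨D.mem _, D.mem _, e.1, e.2.symm⟩, fun e => ⟨e.2.2.1, e.2.2.2.symm⟩⟩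

theorem sub (D : FieldChart S a b τ σ) (hs : S.DFun fun v => σ (s v))
    (ht : S.DFun fun v => σ (t v)) : S.DFun fun v => σ (s v - t v) := by
  refine DefStr.congr (D.def_add.app (var none) ht.weaken hs.weaken) fun v => ?_
  rw [D.eq_inv_iff, D.left, D.left]
  exact ⟨fun e => ⟨e.1, D.mem _, D.mem _, by linarith [e.2]⟩,
    fun e => ⟨e.1, by linarith [e.2.2.2]⟩⟩

theorem div (D : FieldChart S a b τ σ) (hs : S.DFun fun v => σ (s v))
    (ht : S.DFun fun v => σ (t v)) : S.DFun fun v => σ (s v / t v) := by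
  have h0 : S.DFun (fun _ : Option α → ℝ => σ 0) := const _
  refine DefStr.congr (DefStr.or (S.and (eq ht.weaken h0) (eq (var none) h0))
    (S.and (S.not (eq ht.weaken h0))
      (D.def_mul.app (var none) ht.weaken hs.weaken))) fun v => ?_
  rw [D.strictMono_inv.injective.eq_iff, D.left, D.left]
  by_cases h : t (fun i => v (some i)) = 0
  · simp [h]
  · simp only [h, not_false_eq_true, true_and, false_and, false_or, D.mem, D.eq_inv_iff,
      eq_div_iff h]

/-- If a structure does not interpret second-order arithmetic, then a decreasing definable family
of closed sets with dense union has a member with interior. -/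
theorem exists_forall_mem_Ioo (D : FieldChart S a b τ σ) (hno : ¬ S.SecondOrderArith)
    {A : ℝ → ℝ → Prop} (hA : S.Def2 A) {p q : ℝ} (hp : a < p) (hpq : p < q) (hq : q < b)
    (hclosed : ∀ e, 0 < e → IsClosed {x | x ∈ Icc p q ∧ A e x})
    (hanti : ∀ e e' x, 0 < e' → e' ≤ e → x ∈ Icc p q → A e x → A e' x)
    (hdense : ∀ x y, p ≤ x → x < y → y ≤ q → ∃ z, x < z ∧ z < y ∧ ∃ e, 0 < e ∧ A e z) :
    ∃ e, 0 < e ∧ ∃ x y, p ≤ x ∧ x < y ∧ y ≤ q ∧ ∀ z ∈ Ioo x y, A e z := by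
  have h := D.grp
  -- `β x` is the largest parameter, capped at `1` for boundedness, whose set contains `x`. If no
  -- member of the family had interior, its superlevel sets would satisfy
  -- `secondOrderArith_of_superlevel` in the chart.
  set B : ℝ → Set ℝ := fun x => {e | 0 < e ∧ e ≤ 1 ∧ x ∈ Icc p q ∧ A e x} with hB
  set β : ℝ → ℝ := fun x => sSup (B x) with hβ
  have hbdd : ∀ x, BddAbove (B x) := fun x => ⟨1, fun e he => he.2.1⟩
  have β0 : ∀ x, 0 ≤ β x := fun x => Real.sSup_nonneg fun e he => he.1.le
  have hlt : ∀ x e, 0 ≤ e → e < β x → ∃ e' ∈ B x, e < e' := fun x e he hx => by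
    have hne : (B x).Nonempty := by
      rw [Set.nonempty_iff_ne_empty]
      intro h0
      rw [hβ] at hx
      simp only [h0, Real.sSup_empty] at hx
      linarith
    exact exists_lt_of_lt_csSup hne hx
  have hmem : ∀ x e, 0 < e → e < β x → e ∈ B x := fun x e he hx => by
    obtain ⟨e', h1, h2⟩ := hlt x e he.le hx
    exact ⟨he, h2.le.trans h1.2.1, h1.2.2.1, hanti _ _ _ he h2.le h1.2.2.1 h1.2.2.2⟩
  have hin : ∀ x ∈ Icc p q, x ∈ Ioo a b := fun x hx => ⟨hp.trans_le hx.1, hx.2.trans_lt hq⟩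
  have hpI := hin p (left_mem_Icc.2 hpq.le)
  have hqI := hin q (right_mem_Icc.2 hpq.le)
  have hX := D.def_mem
  have hK : (S.pullback (fun x => x ∈ Ioo a b) hX τ σ D.mem D.left D.right).OrdField := by
    refine pullback_ordField ?_ D.def_add D.def_mul
    have : S.Def2 fun x y => x ∈ Ioo a b ∧ y ∈ Ioo a b ∧ x < y := by
      unfold Def2
      repeat' with_reducible first | exact var _ | apply hX.app | apply S.and | apply h.lt
    exact DefStr.congr this fun v =>
      and_congr_right fun h1 => and_congr_right fun h2 => D.mono.lt_iff_lt h1 h2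
  have hσI : ∀ x y, τ p ≤ x → x < y → y ≤ τ q → p ≤ σ x ∧ σ x < σ y ∧ σ y ≤ q := by
    intro x y h1 h2 h3
    refine ⟨?_, D.strictMono_inv h2, ?_⟩
    · rwa [← D.mono.le_iff_le hpI (D.mem x), D.left]
    · rwa [← D.mono.le_iff_le (D.mem y) hqI, D.left]
  by_contra! hcon
  refine hno (SecondOrderArith.of_pullback (hσ := D.mem) (hτσ := D.left) (hστ := D.right)
    (secondOrderArith_of_superlevel hK (b := fun y => β (σ y)) (p := τ p) (q := τ q)
      (D.mono hpI hqI hpq) ?_ ?_ ?_ ?_))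
  -- Parameters stay in the original line; only the comparison of `β` at two points must be
  -- definable, and two separating parameters witness it.
  · have : S.Def2 fun x y => x ∈ Ioo a b ∧ y ∈ Ioo a b ∧ ∃ e e', 0 < e ∧ e < e' ∧ (0 < e' ∧
        e' ≤ 1 ∧ (p ≤ y ∧ y ≤ q) ∧ A e' y) ∧ ¬ (0 < e ∧ e ≤ 1 ∧ (p ≤ x ∧ x ≤ q) ∧ A e x) := by
      unfold Def2
      repeat' with_reducible first
        | exact var _ | exact const _ | apply hX.app | apply hA.app | apply S.and | apply S.not
        | apply S.ex | apply h.lt | apply h.le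
    refine pullback_def_iff.2 (DefStr.congr (S := S) this fun v => ?_)
    rw [Fin.forall_fin_two, and_assoc]
    refine and_congr_right fun h1 => and_congr_right fun h2 => ?_
    beta_reduce
    rw [D.right _ h1, D.right _ h2]
    constructor
    · intro hb
      obtain ⟨e, h3, h4⟩ := exists_between hb
      obtain ⟨e', h5, h6⟩ := exists_between h4
      have he : 0 < e := (β0 _).trans_lt h3
      obtain ⟨k1, k2, k3, k4⟩ := hmem _ e' (he.trans h5) h6
      exact ⟨e, e', he, h5, ⟨k1, k2, k3, k4⟩,
        fun hc => absurd (le_csSup (hbdd _) hc) (not_le.2 h3)⟩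
    · rintro ⟨e, e', h3, h4, ⟨k1, k2, k3, k4⟩, k5⟩
      have h5 : e' ≤ β (v 1) := le_csSup (hbdd _) ⟨k1, k2, k3, k4⟩
      have h6 : β (v 0) ≤ e := by
        by_contra! hc
        obtain ⟨j1, j2, j3, j4⟩ := hmem _ e h3 hc
        exact k5 ⟨j1, j2, j3, j4⟩
      linarith
  · intro e he
    -- The supremum need not be attained, so a superlevel set is the intersection of the members
    -- with smaller positive parameter.
    have : {x | x ∈ Icc (τ p) (τ q) ∧ e ≤ β (σ x)} =
        Icc (τ p) (τ q) ∩ σ ⁻¹' (⋂ e' ∈ Ioo 0 e, {x | x ∈ Icc p q ∧ (e' ≤ 1 ∧ A e' x)}) := by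
      ext x
      simp only [mem_ofPred_eq, mem_inter_iff, mem_preimage, mem_iInter]
      refine and_congr_right fun _ => ⟨fun h1 e' he' => ?_, fun h1 => ?_⟩
      · obtain ⟨-, k2, k3, k4⟩ := hmem (σ x) e' he'.1 (he'.2.trans_le h1)
        exact ⟨k3, k2, k4⟩
      · refine le_of_forall_lt_imp_le_of_dense fun e' he' => ?_
        rcases le_or_gt e' 0 with h0 | h0
        · exact h0.trans (β0 _)
        · obtain ⟨k1, k2, k3⟩ := h1 e' ⟨h0, he'⟩
          exact le_csSup (hbdd _) ⟨h0, k2, k1, k3⟩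
    rw [this]
    refine isClosed_Icc.inter (IsClosed.preimage D.cont_inv ?_)
    refine isClosed_biInter fun e' he' => ?_
    by_cases h1 : e' ≤ 1
    · simpa [h1] using hclosed e' he'.1
    · simp [h1]
  · intro e x y he h1 h2 h3
    obtain ⟨k1, k2, k3⟩ := hσI x y h1 h2 h3
    obtain ⟨z, hz, hAz⟩ := hcon (e / 2) (by linarith) _ _ k1 k2 k3
    have hzI : z ∈ Ioo a b := hin z ⟨k1.trans hz.1.le, hz.2.le.trans k3⟩
    refine ⟨τ z, ?_, ?_, ?_⟩
    · rw [← D.strictMono_inv.lt_iff_lt, D.right z hzI]; exact hz.1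
    · rw [← D.strictMono_inv.lt_iff_lt, D.right z hzI]; exact hz.2
    · rw [D.right z hzI]
      by_contra! hc
      exact hAz (hmem z (e / 2) (by linarith) (by linarith)).2.2.2
  · intro x y h1 h2 h3
    obtain ⟨k1, k2, k3⟩ := hσI x y h1 h2 h3
    obtain ⟨z, hz1, hz2, e, he, hAe⟩ := hdense _ _ k1 k2 k3
    have hz : z ∈ Icc p q := ⟨k1.trans hz1.le, hz2.le.trans k3⟩
    refine ⟨τ z, ?_, ?_, ?_⟩
    · rwa [← D.strictMono_inv.lt_iff_lt, D.right z (hin z hz)]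
    · rwa [← D.strictMono_inv.lt_iff_lt, D.right z (hin z hz)]
    · rw [D.right z (hin z hz)]
      have h4 : min e 1 ∈ B z := ⟨by positivity, min_le_right _ _, hz,
        hanti _ _ _ (by positivity) (min_le_left _ _) hz hAe⟩
      exact h4.1.trans_le (le_csSup (hbdd z) h4)

end FieldChart

/-! ### Monotone differences and Lipschitz bounds. -/

theorem sum_range_add_mul_sub (F : ℝ → ℝ) (u s t : ℝ) (n : ℕ) :
    ∑ k ∈ Finset.range n, (F (u + s + (t + k * s)) - F (u + (t + k * s))) =
      F (u + t + n * s) - F (u + t) := by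
  have := Finset.sum_range_sub (fun k : ℕ => F (u + t + k * s)) n
  simp only [Nat.cast_zero, zero_mul, add_zero] at this
  rw [← this]
  refine Finset.sum_congr rfl fun k _ => ?_
  congr 2 <;> push_cast <;> ring

theorem exists_nat_mul_mem {s T : ℝ} (hs : 0 < s) :
    ∃ n : ℕ, T - s < n * s ∧ (0 ≤ T → n * s ≤ T) := by
  refine ⟨⌊T / s⌋₊, ?_, fun hT => ?_⟩
  · have := Nat.lt_floor_add_one (T / s)
    rw [div_lt_iff₀ hs] at this
    linarith
  · have := Nat.floor_le (div_nonneg hT hs.le)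
    rwa [le_div_iff₀ hs] at this

/-- Monotone differences give `F v - F u ≤ F (v + t) - F (u + t)` for all shifts `t` in `[t₁, t₂]`.
Summing over shifts spaced by `v - u` telescopes: about `(t₂ - t₁) / (v - u)` copies of `F v - F u`
are bounded by the total increase of `F`. -/
theorem exists_upper_lipschitz {F : ℝ → ℝ} {x y t₁ t₂ : ℝ} (hxy : x < y) (ht₁ : 0 < t₁)
    (ht : t₁ < t₂) (hF : MonotoneOn F (Icc x (y + t₂)))
    (h : ∀ t ∈ Icc t₁ t₂, MonotoneOn (fun u => F (u + t) - F u) (Icc x y)) :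
    ∃ C y', 0 < C ∧ x < y' ∧ y' ≤ y ∧ ∀ u v, x ≤ u → u < v → v ≤ y' → F v - F u ≤ C * (v - u) := by
  -- With `v - u` at most half of `t₂ - t₁`, the shifts cover at least the other half. The `+ 1`
  -- keeps the constant positive.
  refine ⟨(F (y + t₂) - F x + 1) / ((t₂ - t₁) / 2), min y (x + (t₂ - t₁) / 2), ?_, ?_,
    min_le_left _ _, fun u v hu huv hv => ?_⟩
  · have := hF (left_mem_Icc.2 (by linarith)) (right_mem_Icc.2 (by linarith))
      (show x ≤ y + t₂ by linarith)
    exact div_pos (by linarith) (by linarith)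
  · exact lt_min hxy (by linarith)
  · have hv1 := hv.trans (min_le_left _ _)
    have hv2 := hv.trans (min_le_right _ _)
    have hs : 0 < v - u := by linarith
    obtain ⟨n, hn1, hn2⟩ := exists_nat_mul_mem (T := t₂ - t₁) hs
    replace hn2 := hn2 (by linarith)
    have hsum := sum_range_add_mul_sub F u (v - u) t₁ n
    have hle : ∑ _k ∈ Finset.range n, (F v - F u) ≤ F (u + t₁ + n * (v - u)) - F (u + t₁) := by
      rw [← hsum]
      refine Finset.sum_le_sum fun k hk => ?_
      have hk' : (k : ℝ) ≤ n := by exact_mod_cast (Finset.mem_range.1 hk).le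
      have hks : (k : ℝ) * (v - u) ≤ n * (v - u) := by gcongr
      have hks0 : 0 ≤ (k : ℝ) * (v - u) := by positivity
      have := h (t₁ + k * (v - u)) ⟨by linarith, by linarith⟩ ⟨hu, by linarith⟩
        ⟨by linarith, hv1⟩ huv.le
      have e : u + (v - u) = v := by ring
      rw [e]
      linarith
    rw [Finset.sum_const, Finset.card_range, nsmul_eq_mul] at hle
    have hn0 : 0 ≤ (n : ℝ) * (v - u) := by positivity
    have h1 := hF (a := u + t₁ + n * (v - u)) (b := y + t₂) ⟨by linarith, by linarith⟩
      (right_mem_Icc.2 (by linarith)) (by linarith)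
    have h2 := hF (a := x) (b := u + t₁) (left_mem_Icc.2 (by linarith))
      ⟨by linarith, by linarith⟩ (by linarith)
    have h3 := hF (a := u) (b := v) ⟨by linarith, by linarith⟩ ⟨by linarith, by linarith⟩ huv.le
    rw [div_mul_eq_mul_div, le_div_iff₀ (by linarith)]
    calc (F v - F u) * ((t₂ - t₁) / 2) ≤ (F v - F u) * (n * (v - u)) :=
          mul_le_mul_of_nonneg_left (by linarith) (by linarith)
      _ = n * (F v - F u) * (v - u) := by ring
      _ ≤ (F (y + t₂) - F x + 1) * (v - u) := mul_le_mul_of_nonneg_right (by linarith) hs.le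

/-- The same telescoping with reversed inequality: copies of `F v - F u` dominate the increase of
`F` over a fixed interval covered by every such sum, which is positive by strict monotonicity. -/
theorem exists_lower_lipschitz {F : ℝ → ℝ} {x y t₁ t₂ : ℝ} (hxy : x < y) (ht₁ : 0 < t₁)
    (ht : t₁ < t₂) (hF : StrictMonoOn F (Icc x (y + t₂)))
    (h : ∀ t ∈ Icc t₁ t₂, AntitoneOn (fun u => F (u + t) - F u) (Icc x y)) :
    ∃ C y', 0 < C ∧ x < y' ∧ y' ≤ y ∧ ∀ u v, x ≤ u → u < v → v ≤ y' → C * (v - u) ≤ F v - F u := by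
  set w := (t₂ - t₁) / 4 with hw
  have hc0 : F (x + w + t₁) < F (x + t₁ + 2 * w) :=
    hF ⟨by linarith, by linarith⟩ ⟨by linarith, by linarith⟩ (by linarith)
  refine ⟨(F (x + t₁ + 2 * w) - F (x + w + t₁)) / (t₂ - t₁), min y (x + w), ?_, ?_,
    min_le_left _ _, fun u v hu huv hv => ?_⟩
  · exact div_pos (by linarith) (by linarith)
  · exact lt_min hxy (by linarith)
  · have hv1 := hv.trans (min_le_left _ _)
    have hv2 := hv.trans (min_le_right _ _)
    have hs : 0 < v - u := by linarith
    obtain ⟨n, hn1, hn2⟩ := exists_nat_mul_mem (T := t₂ - t₁) hs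
    replace hn2 := hn2 (by linarith)
    have hsum := sum_range_add_mul_sub F u (v - u) t₁ n
    have hle : F (u + t₁ + n * (v - u)) - F (u + t₁) ≤ ∑ _k ∈ Finset.range n, (F v - F u) := by
      rw [← hsum]
      refine Finset.sum_le_sum fun k hk => ?_
      have hk' : (k : ℝ) ≤ n := by exact_mod_cast (Finset.mem_range.1 hk).le
      have hks : (k : ℝ) * (v - u) ≤ n * (v - u) := by gcongr
      have hks0 : 0 ≤ (k : ℝ) * (v - u) := by positivity
      have := h (t₁ + k * (v - u)) ⟨by linarith, by linarith⟩ ⟨hu, by linarith⟩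
        ⟨by linarith, hv1⟩ huv.le
      have e : u + (v - u) = v := by ring
      rw [e]
      linarith
    rw [Finset.sum_const, Finset.card_range, nsmul_eq_mul] at hle
    have hF' := hF.monotoneOn
    have h1 := hF' (a := x + t₁ + 2 * w) (b := u + t₁ + n * (v - u)) ⟨by linarith, by linarith⟩
      ⟨by linarith, by linarith⟩ (by linarith)
    have h2 := hF' (a := u + t₁) (b := x + w + t₁) ⟨by linarith, by linarith⟩
      ⟨by linarith, by linarith⟩ (by linarith)
    have h3 := hF' (a := u) (b := v) ⟨by linarith, by linarith⟩ ⟨by linarith, by linarith⟩ huv.le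
    rw [div_mul_eq_mul_div, div_le_iff₀ (by linarith)]
    calc (F (x + t₁ + 2 * w) - F (x + w + t₁)) * (v - u) ≤ n * (F v - F u) * (v - u) :=
          mul_le_mul_of_nonneg_right (by linarith) hs.le
      _ = (F v - F u) * (n * (v - u)) := by ring
      _ ≤ (F v - F u) * (t₂ - t₁) := mul_le_mul_of_nonneg_left hn2 (by linarith)

theorem le_deriv_of_eventually_le {F : ℝ → ℝ} {F' C z : ℝ} (h : HasDerivAt F F' z)
    (hC : ∀ᶠ w in 𝓝[>] z, C * (w - z) ≤ F w - F z) : C ≤ F' := by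
  have h1 := (hasDerivAt_iff_tendsto_slope.1 h).mono_left
    (nhdsWithin_mono z (s := Ioi z) fun w hw => ne_of_gt hw)
  refine ge_of_tendsto h1 ?_
  filter_upwards [hC, self_mem_nhdsWithin] with w h2 h3
  rw [slope_def_field, le_div_iff₀ (sub_pos.2 h3)]
  exact h2

/-- If all the difference functions with small shift of a function are piecewise monotone
somewhere, then the monotonicity can be achieved uniformly for an interval of shifts. -/
theorem exists_uniform_monotoneOn {F : ℝ → ℝ} {c d d' : ℝ} (hcd : c < d) (hd : d < d')
    (hF : ContinuousOn F (Icc c d'))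
    (h : ∀ t ∈ Ioo 0 (d' - d), ∃ x y, c ≤ x ∧ x < y ∧ y ≤ d ∧
      (MonotoneOn (fun u => F (u + t) - F u) (Ioo x y) ∨
        AntitoneOn (fun u => F (u + t) - F u) (Ioo x y))) :
    ∃ x y t₁ t₂, c ≤ x ∧ x < y ∧ y ≤ d ∧ 0 < t₁ ∧ t₁ < t₂ ∧ t₂ < d' - d ∧
      ((∀ t ∈ Icc t₁ t₂, MonotoneOn (fun u => F (u + t) - F u) (Icc x y)) ∨
        ∀ t ∈ Icc t₁ t₂, AntitoneOn (fun u => F (u + t) - F u) (Icc x y)) := by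
  set T := d' - d with hT
  have hT0 : 0 < T := by linarith
  let R : Bool → ℝ → ℝ → Prop := fun i r s => if i then r ≤ s else s ≤ r
  -- The shifts for which the difference is monotone, in the sense given by the boolean, on a given
  -- rational interval. Shifts outside `(0, T)` are added so that these countably many closed sets
  -- cover the line and Baire's theorem applies.
  let M : {i : ℚ × ℚ × Bool // c ≤ i.1 ∧ (i.1 : ℝ) < i.2.1 ∧ i.2.1 ≤ d} → Set ℝ := fun i =>
    ⋂ (u : Icc (i.1.1 : ℝ) i.1.2.1) (v : Icc (u : ℝ) i.1.2.1),
      (Iic 0 ∪ Ici T) ∪ {t | t ∈ Icc 0 T ∧ R i.1.2.2 (F (u + t) - F u) (F (v + t) - F v)}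
  have hcont : ∀ u ∈ Icc c d, ContinuousOn (fun t => F (u + t) - F u) (Icc 0 T) := by
    intro u hu
    refine ContinuousOn.sub (hF.comp (by fun_prop) fun t ht => ?_) continuousOn_const
    exact ⟨by linarith [hu.1, ht.1], by linarith [hu.2, ht.2]⟩
  have hclosed : ∀ i, IsClosed (M i) := by
    rintro ⟨⟨p, q, i⟩, hp, hpq, hq⟩
    refine isClosed_iInter fun u => isClosed_iInter fun v => ?_
    refine (isClosed_Iic.union isClosed_Ici).union ?_
    have hu : (u : ℝ) ∈ Icc c d := ⟨hp.trans u.2.1, u.2.2.trans hq⟩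
    have hv : (v : ℝ) ∈ Icc c d := ⟨hu.1.trans v.2.1, v.2.2.trans hq⟩
    cases i
    · simpa [R] using isClosed_Icc.isClosed_le (hcont v hv) (hcont u hu)
    · simpa [R] using isClosed_Icc.isClosed_le (hcont u hu) (hcont v hv)
  have hne : Nonempty {i : ℚ × ℚ × Bool // c ≤ i.1 ∧ (i.1 : ℝ) < i.2.1 ∧ i.2.1 ≤ d} := by
    obtain ⟨p, hp1, hp2⟩ := exists_rat_btwn hcd
    obtain ⟨q, hq1, hq2⟩ := exists_rat_btwn hp2
    exact ⟨⟨p, q, true⟩, hp1.le, hq1, hq2.le⟩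
  have hunion : ⋃ i, M i = univ := by
    refine eq_univ_of_forall fun t => mem_iUnion.2 ?_
    by_cases ht : t ∈ Ioo 0 T
    · obtain ⟨x, y, hx, hxy, hy, hm⟩ := h t ht
      obtain ⟨p, hp1, hp2⟩ := exists_rat_btwn hxy
      obtain ⟨q, hq1, hq2⟩ := exists_rat_btwn hp2
      have key : ∀ i, (∀ u v, u ∈ Ioo x y → v ∈ Ioo x y → u ≤ v →
          R i (F (u + t) - F u) (F (v + t) - F v)) → ∃ i, t ∈ M i := by
        refine fun i hi => ⟨⟨⟨p, q, i⟩, by dsimp; linarith, hq1, by dsimp; linarith⟩, ?_⟩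
        refine mem_iInter.2 fun u => mem_iInter.2 fun v => Or.inr ⟨Ioo_subset_Icc_self ht, ?_⟩
        have hu := u.2
        have hv := v.2
        dsimp only at hu hv
        exact hi u v ⟨by linarith [hu.1], by linarith [hu.2]⟩
          ⟨by linarith [hu.1, hv.1], by linarith [hv.2]⟩ hv.1
      rcases hm with hm | hm
      · exact key true fun u v hu hv huv => by simpa [R] using hm hu hv huv
      · exact key false fun u v hu hv huv => by simpa [R] using hm hu hv huv
    · obtain ⟨i⟩ := hne
      refine ⟨i, mem_iInter.2 fun u => mem_iInter.2 fun v => Or.inl ?_⟩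
      rw [mem_Ioo, not_and_or, not_lt, not_lt] at ht
      exact ht
  have hdense := dense_iUnion_interior_of_closed hclosed hunion
  obtain ⟨t, ht, htT⟩ := hdense.exists_mem_open isOpen_Ioo (nonempty_Ioo.2 hT0)
  obtain ⟨⟨⟨p, q, i⟩, hp, hpq, hq⟩, hi⟩ := mem_iUnion.1 ht
  obtain ⟨l, r, hlr, hsub⟩ := mem_nhds_iff_exists_Ioo_subset.1
    (inter_mem (isOpen_interior.mem_nhds hi) (isOpen_Ioo.mem_nhds htT))
  obtain ⟨t₁, h1, h2⟩ := exists_between hlr.1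
  obtain ⟨t₂, h3, h4⟩ := exists_between hlr.2
  have hmem : ∀ t ∈ Icc t₁ t₂, t ∈ Ioo 0 T ∧ ∀ u v, u ∈ Icc (p : ℝ) q → v ∈ Icc (p : ℝ) q →
      u ≤ v → R i (F (u + t) - F u) (F (v + t) - F v) := by
    intro t ht
    have h5 := hsub ⟨h1.trans_le ht.1, ht.2.trans_lt h4⟩
    refine ⟨h5.2, fun u v hu hv huv => ?_⟩
    have h6 := mem_iInter.1 (mem_iInter.1 (interior_subset h5.1) ⟨u, hu⟩) ⟨v, huv, hv.2⟩
    rcases h6 with (h6 | h6) | h6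
    · exact absurd h6 (not_le.2 h5.2.1)
    · exact absurd h6 (not_le.2 h5.2.2)
    · exact h6.2
  have h12 : t₁ < t₂ := h2.trans h3
  refine ⟨p, q, t₁, t₂, hp, hpq, hq, (hmem t₁ (left_mem_Icc.2 h12.le)).1.1, h12,
    (hmem t₂ (right_mem_Icc.2 h12.le)).1.2, ?_⟩
  cases i
  · refine Or.inr fun t ht u hu v hv huv => ?_
    simpa [R] using (hmem t ht).2 u v hu hv huv
  · refine Or.inl fun t ht u hu v hv huv => ?_
    simpa [R] using (hmem t ht).2 u v hu hv huv

theorem isClosed_setOf_extr {H : ℝ → ℝ} {c d r : ℝ} (hH : ContinuousOn H (Icc c d)) (hr : 0 < r) :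
    IsClosed {u | (c ≤ u - r ∧ u + r ≤ d) ∧ ∀ s, -r < s → s < r → H (u + s) ≤ H u} := by
  have : {u | (c ≤ u - r ∧ u + r ≤ d) ∧ ∀ s, -r < s → s < r → H (u + s) ≤ H u} =
      Icc (c + r) (d - r) ∩ ⋂ s : Ioo (-r) r, {u | u ∈ Icc (c + r) (d - r) ∧ H (u + s) ≤ H u} := by
    ext u
    simp only [mem_ofPred_eq, mem_inter_iff, mem_iInter, mem_Icc, Subtype.forall, mem_Ioo]
    constructor
    · rintro ⟨⟨h1, h2⟩, h3⟩
      exact ⟨⟨by linarith, by linarith⟩, fun s hs => ⟨⟨by linarith, by linarith⟩, h3 s hs.1 hs.2⟩⟩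
    · rintro ⟨⟨h1, h2⟩, h3⟩
      exact ⟨⟨by linarith, by linarith⟩, fun s hs hs' => (h3 s ⟨hs, hs'⟩).2⟩
  rw [this]
  refine isClosed_Icc.inter (isClosed_iInter fun s => isClosed_Icc.isClosed_le ?_ ?_)
  · exact hH.comp (by fun_prop) fun u hu => ⟨by linarith [hu.1, s.2.1], by linarith [hu.2, s.2.2]⟩
  · exact hH.mono fun u hu => ⟨by linarith [hu.1], by linarith [hu.2]⟩

/-! ### Smoothness of a chart in the absence of second-order arithmetic. -/

namespace FieldChart

variable {S : DefStr} {a b : ℝ} {τ σ : ℝ → ℝ}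

/-- If `H` were nowhere monotone, local extrema would be dense, so by the definable Baire theorem
all points of some interval would be extrema of one radius `e`. On a piece of length at most `e`
every value would then be the maximum or the minimum of `H`, against the intermediate value theorem.
-/
theorem exists_monotoneOn_or_antitoneOn (D : FieldChart S a b τ σ) (hno : ¬ S.SecondOrderArith)
    {H : ℝ → ℝ} {c d : ℝ} (hc : a < c) (hcd : c < d) (hd : d < b) (hH : ContinuousOn H (Icc c d))
    (hdef : S.Def2 fun x y => H x ≤ H y) : ∃ x y, c ≤ x ∧ x < y ∧ y ≤ d ∧
      (MonotoneOn H (Ioo x y) ∨ AntitoneOn H (Ioo x y)) := by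
  by_contra! hcon
  have h := D.grp
  have hA : S.Def2 fun r u => (c ≤ u - r ∧ u + r ≤ d) ∧
      ((∀ s, -r < s → s < r → H (u + s) ≤ H u) ∨ ∀ s, -r < s → s < r → H u ≤ H (u + s)) := by
    unfold Def2
    repeat' with_reducible first
      | exact var _ | exact const _ | apply hdef.app | apply S.and | apply DefStr.or | apply all
      | apply imp | apply h.lt | apply h.le | apply h.sub | apply h.add | apply h.neg
  obtain ⟨e, he, x, y, hx, hxy, hy, hA⟩ := D.exists_forall_mem_Ioo hno hA hc hcd hd (by
      intro e he
      have : {x | x ∈ Icc c d ∧ (c ≤ x - e ∧ x + e ≤ d) ∧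
          ((∀ s, -e < s → s < e → H (x + s) ≤ H x) ∨ ∀ s, -e < s → s < e → H x ≤ H (x + s))} =
          Icc c d ∩ ({x | (c ≤ x - e ∧ x + e ≤ d) ∧ ∀ s, -e < s → s < e → H (x + s) ≤ H x} ∪
          {x | (c ≤ x - e ∧ x + e ≤ d) ∧ ∀ s, -e < s → s < e → - H (x + s) ≤ - H x}) := by
        ext x
        simp only [mem_ofPred_eq, mem_inter_iff, mem_union, neg_le_neg_iff]
        tauto
      rw [this]
      exact isClosed_Icc.inter ((isClosed_setOf_extr hH he).union (isClosed_setOf_extr hH.neg he)))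
    (by
      rintro e e' x he' hee' - ⟨⟨h1, h2⟩, h3⟩
      refine ⟨⟨by linarith, by linarith⟩, h3.imp ?_ ?_⟩
      all_goals exact fun h4 s hs hs' => h4 s (by linarith) (by linarith)) (by
      intro x y hx hxy hy
      obtain ⟨n1, n2⟩ := hcon x y hx hxy hy
      obtain ⟨z, r, hr, h1, h2, h3⟩ := exists_extr_of_not_strictMono hxy
        (hH.mono (Icc_subset_Icc hx hy)) (fun hs => n1 hs.monotoneOn) (fun hs => n2 hs.antitoneOn)
      refine ⟨z, by linarith, by linarith, r, hr, ⟨by linarith, by linarith⟩, h3.imp ?_ ?_⟩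
      all_goals exact fun h4 s hs hs' => h4 _ (by linarith) (by linarith))
  set y' := min y (x + e) with hy'
  have hxy' : x < y' := lt_min hxy (by linarith)
  have hy'y : y' ≤ y := min_le_left _ _
  have hy'e : y' ≤ x + e := min_le_right _ _
  have key : ∀ z ∈ Ioo x y', (∀ w ∈ Ioo x y', H w ≤ H z) ∨ ∀ w ∈ Ioo x y', H z ≤ H w := by
    intro z hz
    refine (hA z ⟨hz.1, hz.2.trans_le hy'y⟩).2.imp (fun h1 w hw => ?_) fun h1 w hw => ?_
    all_goals
      have := h1 (w - z) (by linarith [hz.1, hz.2, hw.1, hw.2])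
        (by linarith [hz.1, hz.2, hw.1, hw.2])
      rwa [add_sub_cancel] at this
  refine (hcon x y' hx hxy' (hy'y.trans hy)).1 fun u hu v hv huv => ?_
  by_contra! hlt
  have hsub : Icc u v ⊆ Ioo x y' := fun z hz => ⟨hu.1.trans_le hz.1, hz.2.trans_lt hv.2⟩
  have hcont : ContinuousOn H (Icc u v) :=
    hH.mono fun z hz => ⟨hx.trans (hsub hz).1.le, (hsub hz).2.le.trans (hy'y.trans hy)⟩
  obtain ⟨t, ht1, ht2⟩ := exists_between hlt
  obtain ⟨z, hz, hzt⟩ := intermediate_value_Icc' huv hcont ⟨ht1.le, ht2.le⟩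
  rcases key z (hsub hz) with h1 | h1
  · linarith [h1 u hu]
  · linarith [h1 v hv]

theorem exists_differentiableAt (D : FieldChart S a b τ σ) {x y : ℝ} (hx : a ≤ x) (hxy : x < y)
    (hy : y ≤ b) : ∃ z ∈ Ioo x y, DifferentiableAt ℝ τ z := by
  obtain ⟨z, hz1, hz2⟩ := (MeasureTheory.Measure.dense_of_ae
    D.mono.monotoneOn.ae_differentiableWithinAt_of_mem).exists_between hxy
  have hz : z ∈ Ioo a b := ⟨hx.trans_lt hz2.1, hz2.2.trans_le hy⟩
  exact ⟨z, hz2, (hz1 hz).differentiableAt (isOpen_Ioo.mem_nhds hz)⟩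

/-- Almost everywhere differentiability of a monotone function does not exclude zero derivative.
Uniformly monotone differences supply the missing Lipschitz bound for `τ` or for its inverse. -/
theorem exists_hasDerivAt_pos (D : FieldChart S a b τ σ) (hab : a < b)
    (hno : ¬ S.SecondOrderArith) : ∃ u₀ ∈ Ioo a b, ∃ κ, 0 < κ ∧ HasDerivAt τ κ u₀ := by
  have h := D.grp
  obtain ⟨c, hc, h1⟩ := exists_between hab
  obtain ⟨d, hd, h2⟩ := exists_between h1
  obtain ⟨d', hd', h3⟩ := exists_between h2
  have hcont : ContinuousOn τ (Icc c d') :=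
    D.cont.mono fun x hx => ⟨hc.trans_le hx.1, hx.2.trans_lt h3⟩
  obtain ⟨x, y, t₁, t₂, hx, hxy, hy, ht₁, ht, ht₂, hm⟩ := exists_uniform_monotoneOn hd hd' hcont
    fun t ht => by
      refine D.exists_monotoneOn_or_antitoneOn hno hc hd h2 ?_ ?_
      · refine ContinuousOn.sub (hcont.comp (by fun_prop) fun u hu => ?_)
          (hcont.mono fun u hu => ⟨hu.1, hu.2.trans hd'.le⟩)
        exact ⟨by linarith [hu.1, ht.1], by linarith [hu.2, ht.2]⟩
      · unfold Def2
        repeat' with_reducible first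
          | exact var _ | exact const _ | apply D.le | apply D.sub | apply D.coord | apply h.add
  have hmono : StrictMonoOn τ (Icc x (y + t₂)) :=
    D.mono.mono fun z hz => ⟨by linarith [hz.1], by linarith [hz.2]⟩
  rcases hm with hm | hm
  · obtain ⟨C, y', hC, hxy', hy', hL⟩ := exists_upper_lipschitz hxy ht₁ ht hmono.monotoneOn hm
    have hIx : ∀ z ∈ Icc x y', z ∈ Ioo a b := fun z hz => ⟨by linarith [hz.1], by linarith [hz.2]⟩
    have hxI := hIx x (left_mem_Icc.2 hxy'.le)
    have hyI := hIx y' (right_mem_Icc.2 hxy'.le)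
    -- An upper bound `C` for the slopes of `τ` is a lower bound `C⁻¹` for those of `σ`. At a point
    -- where `σ` is differentiable the inverse function rule returns to `τ`.
    obtain ⟨w, hw1, hw2⟩ := (MeasureTheory.Measure.dense_of_ae
      D.strictMono_inv.monotone.ae_differentiableAt).exists_between (D.mono hxI hyI hxy')
    have hd : HasDerivAt σ (deriv σ w) w := hw1.hasDerivAt
    have hinv : ∀ z ∈ Ioo (τ x) (τ y'), σ z ∈ Ioo x y' := fun z hz => by
      constructor
      · rw [← D.mono.lt_iff_lt hxI (D.mem _), D.left]; exact hz.1
      · rw [← D.mono.lt_iff_lt (D.mem _) hyI, D.left]; exact hz.2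
    have hpos : C⁻¹ ≤ deriv σ w := by
      refine le_deriv_of_eventually_le hd ?_
      filter_upwards [Ioo_mem_nhdsGT hw2.2] with z hz
      have hz' := hinv z ⟨hw2.1.trans hz.1, hz.2⟩
      have := hL (σ w) (σ z) (hinv w hw2).1.le (D.strictMono_inv hz.1) hz'.2.le
      rw [D.left, D.left] at this
      rw [inv_mul_le_iff₀ hC]
      exact this
    have hpos' : 0 < deriv σ w := (inv_pos.2 hC).trans_le hpos
    refine ⟨σ w, D.mem w, (deriv σ w)⁻¹, inv_pos.2 hpos', ?_⟩
    refine HasDerivAt.of_local_left_inverse (f := σ)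
      (D.cont.continuousAt (isOpen_Ioo.mem_nhds (D.mem w))) ?_ hpos'.ne' ?_
    · rwa [D.left]
    · filter_upwards [isOpen_Ioo.mem_nhds (D.mem w)] with z hz using D.right z hz
  · obtain ⟨C, y', hC, hxy', hy', hL⟩ := exists_lower_lipschitz hxy ht₁ ht hmono hm
    obtain ⟨z, hz, hdz⟩ := D.exists_differentiableAt (hc.le.trans hx) hxy' (by linarith)
    refine ⟨z, ⟨by linarith [hz.1], by linarith [hz.2]⟩, deriv τ z,
      hC.trans_le (le_deriv_of_eventually_le hdz.hasDerivAt ?_), hdz.hasDerivAt⟩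
    filter_upwards [Ioo_mem_nhdsGT hz.2] with w hw
    exact hL z w hz.1.le hw.1 hw.2.le

end FieldChart

/-- If the difference quotients of a function, measured against a gauge `m` with positive right
derivative `κ` at zero, converge locally uniformly, then the function is `C¹`. -/
theorem exists_continuousOn_hasDerivAt {F m : ℝ → ℝ} {κ : ℝ} {U : Set ℝ} (hU : IsOpen U)
    (hm0 : ∀ᶠ s in 𝓝[>] 0, m s ≠ 0) (hm : Tendsto (fun s => m s / s) (𝓝[>] 0) (𝓝 κ))
    (hQ : ∀ v ∈ U, ∀ e, 0 < e → ∃ δ, 0 < δ ∧ ∀ v₁ v₂ s₁ s₂, v - δ < v₁ → v₁ < v + δ → v - δ < v₂ →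
      v₂ < v + δ → 0 < s₁ → s₁ < δ → 0 < s₂ → s₂ < δ →
      (F (v₁ + s₁) - F v₁) / m s₁ ≤ (F (v₂ + s₂) - F v₂) / m s₂ + e) :
    ∃ g : ℝ → ℝ, ContinuousOn g U ∧ ∀ v ∈ U, HasDerivAt F (g v) v := by
  let Q : ℝ × ℝ → ℝ := fun p => (F (p.1 + p.2) - F p.1) / m p.2
  have hex : ∀ v, ∃ y, v ∈ U → Tendsto Q (𝓝 v ×ˢ 𝓝[>] 0) (𝓝 y) := by
    intro v
    by_cases hv : v ∈ U
    · obtain ⟨y, hy⟩ := (cauchy_map_iff_exists_tendsto (f := Q) (l := 𝓝 v ×ˢ 𝓝[>] 0)).1 <| by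
        refine Metric.cauchy_iff.2 ⟨inferInstance, fun e he => ?_⟩
        obtain ⟨δ, hδ, h⟩ := hQ v hv (e / 2) (by linarith)
        refine ⟨Q '' (Ioo (v - δ) (v + δ) ×ˢ Ioo 0 δ), image_mem_map (prod_mem_prod
          (Ioo_mem_nhds (by linarith) (by linarith)) (Ioo_mem_nhdsGT hδ)), ?_⟩
        rintro _ ⟨⟨v₁, s₁⟩, ⟨h1, h2⟩, rfl⟩ _ ⟨⟨v₂, s₂⟩, ⟨h3, h4⟩, rfl⟩
        have k1 := h v₁ v₂ s₁ s₂ h1.1 h1.2 h3.1 h3.2 h2.1 h2.2 h4.1 h4.2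
        have k2 := h v₂ v₁ s₂ s₁ h3.1 h3.2 h1.1 h1.2 h4.1 h4.2 h2.1 h2.2
        rw [Real.dist_eq, abs_lt]
        dsimp only [Q]
        constructor <;> linarith
      exact ⟨y, fun _ => hy⟩
    · exact ⟨0, fun h => absurd h hv⟩
  choose g hg using hex
  refine ⟨fun v => g v * κ, ContinuousOn.mul (fun v hv => ContinuousAt.continuousWithinAt ?_)
    continuousOn_const, fun v hv => ?_⟩
  · rw [ContinuousAt, (closed_nhds_basis (g v)).tendsto_right_iff]
    rintro N ⟨hN, hNc⟩
    -- The limit at a nearby `w` is a limit of quotients already in the closed neighbourhood `N`, so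
    -- it lies in `N` too.
    have h1 := ((hg v hv).eventually hN).curry
    filter_upwards [h1, hU.mem_nhds hv] with w h2 hw
    refine hNc.mem_of_tendsto ((hg w hw).comp ?_) h2
    exact (tendsto_const_nhds (x := w)).prodMk tendsto_id
  · rw [hasDerivAt_iff_tendsto_slope, ← nhdsLT_sup_nhdsGT, tendsto_sup]
    constructor
    -- The left slope at `v` is a quotient with moving base `w` and positive shift `v - w`; this is
    -- where convergence jointly in base and shift is needed.
    · have hs : Tendsto (fun w => v - w) (𝓝[<] v) (𝓝[>] 0) := by
        refine tendsto_nhdsWithin_iff.2 ⟨?_, ?_⟩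
        · refine tendsto_nhdsWithin_of_tendsto_nhds ?_
          exact (show Continuous fun w => v - w by fun_prop).tendsto' v 0 (sub_self v)
        · filter_upwards [self_mem_nhdsWithin] with w hw using sub_pos.2 (mem_Iio.1 hw)
      refine (((hg v hv).comp ((tendsto_nhdsWithin_of_tendsto_nhds tendsto_id).prodMk hs)).mul
        (hm.comp hs)).congr' ?_
      filter_upwards [hs.eventually hm0, self_mem_nhdsWithin] with w h1 h2
      have h3 : v - w ≠ 0 := (sub_pos.2 h2).ne'
      have h4 : w - v ≠ 0 := (sub_neg.2 h2).ne
      simp only [Q, Function.comp, id, slope_def_field, add_sub_cancel]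
      rw [div_mul_div_cancel₀ h1, div_eq_div_iff h3 h4]
      ring
    · have hs : Tendsto (fun w => w - v) (𝓝[>] v) (𝓝[>] 0) := by
        refine tendsto_nhdsWithin_iff.2 ⟨?_, ?_⟩
        · refine tendsto_nhdsWithin_of_tendsto_nhds ?_
          exact (show Continuous fun w => w - v by fun_prop).tendsto' v 0 (sub_self v)
        · filter_upwards [self_mem_nhdsWithin] with w hw using sub_pos.2 (mem_Ioi.1 hw)
      refine (((hg v hv).comp ((tendsto_const_nhds (x := v)).prodMk hs)).mul
        (hm.comp hs)).congr' ?_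
      filter_upwards [hs.eventually hm0] with w h1
      simp only [Q, Function.comp, slope_def_field, add_sub_cancel]
      rw [div_mul_div_cancel₀ h1]

namespace FieldChart

variable {S : DefStr} {a b : ℝ} {τ σ : ℝ → ℝ}

/-- Division is available only in the chart, so the shift `s` is measured by the gauge `τ (u₀ + s) -
τ u₀`, asymptotic to `κ s`. At every point of differentiability of `τ` the quotients converge, and
such points are dense; the definable Baire theorem makes the threshold uniform on an interval. -/
theorem exists_quotient_uniform (D : FieldChart S a b τ σ) (hno : ¬ S.SecondOrderArith)
    {u₀ κ δ₀ x y η : ℝ} (hδ₀ : 0 < δ₀) (hκ : 0 < κ)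
    (hτ : HasDerivAt τ κ u₀) (hx : a < x) (hxy : x < y) (hy : y + δ₀ ≤ b) (hη : 0 < η) :
    ∃ ε, 0 < ε ∧ ε ≤ δ₀ ∧ ∃ x' y', x ≤ x' ∧ x' < y' ∧ y' ≤ y ∧ ∀ z ∈ Ioo x' y', ∀ s₁ s₂,
      0 < s₁ → s₁ < ε → 0 < s₂ → s₂ < ε →
      (τ (z + s₁) - τ z) / (τ (u₀ + s₁) - τ u₀) ≤
        (τ (z + s₂) - τ z) / (τ (u₀ + s₂) - τ u₀) + η := by
  have h := D.grp
  have hA : S.Def2 fun ε z => ε ≤ δ₀ ∧ ∀ s₁ s₂, 0 < s₁ → s₁ < ε → 0 < s₂ → s₂ < ε →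
      (τ (z + s₁) - τ z) / (τ (u₀ + s₁) - τ u₀) ≤
        (τ (z + s₂) - τ z) / (τ (u₀ + s₂) - τ u₀) + η := by
    unfold Def2
    repeat' with_reducible first
      | exact var _ | exact const _ | exact h.le (var _) (const _) | apply D.le | apply D.add
      | apply D.div | apply D.sub | apply D.coord | apply S.and | apply all | apply imp
      | apply h.lt | apply h.add
  obtain ⟨ε, hε, x', y', h1, h2, h3, h4⟩ := D.exists_forall_mem_Ioo hno hA hx hxy
    (by linarith) (fun e he => by
      by_cases hed : e ≤ δ₀
      · have : {z | z ∈ Icc x y ∧ e ≤ δ₀ ∧ ∀ s₁ s₂, 0 < s₁ → s₁ < e → 0 < s₂ → s₂ < e →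
            (τ (z + s₁) - τ z) / (τ (u₀ + s₁) - τ u₀) ≤
            (τ (z + s₂) - τ z) / (τ (u₀ + s₂) - τ u₀) + η} =
            Icc x y ∩ ⋂ (s₁ : Ioo 0 e) (s₂ : Ioo 0 e), {z | z ∈ Icc x y ∧
            (τ (z + s₁) - τ z) / (τ (u₀ + s₁) - τ u₀) ≤
            (τ (z + s₂) - τ z) / (τ (u₀ + s₂) - τ u₀) + η} := by
          ext z
          simp only [mem_ofPred_eq, mem_inter_iff, mem_iInter, Subtype.forall, mem_Ioo]
          exact ⟨fun k => ⟨k.1, fun s₁ i1 s₂ i2 => ⟨k.1, k.2.2 s₁ s₂ i1.1 i1.2 i2.1 i2.2⟩⟩,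
            fun k => ⟨k.1, hed, fun s₁ s₂ i1 i2 i3 i4 => (k.2 s₁ ⟨i1, i2⟩ s₂ ⟨i3, i4⟩).2⟩⟩
        rw [this]
        have hc : ∀ s ∈ Ioo 0 e, ContinuousOn (fun z => (τ (z + s) - τ z) / (τ (u₀ + s) - τ u₀))
            (Icc x y) := fun s hs => by
          refine ContinuousOn.div_const (ContinuousOn.sub (D.cont.comp (by fun_prop) fun z hz => ?_)
            (D.cont.mono fun z hz => ?_)) _
          · exact ⟨by linarith [hz.1, hs.1], by linarith [hz.2, hs.2]⟩
          · exact ⟨by linarith [hz.1], by linarith [hz.2]⟩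
        exact isClosed_Icc.inter (isClosed_iInter fun s₁ => isClosed_iInter fun s₂ =>
          isClosed_Icc.isClosed_le (hc s₁ s₁.2) ((hc s₂ s₂.2).add continuousOn_const))
      · simp [hed])
    (fun e e' z _ h1 _ h2 => ⟨h1.trans h2.1, fun s₁ s₂ i1 i2 i3 i4 =>
      h2.2 s₁ s₂ i1 (i2.trans_le h1) i3 (i4.trans_le h1)⟩)
    (fun x' y' h1 h2 h3 => by
      obtain ⟨z, hz, hdz⟩ := D.exists_differentiableAt (hx.le.trans h1) h2 (by linarith)
      have hlim := hdz.hasDerivAt.tendsto_slope_zero_right.div hτ.tendsto_slope_zero_right hκ.ne'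
      have hev := hlim.eventually (Ioo_mem_nhds (sub_lt_self _ (half_pos hη))
        (lt_add_of_pos_right _ (half_pos hη)))
      obtain ⟨e, he, hsub⟩ := mem_nhdsGT_iff_exists_Ioo_subset.1 hev
      have key : ∀ s, 0 < s → s < e →
          deriv τ z / κ - η / 2 < (τ (z + s) - τ z) / (τ (u₀ + s) - τ u₀) ∧
          (τ (z + s) - τ z) / (τ (u₀ + s) - τ u₀) < deriv τ z / κ + η / 2 := fun s h0 h1 => by
        have := hsub ⟨h0, h1⟩
        simp only [mem_ofPred_eq, Pi.div_apply, smul_eq_mul] at this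
        rwa [mul_div_mul_left _ _ (inv_ne_zero h0.ne')] at this
      refine ⟨z, hz.1, hz.2, min e δ₀, lt_min he hδ₀, min_le_right _ _,
        fun s₁ s₂ i1 i2 i3 i4 => ?_⟩
      have k1 := key s₁ i1 (i2.trans_le (min_le_left _ _))
      have k2 := key s₂ i3 (i4.trans_le (min_le_left _ _))
      linarith [k1.2, k2.1])
  have hz := h4 ((x' + y') / 2) ⟨by linarith, by linarith⟩
  exact ⟨ε, hε, hz.1, x', y', h1, h2, h3, fun z hz => (h4 z hz).2⟩

/-- For each tolerance, the points near which quotients oscillate little form a dense open set. If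
their complements had dense union in every subinterval, the definable Baire theorem would give one
of them interior. So some interval consists of points that are good for all tolerances, and there
the quotients converge locally uniformly. -/
theorem exists_hasDerivAt_continuousOn (D : FieldChart S a b τ σ) (hab : a < b)
    (hno : ¬ S.SecondOrderArith) : ∃ x y, x < y ∧ Ioo x y ⊆ Ioo a b ∧ ∃ g : ℝ → ℝ,
      ContinuousOn g (Ioo x y) ∧ ∀ z ∈ Ioo x y, HasDerivAt τ (g z) z := by
  have h := D.grp
  obtain ⟨u₀, hu₀, κ, hκ, hτ⟩ := D.exists_hasDerivAt_pos hab hno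
  obtain ⟨p, hp, h1⟩ := exists_between hab
  obtain ⟨q, hpq, hq⟩ := exists_between h1
  obtain ⟨δ₀, hδ₀, hδ⟩ : ∃ δ₀, 0 < δ₀ ∧ δ₀ < min (b - q) (b - u₀) :=
    exists_between (lt_min (sub_pos.2 hq) (sub_pos.2 hu₀.2))
  have hδ1 : q + δ₀ < b := by linarith [hδ.trans_le (min_le_left _ _)]
  have hδ2 : u₀ + δ₀ < b := by linarith [hδ.trans_le (min_le_right _ _)]
  have hm : ∀ s s', 0 ≤ s → s < s' → s' ≤ δ₀ → τ (u₀ + s) - τ u₀ < τ (u₀ + s') - τ u₀ :=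
    fun s s' i1 i2 i3 => sub_lt_sub_right (D.mono ⟨by linarith [hu₀.1], by linarith⟩
      ⟨by linarith [hu₀.1], by linarith⟩ (by linarith)) _
  have hm0 : ∀ s, 0 < s → s ≤ δ₀ → 0 < τ (u₀ + s) - τ u₀ := fun s i1 i2 => by
    simpa using hm 0 s le_rfl i1 i2
  -- The tolerance must be a field element, while the family is indexed by the original line; hence
  -- the increment `τ (u₀ + e) - τ u₀`, positive and increasing in small `e > 0`.
  let P : ℝ → ℝ → Prop := fun e v => ∃ δ, 0 < δ ∧ ∀ v₁ v₂ s₁ s₂, v - δ < v₁ → v₁ < v + δ →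
    v - δ < v₂ → v₂ < v + δ → 0 < s₁ → s₁ < δ → 0 < s₂ → s₂ < δ →
    (τ (v₁ + s₁) - τ v₁) / (τ (u₀ + s₁) - τ u₀) ≤
      (τ (v₂ + s₂) - τ v₂) / (τ (u₀ + s₂) - τ u₀) + (τ (u₀ + e) - τ u₀)
  have hPdense : ∀ e x y, 0 < e → e ≤ δ₀ → p ≤ x → x < y → y ≤ q → ∃ z ∈ Ioo x y, P e z := by
    intro e x y he heδ hx hxy hy
    set η := (τ (u₀ + e) - τ u₀) / 3 with hη
    have hη0 : 0 < η := div_pos (hm0 e he heδ) (by norm_num)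
    obtain ⟨ε, hε, hεδ, x', y', h1, h2, h3, h4⟩ := D.exists_quotient_uniform hno hδ₀ hκ
      hτ (hp.trans_le hx) hxy (by linarith) hη0
    obtain ⟨z, hz⟩ := nonempty_Ioo.2 h2
    have hc : ContinuousAt (fun v => (τ (v + ε / 2) - τ v) / (τ (u₀ + ε / 2) - τ u₀)) z := by
      have c1 : ContinuousAt τ z := D.cont.continuousAt (Ioo_mem_nhds (by linarith [hz.1])
        (by linarith [hz.2]))
      have c2 : ContinuousAt τ (z + ε / 2) := D.cont.continuousAt
        (Ioo_mem_nhds (by linarith [hz.1]) (by linarith [hz.2]))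
      exact ((ContinuousAt.comp (f := fun v => v + ε / 2) c2 (by fun_prop)).sub c1).div_const _
    obtain ⟨δ, hδ, hball⟩ := Metric.mem_nhds_iff.1 (inter_mem (isOpen_Ioo.mem_nhds hz)
      (hc (Metric.ball_mem_nhds _ (half_pos hη0))))
    have key : ∀ w s, z - min δ ε < w → w < z + min δ ε → 0 < s → s < min δ ε → w ∈ Ioo x' y' ∧
        |(τ (w + ε / 2) - τ w) / (τ (u₀ + ε / 2) - τ u₀) -
          (τ (z + ε / 2) - τ z) / (τ (u₀ + ε / 2) - τ u₀)| < η / 2 := by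
      intro w s i1 i2 i3 i4
      have := hball (show w ∈ Metric.ball z δ by
        rw [Metric.mem_ball, Real.dist_eq, abs_lt]
        constructor <;> linarith [min_le_left δ ε])
      exact ⟨this.1, this.2⟩
    refine ⟨z, ⟨by linarith [hz.1], by linarith [hz.2]⟩, min δ ε, lt_min hδ hε, ?_⟩
    intro v₁ v₂ s₁ s₂ i1 i2 i3 i4 i5 i6 i7 i8
    obtain ⟨k1, k2⟩ := key v₁ s₁ i1 i2 i5 i6
    obtain ⟨k3, k4⟩ := key v₂ s₂ i3 i4 i7 i8
    have j1 := h4 v₁ k1 s₁ (ε / 2) i5 (i6.trans_le (min_le_right _ _)) (by linarith) (by linarith)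
    have j2 := h4 v₂ k3 (ε / 2) s₂ (by linarith) (by linarith) i7 (i8.trans_le (min_le_right _ _))
    rw [abs_lt] at k2 k4
    have : τ (u₀ + e) - τ u₀ = 3 * η := by rw [hη]; ring
    linarith [k2.2, k4.1]
  have hPmono : ∀ e e' v, 0 < e' → e' ≤ e → e ≤ δ₀ → P e' v → P e v := by
    rintro e e' v he' hee' he ⟨δ, hδ, hP⟩
    refine ⟨δ, hδ, fun v₁ v₂ s₁ s₂ i1 i2 i3 i4 i5 i6 i7 i8 =>
      (hP v₁ v₂ s₁ s₂ i1 i2 i3 i4 i5 i6 i7 i8).trans ?_⟩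
    rcases hee'.eq_or_lt with rfl | hlt
    · exact le_rfl
    · linarith [hm e' e he'.le hlt he]
  have hPopen : ∀ e, IsOpen {v | P e v} := by
    intro e
    rw [Metric.isOpen_iff]
    rintro v ⟨δ, hδ, hP⟩
    refine ⟨δ / 2, by linarith, fun w hw => ⟨δ / 2, by linarith, ?_⟩⟩
    rw [Metric.mem_ball, Real.dist_eq, abs_lt] at hw
    intro v₁ v₂ s₁ s₂ i1 i2 i3 i4 i5 i6 i7 i8
    exact hP v₁ v₂ s₁ s₂ (by linarith) (by linarith) (by linarith) (by linarith) i5 (by linarith)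
      i7 (by linarith)
  have hA : S.Def2 fun e v => e ≤ δ₀ ∧ ¬ P e v := by
    unfold Def2
    repeat' with_reducible first
      | exact var _ | exact const _ | exact h.le (var _) (const _) | apply D.le | apply D.add
      | apply D.div | apply D.sub | apply D.coord | apply S.and | apply S.not | apply S.ex
      | apply all | apply imp | apply h.lt | apply h.add | apply h.sub
  obtain ⟨x, y, hx, hxy, hy, hP⟩ : ∃ x y, p ≤ x ∧ x < y ∧ y ≤ q ∧ ∀ z, x < z → z < y →
      ∀ e, 0 < e → ¬ (e ≤ δ₀ ∧ ¬ P e z) := by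
    by_contra! hcon
    obtain ⟨e, he, x, y, hx, hxy, hy, hA'⟩ := D.exists_forall_mem_Ioo hno hA hp hpq hq
      (fun e he => by
        by_cases hed : e ≤ δ₀
        · simp only [hed, true_and]
          exact isClosed_Icc.inter (hPopen e).isClosed_compl
        · simp [hed])
      (fun e e' z i1 i2 _ i3 => ⟨i2.trans i3.1, fun hc => i3.2 (hPmono e e' z i1 i2 i3.1 hc)⟩)
      hcon
    obtain ⟨z, hz, hPz⟩ := hPdense e x y he (hA' ((x + y) / 2) ⟨by linarith, by linarith⟩).1 hx
      hxy hy
    exact (hA' z hz).2 hPz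
  refine ⟨x, y, hxy, Ioo_subset_Ioo (by linarith) (by linarith), ?_⟩
  refine exists_continuousOn_hasDerivAt (m := fun s => τ (u₀ + s) - τ u₀) (κ := κ) isOpen_Ioo
    ?_ ?_ fun v hv e he => ?_
  · filter_upwards [Ioo_mem_nhdsGT hδ₀] with s hs using (hm0 s hs.1 hs.2.le).ne'
  · refine hτ.tendsto_slope_zero_right.congr fun s => ?_
    rw [smul_eq_mul, inv_mul_eq_div]
  · have hlim : Tendsto (fun s => τ (u₀ + s) - τ u₀) (𝓝[>] 0) (𝓝 0) := by
      have hc : ContinuousAt (fun s => τ (u₀ + s) - τ u₀) 0 := by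
        refine ContinuousAt.sub (ContinuousAt.comp (f := fun s => u₀ + s) ?_ (by fun_prop))
          continuousAt_const
        rw [add_zero]
        exact hτ.continuousAt
      have := hc.tendsto
      simp only [add_zero, sub_self] at this
      exact this.mono_left nhdsWithin_le_nhds
    obtain ⟨s, hs, hs2⟩ := ((hlim.eventually (gt_mem_nhds he)).and (Ioo_mem_nhdsGT hδ₀)).exists
    obtain ⟨δ, hδ, hPs⟩ := not_not.1 fun hc => hP v hv.1 hv.2 s hs2.1 ⟨hs2.2.le, hc⟩
    exact ⟨δ, hδ, fun v₁ v₂ s₁ s₂ i1 i2 i3 i4 i5 i6 i7 i8 =>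
      (hPs v₁ v₂ s₁ s₂ i1 i2 i3 i4 i5 i6 i7 i8).trans (by linarith)⟩

end FieldChart

/-! ### A definable non-affine `C¹` function and the final theorem. -/

theorem FieldChart.exists_hasDerivAt_pos_interval {S : DefStr} {a b : ℝ} {τ σ : ℝ → ℝ}
    (D : FieldChart S a b τ σ) (hab : a < b) (hno : ¬ S.SecondOrderArith) :
    ∃ x y, x < y ∧ Ioo x y ⊆ Ioo a b ∧ ∃ g : ℝ → ℝ, ContinuousOn g (Ioo x y) ∧
      ∀ z ∈ Ioo x y, 0 < g z ∧ HasDerivAt τ (g z) z := by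
  obtain ⟨x, y, hxy, hsub, g, hg, hd⟩ := D.exists_hasDerivAt_continuousOn hab hno
  obtain ⟨z, hz, hpos⟩ : ∃ z ∈ Ioo x y, 0 < g z := by
    -- If the derivative were nowhere positive, `τ` would be antitone on the interval, although it
    -- is strictly increasing.
    by_contra! hcon
    have hanti : AntitoneOn τ (Ioo x y) := by
      refine antitoneOn_of_deriv_nonpos (convex_Ioo x y) (D.cont.mono hsub) ?_ ?_
      · rw [interior_Ioo]
        exact fun z hz => (hd z hz).differentiableAt.differentiableWithinAt
      · rw [interior_Ioo]
        exact fun z hz => (hd z hz).deriv.trans_le (hcon z hz)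
    obtain ⟨u, hu⟩ := nonempty_Ioo.2 hxy
    obtain ⟨v, hv⟩ := nonempty_Ioo.2 hu.2
    have hv' : v ∈ Ioo x y := ⟨hu.1.trans hv.1, hv.2⟩
    exact absurd (hanti hu hv' hv.1.le) (not_le.2 (D.mono (hsub hu) (hsub hv') hv.1))
  obtain ⟨l, r, hlr, hs⟩ := mem_nhds_iff_exists_Ioo_subset.1 (inter_mem (isOpen_Ioo.mem_nhds hz)
    ((hg.continuousAt (isOpen_Ioo.mem_nhds hz)).eventually (lt_mem_nhds hpos)))
  exact ⟨l, r, hlr.1.trans hlr.2, fun w hw => hsub (hs hw).1, g, hg.mono fun w hw => (hs hw).1,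
    fun w hw => ⟨(hs hw).2, hd w (hs hw).1⟩⟩

theorem IsFieldType.exists_contDiffOn_not_isAffineOn {L : FirstOrder.Language.{u, v}}
    [L.Structure ℝ] (h : (langStr L).OrdGroup) (hL : IsFieldType L)
    (hno : ¬ (langStr L).SecondOrderArith) : ∃ (l r : ℝ) (f : ℝ → ℝ), l < r ∧ IsDefFunOn L f l r ∧
      ContDiffOn ℝ 1 f (Ioo l r) ∧ ¬ IsAffineOn f l r := by
  obtain ⟨a, b, τ, σ, hab, D⟩ := hL.exists_fieldChart h
  obtain ⟨x, y, hxy, hsub, g, hg, hd⟩ := D.exists_hasDerivAt_pos_interval hab hno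
  obtain ⟨z, hz⟩ := nonempty_Ioo.2 hxy
  -- The field expression `X + (X - τ z)²` read in the chart. It fixes `z` and exceeds the identity
  -- at the other points of `(x, y)`.
  let f : ℝ → ℝ := fun u => σ (τ u + (τ u - τ z) * (τ u - τ z))
  have hτc : ∀ u ∈ Ioo x y, ContinuousAt τ u := fun u hu => (hd u hu).2.continuousAt
  have hfc : ∀ u ∈ Ioo x y, ContinuousAt f u := fun u hu =>
    have := hτc u hu
    D.cont_inv.continuousAt.comp (by fun_prop)
  have hfz : f z = z := by simp [f, D.right z (hsub hz)]
  have hfgt : ∀ u ∈ Ioo x y, u ≠ z → u < f u := fun u hu hne => by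
    have h0 : τ u - τ z ≠ 0 := sub_ne_zero.2 (D.mono.injOn.ne (hsub hu) (hsub hz) hne)
    calc u = σ (τ u) := (D.right u (hsub hu)).symm
      _ < f u := D.strictMono_inv (lt_add_of_pos_right _ (mul_self_pos.2 h0))
  have hN : f ⁻¹' Ioo x y ∈ 𝓝 z := (hfc z hz) (isOpen_Ioo.mem_nhds (hfz.symm ▸ hz))
  obtain ⟨l, r, hlr, hs⟩ := mem_nhds_iff_exists_Ioo_subset.1
    (inter_mem (isOpen_Ioo.mem_nhds hz) hN)
  -- Positivity of `g` is needed here: it makes the inverse chart, and hence `f`, continuously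
  -- differentiable.
  have hσ : ∀ w, σ w ∈ Ioo x y → HasDerivAt σ (g (σ w))⁻¹ w := fun w hw =>
    HasDerivAt.of_local_left_inverse D.cont_inv.continuousAt (hd _ hw).2 (hd _ hw).1.ne'
      (Eventually.of_forall D.left)
  have hfd : ∀ u ∈ Ioo l r, HasDerivAt f
      ((g (f u))⁻¹ * (g u + (g u * (τ u - τ z) + (τ u - τ z) * g u))) u := fun u hu => by
    have h1 := (hd u (hs hu).1).2
    have h2 := h1.sub_const (τ z)
    exact (hσ _ (hs hu).2).comp u (h1.add (h2.mul h2))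
  refine ⟨l, r, f, hlr.1.trans hlr.2, ?_, ?_, ?_⟩
  · have : (langStr L).Def2 fun u w => (l < u ∧ u < r) ∧ w = f u := by
      unfold Def2
      repeat' with_reducible first
        | exact var _ | exact const _ | apply D.add | apply D.sub | apply D.mul | apply D.coord
        | apply h.lt | apply (langStr L).and | apply eq
    exact this
  · rw [contDiffOn_one_iff_derivWithin isOpen_Ioo.uniqueDiffOn]
    refine ⟨fun u hu => (hfd u hu).differentiableAt.differentiableWithinAt, ?_⟩
    refine ContinuousOn.congr (f := fun u =>
      (g (f u))⁻¹ * (g u + (g u * (τ u - τ z) + (τ u - τ z) * g u))) ?_ fun u hu => ?_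
    · have hgc : ContinuousOn g (Ioo l r) := hg.mono fun u hu => (hs hu).1
      have hτ' : ContinuousOn τ (Ioo l r) :=
        fun u hu => (hτc u (hs hu).1).continuousWithinAt
      refine ContinuousOn.mul (ContinuousOn.inv₀ ?_ fun u hu => (hd _ (hs hu).2).1.ne') ?_
      · exact hg.comp (fun u hu => (hfc u (hs hu).1).continuousWithinAt) fun u hu => (hs hu).2
      · fun_prop
    · exact (hfd u hu).hasDerivWithinAt.derivWithin (isOpen_Ioo.uniqueDiffOn u hu)
  · rintro ⟨m, c, hf⟩
    -- An affine `f` would satisfy `f (z + w) + f (z - w) = 2 f z = 2 z`, while the left side is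
    -- greater than `2 z`.
    obtain ⟨w, hw, hw2⟩ := exists_between (lt_min (sub_pos.2 hlr.1) (sub_pos.2 hlr.2))
    have hw3 := hw2.trans_le (min_le_left _ _)
    have hw4 := hw2.trans_le (min_le_right _ _)
    have m1 : z + w ∈ Ioo l r := ⟨by linarith, by linarith⟩
    have m2 : z - w ∈ Ioo l r := ⟨by linarith, by linarith⟩
    have h1 := hfgt _ (hs m1).1 (by linarith)
    have h2 := hfgt _ (hs m2).1 (by linarith)
    have h3 := hf _ m1
    have h4 := hf _ m2
    have h5 := hf z hlr
    linarith

end RealExpansion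

theorem theoremE (L : FirstOrder.Language.{u, v}) [L.Structure ℝ]
    (φ : RealExpansion.ordAddLang →ᴸ L) [φ.IsExpansionOn ℝ] :
    (∀ (a b : ℝ) (f : ℝ → ℝ), a < b → RealExpansion.IsDefFunOn L f a b →
      ContDiffOn ℝ 1 f (Set.Ioo a b) → ¬ RealExpansion.IsAffineOn f a b →
        (RealExpansion.DerivStrictMonoSomewhere f a b → RealExpansion.IsFieldType L) ∧
        (¬ RealExpansion.DerivStrictMonoSomewhere f a b →
          RealExpansion.DefinesSecondOrderArithmetic L) ∧
        (ContDiffOn ℝ 2 f (Set.Ioo a b) → RealExpansion.IsFieldType L)) ∧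
    (¬ RealExpansion.DefinesSecondOrderArithmetic L →
      ((∃ (a b : ℝ) (f : ℝ → ℝ), a < b ∧ RealExpansion.IsDefFunOn L f a b ∧
          ContDiffOn ℝ 1 f (Set.Ioo a b) ∧ ¬ RealExpansion.IsAffineOn f a b) ↔
        RealExpansion.IsFieldType L)) := by
  have h := RealExpansion.langStr_ordGroup L φ
  refine ⟨fun a b f hab hf hC hna => ⟨fun hm => ?_, fun hm => ?_, fun hC2 => ?_⟩,
    fun hno => ⟨?_, fun hL => ?_⟩⟩
  · exact RealExpansion.isFieldType_of_derivStrictMonoSomewhere L h hf hC hm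
  · exact RealExpansion.definesSecondOrderArithmetic_of_not_derivStrictMonoSomewhere L h hab hf hC
      hna hm
  · exact RealExpansion.isFieldType_of_derivStrictMonoSomewhere L h hf hC
      (RealExpansion.derivStrictMonoSomewhere_of_contDiffOn_two hab hC2 hna)
  · rintro ⟨a, b, f, hab, hf, hC, hna⟩
    by_cases hm : RealExpansion.DerivStrictMonoSomewhere f a b
    · exact RealExpansion.isFieldType_of_derivStrictMonoSomewhere L h hf hC hm
    · exact absurd (RealExpansion.definesSecondOrderArithmetic_of_not_derivStrictMonoSomewhere L h
        hab hf hC hna hm) hno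
  · exact hL.exists_contDiffOn_not_isAffineOn h fun hs =>
      hno (RealExpansion.definesSecondOrderArithmetic_of_langStr L hs)
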